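/- **Setting.** Let $0<\epsilon\le 1/32$ and put $\Gamma=\frac{12}{\epsilon}$, $\alpha=\epsilon^{\frac1\epsilon+1}$, $H_\epsilon=(\frac1\epsilon)^{\frac2\epsilon+1}$. Let $T=(V,E)$ be a finite rooted tree with edge weights $w\ge 0$, whose root $r$ is the depot, in which every non-leaf vertex has exactly two children; the terminals are the leaves, and $k\ge 1$ is the tour capacity. Let $\mathrm{dist}(v)$ be the distance from $r$ to $v$ in $T$, let $D_{\min}$ and $D_{\max}$ be the minimum and maximum of $\mathrm{dist}$ over the terminals, and assume that $D_{\max}<(\frac1\epsilon)^{\frac1\epsilon-1}D_{\min}$ (bounded distances). In the unit demand CVRP, a tour is a closed walk from the depot together with a set of terminals on it that it visits (picks up); a feasible solution is a finite collection of tours, each visiting at most $k$ terminals, such that each terminal is visited by exactly one tour; its cost is the total weight of its walks, and $\mathrm{opt}$ is the optimal cost on $T$. A *component decomposition* of $T$ is a partition $\mathcal C$ of $E$ into non-empty connected sets (components) such that, writing $r_c$ for the vertex of $c$ closest to the depot: a component $c$ containing all descendants of $r_c$ (a *leaf* component) shares no vertex other than $r_c$ with other components; every other component $c$ (an *internal*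 component) has an *exit vertex* $e_c\ne r_c$ that it shares with some other component, and shares no vertices other than $r_c,e_c$ with other components; every component contains at most $2\Gamma k$ terminals; and, if $|\mathcal C|>1$, every leaf component is *big*, i.e. contains at least $\Gamma k$ terminals, and there is a map from $\mathcal C$ to the big components that sends each component to itself or to a component descending from it, with at most three pre-images for each big component. Let $\tilde D=\alpha\epsilon D_{\min}$, and for $i\ge 1$ let $\mathcal C_i$ be the set of $c\in\mathcal C$ with $\mathrm{dist}(r_c)\in[(i-1)\tilde D,i\tilde D)$. For a maximally connected set $\tilde{\mathcal C}\subseteq\mathcal C_i$ of components (components being adjacent when they share a vertex), its critical vertex $z$ is the root of the component of $\tilde{\mathcal C}$ closest to the depot. The tree $\hat T$ is obtained from $T$ by doing the following for every $i$, every such $\tilde{\mathcal C}$ and every $c\in\tilde{\mathcal C}$: split $T$ at $r_c$, i.e. give $c$ its own duplicate of $r_c$, and join this duplicate to $z$ by an edge whose weight is the $r_c$-to-$z$ distance in $T$. The vertices of $c$ in $\hat T$ are this duplicate and the vertices of $c$ other than $r_c$. **Theorem.** $T$ has a component decomposition. For every component decomposition $\mathcal C$, the graph $\hat T$ is a tree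 with non-negative edge weights, and every path of $\hat T$ from the root meets at most $\lceil H_\epsilon\rceil$ components. Moreover, there exist finitely many dummy terminals at internal (non-leaf) vertices of $\hat T$, and a feasible solution $\mathrm{OPT}_2$ of the unit demand CVRP on $\hat T$ with capacity $k$ visiting all real and dummy terminals, such that: 1. for each component $c$, at most $\frac{2\Gamma}{\alpha}+1$ tours visit (real or dummy) terminals in $c$; 2. for each component $c$ and each tour $t$ visiting terminals in $c$, the number of (real and dummy) terminals in $c$ visited by $t$ is at least $\alpha k$; 3. the cost $\mathrm{opt}_2$ of $\mathrm{OPT}_2$ satisfies $\mathrm{opt}_2<(1+3\epsilon)\cdot\mathrm{opt}$. -/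

import Mathlib

namespace CVRP

noncomputable section

/-- A graph with a distinguished vertex (the depot) and edge weights. -/
structure Network (V : Type*) where
  graph : SimpleGraph V
  root : V
  weight : Sym2 V → ℝ

namespace Network

variable {V : Type*} (N : Network V)

/-! ### Weighted rooted trees -/

/-- The network is a rooted tree with non-negative edge weights. -/
def IsWeightedTree : Prop :=
  N.graph.IsTree ∧ ∀ e ∈ N.graph.edgeSet, 0 ≤ N.weight e

/-- The total weight of the edges on a walk, counted with multiplicity. -/
def cost {u v : V} (p : N.graph.Walk u v) : ℝ :=
  (p.edges.map N.weight).sum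

/-- The weighted distance between two vertices. -/
def wdist (u v : V) : ℝ :=
  ⨅ p : N.graph.Walk u v, N.cost p

/-- The distance of a vertex to the depot. -/
def depotDist (v : V) : ℝ :=
  N.wdist N.root v

/-- `u` lies on the path from the root to `v` (possibly `u = v`). -/
def IsAncestor (u v : V) : Prop :=
  ∃ p : N.graph.Walk N.root v, p.IsPath ∧ u ∈ p.support

/-- `v` is a child of `u`. -/
def IsChild (u v : V) : Prop :=
  N.graph.Adj u v ∧ N.IsAncestor u v

/-- A leaf is a vertex without children. -/
def IsLeaf (v : V) : Prop :=
  ∀ u, ¬ N.IsChild v u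

/-- Every vertex that is not a leaf has exactly two children. -/
def IsBinary : Prop :=
  ∀ v, ¬ N.IsLeaf v → {u | N.IsChild v u}.ncard = 2

/-- The terminals are the leaves. -/
def terminals : Set V :=
  {v | N.IsLeaf v}

/-- The minimum distance between the depot and a terminal. -/
def Dmin : ℝ :=
  sInf (N.depotDist '' N.terminals)

/-- The maximum distance between the depot and a terminal. -/
def Dmax : ℝ :=
  sSup (N.depotDist '' N.terminals)

/-- Bounded distances: `D_max < (1/ε)^(1/ε - 1) * D_min`. -/
def HasBoundedDistances (ε : ℝ) : Prop :=
  N.Dmax < (1 / ε) ^ (1 / ε - 1) * N.Dmin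

/-! ### Tours and solutions of the unit demand problem -/

/-- A tour for the tokens `x : X`, the token `x` being placed on the vertex `loc x`: a closed walk
from the depot together with the set of the tokens that it picks up. A tour may go through the
vertex of a token without picking up that token. -/
structure Tour {X : Type*} (loc : X → V) where
  walk : N.graph.Walk N.root N.root
  visited : Finset X
  visited_on_walk : ∀ x ∈ visited, loc x ∈ walk.support

variable {N}

/-- A collection of tours is feasible for the capacity `k` if each tour visits at most `k` tokens
and each token is visited by exactly one tour. -/
def IsFeasible {X : Type*} {loc : X → V} (k : ℕ) {n : ℕ} (S : Fin n → N.Tour loc) : Prop :=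
  (∀ i, (S i).visited.card ≤ k) ∧ ∀ x, ∃! i, x ∈ (S i).visited

/-- The total cost of a collection of tours. -/
def totalCost {X : Type*} {loc : X → V} {n : ℕ} (S : Fin n → N.Tour loc) : ℝ :=
  ∑ i, N.cost (S i).walk

variable (N)

/-- The optimal cost of the unit demand problem with one token on each terminal. -/
def opt (k : ℕ) : ℝ :=
  sInf {x | ∃ (n : ℕ) (S : Fin n → N.Tour (Subtype.val : N.terminals → V)),
    IsFeasible k S ∧ totalCost S = x}

end Network

/-! ### The constants -/

/-- The constant `Γ = 12/ε`. -/
def Γ (ε : ℝ) : ℝ := 12 / ε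

/-- The constant `α = ε^(1/ε + 1)`. -/
def α (ε : ℝ) : ℝ := ε ^ (1 / ε + 1)

/-- The constant `H_ε = (1/ε)^(2/ε + 1)`. -/
def H (ε : ℝ) : ℝ := (1 / ε) ^ (2 / ε + 1)

namespace Network

variable {V : Type*} (N : Network V)

/-! ### Components. A component is a set of edges. -/

/-- The vertices of a component. -/
def verts (c : Set (Sym2 V)) : Set V :=
  {v | ∃ e ∈ c, v ∈ e}

/-- `v` is the vertex of `c` closest to the depot: a vertex of `c` that is an ancestor of every
vertex of `c`. -/
def IsCompRoot (c : Set (Sym2 V)) (v : V) : Prop :=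
  v ∈ verts c ∧ ∀ u ∈ verts c, N.IsAncestor v u

/-- The root vertex `r_c` of a component `c`
(exists and is unique when `c` is a non-empty connected set of edges of a tree). -/
def compRoot (c : Set (Sym2 V)) : V :=
  @Classical.epsilon V ⟨N.root⟩ (N.IsCompRoot c)

/-- A leaf component contains all descendants of its root; other components are internal. -/
def IsLeafComp (c : Set (Sym2 V)) : Prop :=
  ∀ v, N.IsAncestor (N.compRoot c) v → v ∈ verts c

/-- The number of terminals in a component. -/
def numTerminals (c : Set (Sym2 V)) : ℕ :=
  (verts c ∩ N.terminals).ncard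

/-- A component is big if it contains at least `Γ k` terminals. -/
def IsBig (ε : ℝ) (k : ℕ) (c : Set (Sym2 V)) : Prop :=
  Γ ε * k ≤ N.numTerminals c

/-- The component `d` is `c` itself or hangs below a vertex of `c` other than the root of `c`. -/
def IsDescComp (c d : Set (Sym2 V)) : Prop :=
  d = c ∨ ∃ v ∈ verts c, v ≠ N.compRoot c ∧ N.IsAncestor v (N.compRoot d)

/-- Decompositions of the edges of the tree into components. -/
structure IsDecomposition (ε : ℝ) (k : ℕ) (𝒞 : Set (Set (Sym2 V))) : Prop where
  /-- the components form a partition of the edges -/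
  nonempty : ∀ c ∈ 𝒞, c.Nonempty
  disjoint : 𝒞.PairwiseDisjoint id
  sUnion_eq : ⋃₀ 𝒞 = N.graph.edgeSet
  /-- each component is connected -/
  connected : ∀ c ∈ 𝒞, ∀ u ∈ verts c, ∀ v ∈ verts c, (SimpleGraph.fromEdgeSet c).Reachable u v
  /-- a leaf component meets other components at its root only -/
  leaf_inter : ∀ c ∈ 𝒞, N.IsLeafComp c → ∀ d ∈ 𝒞, d ≠ c → verts c ∩ verts d ⊆ {N.compRoot c}
  /-- an internal component meets other components at its root and at its exit vertex only -/
  exit : ∀ c ∈ 𝒞, ¬ N.IsLeafComp c → ∃ e ∈ verts c, e ≠ N.compRoot c ∧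
    (∃ d ∈ 𝒞, d ≠ c ∧ e ∈ verts d) ∧
    ∀ d ∈ 𝒞, d ≠ c → verts c ∩ verts d ⊆ {N.compRoot c, e}
  numTerminals_le : ∀ c ∈ 𝒞, (N.numTerminals c : ℝ) ≤ 2 * Γ ε * k
  leaf_big : 1 < 𝒞.ncard → ∀ c ∈ 𝒞, N.IsLeafComp c → N.IsBig ε k c
  /-- a map from all components to big components, the image of a component being among its
  descendants, such that each big component has at most three pre-images -/
  big_map : 1 < 𝒞.ncard → ∃ f : 𝒞 → 𝒞,
    (∀ c : 𝒞, N.IsBig ε k (f c)) ∧ (∀ c : 𝒞, N.IsDescComp c (f c)) ∧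
    ∀ b : 𝒞, {c : 𝒞 | f c = b}.ncard ≤ 3

/-! ### The height-reduced tree -/

/-- The length `α ε D_min` of the distance classes. -/
def classWidth (ε : ℝ) : ℝ :=
  α ε * ε * N.Dmin

/-- The class `𝒞_i` of the components whose root has distance in `[(i-1) D, i D)` to the depot,
where `D = α ε D_min`. -/
def compClass (ε : ℝ) (𝒞 : Set (Set (Sym2 V))) (i : ℕ) : Set (Set (Sym2 V)) :=
  {c ∈ 𝒞 | ((i : ℝ) - 1) * N.classWidth ε ≤ N.depotDist (N.compRoot c) ∧
    N.depotDist (N.compRoot c) < i * N.classWidth ε}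

/-- Two distinct components are adjacent if they share a vertex. -/
def compGraph (V : Type*) : SimpleGraph (Set (Sym2 V)) :=
  SimpleGraph.fromRel fun c d => (verts c ∩ verts d).Nonempty

/-- `S` is a maximally connected set of components within the class `𝒞_i`. -/
def IsMaxConnected (ε : ℝ) (𝒞 : Set (Set (Sym2 V))) (i : ℕ) (S : Set (Set (Sym2 V))) : Prop :=
  Maximal (fun S' => S' ⊆ N.compClass ε 𝒞 i ∧ ((compGraph V).induce S').Connected) S

/-- `z` is the critical vertex of `S`: the root of the component of `S` closest to the depot. -/
def IsCritical (S : Set (Set (Sym2 V))) (z : V) : Prop :=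
  ∃ c ∈ S, z = N.compRoot c ∧ ∀ d ∈ S, N.IsAncestor z (N.compRoot d)

/-- `z` is the critical vertex of the maximally connected set that contains `c`. -/
def IsCriticalFor (ε : ℝ) (𝒞 : Set (Set (Sym2 V))) (c : Set (Sym2 V)) (z : V) : Prop :=
  ∃ (i : ℕ) (S : Set (Set (Sym2 V))),
    1 ≤ i ∧ N.IsMaxConnected ε 𝒞 i S ∧ c ∈ S ∧ N.IsCritical S z

/-- Adjacency in the height-reduced tree (before symmetrization). The vertex `Sum.inr c` is the
duplicate of `r_c` obtained when the tree is split at the root of `c`; it takes over the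
edges of `c` at `r_c`, and is joined to the critical vertex. The vertex `Sum.inl v` is what remains
of `v` after all splits. -/
def hatRel (ε : ℝ) (𝒞 : Set (Set (Sym2 V))) : V ⊕ 𝒞 → V ⊕ 𝒞 → Prop
  | Sum.inl u, Sum.inl v => ∃ c ∈ 𝒞, s(u, v) ∈ c ∧ u ≠ N.compRoot c ∧ v ≠ N.compRoot c
  | Sum.inl u, Sum.inr c => s(u, N.compRoot c.1) ∈ c.1 ∨ N.IsCriticalFor ε 𝒞 c.1 u
  | Sum.inr _, _ => False

open Classical in
/-- The weight of the pair of `u` and the duplicate of `r_c`: an edge of `c` keeps its weight, the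
new edge to the critical vertex `u` has as weight the distance between `r_c` and `u` in the original
tree. -/
def hatRootWeight (c : Set (Sym2 V)) (u : V) : ℝ :=
  if s(u, N.compRoot c) ∈ c then N.weight s(u, N.compRoot c) else N.wdist (N.compRoot c) u

/-- Edge weights in the height-reduced tree. -/
def hatWeightAux (𝒞 : Set (Set (Sym2 V))) : V ⊕ 𝒞 → V ⊕ 𝒞 → ℝ
  | Sum.inl u, Sum.inl v => N.weight s(u, v)
  | Sum.inl u, Sum.inr c => N.hatRootWeight c.1 u
  | Sum.inr c, Sum.inl u => N.hatRootWeight c.1 u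
  | Sum.inr _, Sum.inr _ => 0

theorem hatWeightAux_comm (𝒞 : Set (Set (Sym2 V))) (a b : V ⊕ 𝒞) :
    N.hatWeightAux 𝒞 a b = N.hatWeightAux 𝒞 b a := by
  cases a <;> cases b <;> simp [hatWeightAux, Sym2.eq_swap]

/-- The height-reduced tree. -/
def hat (ε : ℝ) (𝒞 : Set (Set (Sym2 V))) : Network (V ⊕ 𝒞) where
  graph := SimpleGraph.fromRel (N.hatRel ε 𝒞)
  root := Sum.inl N.root
  weight := Sym2.lift ⟨N.hatWeightAux 𝒞, N.hatWeightAux_comm 𝒞⟩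

/-- The vertices of the component `c` in the height-reduced tree. -/
def hatVerts {𝒞 : Set (Set (Sym2 V))} (c : 𝒞) : Set (V ⊕ 𝒞) :=
  {Sum.inr c} ∪ Sum.inl '' (verts c.1 \ {N.compRoot c.1})

/-- Positions of the tokens in the height-reduced tree: the real terminals are where they were, and
there are `m` dummy terminals at the vertices `D j`. -/
def hatLoc {𝒞 : Set (Set (Sym2 V))} {m : ℕ} (D : Fin m → V ⊕ 𝒞) : N.terminals ⊕ Fin m → V ⊕ 𝒞 :=
  Sum.elim (fun v => Sum.inl v.1) D

end Network

end

end CVRP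

/-!
A finite tree network is encoded by the parent function of the tree (`RTree`, `Network.Represents`).
A non-root vertex then stands for the edge to its parent, a set of edges is a finite set of
vertices, and a tour visiting a set `U` of vertices costs at least twice the weight of `R.span U`,
the subtree spanned by the root and `U` (`two_mul_span_le_cost`); this weight is attained by a walk
around the subtree (`exists_closed_walk`). Hence only the assignment of the terminals to tours
matters.

*Existence of a decomposition.* Components are cut off from the leaves upwards
(`RTree.exists_isCharging`). A component with at least `Γ k` terminals can be charged three times:
once by itself, and twice more. Whenever two such parts meet below a vertex, each of them
is closed by a possibly small component that uses one of its two spare charges, and one spare charge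
is left on both sides. What remains above the last cut has less than `Γ k` terminals, and
becomes one more component (`Represents.exists_isDecomposition`).

*The height-reduced tree.* Attaching the components to their critical vertices keeps the distances
to the root (`hat_dist`), and along a path from the root the distance classes of the components
increase strictly (`card_comp_anc_le`). As `D_max` is less than `H_ε` times the width `αεD_min` of
a class, this bounds the number of components on a path (`ncard_comp_path_le`). A tour that visits
`t` components gets longer by at most `2t` times the width of a class (`hat_span_le`). If it visits
at least `αk` terminals in each of them, then `t ≤ 1/α`, and the additional cost is at most
`2εD_min`, hence at most `ε` times the cost of the tour.

*Redistribution of small pieces.* The terminals of a tour in a component form a piece. Pieces of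
less than `αk` terminals are regrouped (`exists_redistribution`): in each component, separately
for the tours that pass through the component to terminals elsewhere and for those that do not, the
small pieces are collected in groups of total size in `[αk, 2αk)` (`exists_grouping`). Every group
is shared by the tours that contribute to it, and rounding a fractional assignment of minimal
support gives all groups, except for at most one per tour, to a tour that contributes to it, such
that no tour gets more terminals in total (`exists_partial_assignment`). The unassigned groups of
each component fill bins, new tours that take up to `⌊1/(2α)⌋` groups each; the leftovers of a
component go to its first bin, which is filled up with dummy terminals at the duplicate of the root
of the component if necessary.

A tour that receives a group in a component goes through the component if and only if the tours that
gave it do so. Therefore every edge that is needed to visit a group either was used by the receiving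
tour already, or was used by a giving tour for its small piece only and is not needed there anymore.
Only the bins need additional edges, on the paths from the root to the exit vertices
(`sum_redistributed_le`). For the first bin of each component, these paths are paid for by the
terminals, as every component is charged to a component below it with at least `Γ k` terminals
(`sum_dist_top_le`). There is at most one unassigned group per tour, so the number of further bins
is at most `4α` times the number of tours, and `αD_max < ε²D_min` by the assumption of bounded
distances (`sum_bins_mul_dist_exit_le`). Altogether the cost grows by a factor of at most
`(1 + ε)(1 + ε/2 + 4ε²) ≤ 1 + 2ε`, and applying this to a solution that is close enough to the
optimum gives a cost less than `(1 + 3ε) opt`.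
-/

namespace CVRP

noncomputable section

open Classical Finset

/-! ### Rooted trees given by a parent function -/

/-- A rooted tree on `V`, encoded by its parent function. The root is its own parent, and a rank
that decreases strictly from a vertex to its parent rules out cycles. -/
structure RTree (V : Type*) where
  root : V
  par : V → V
  rank : V → ℕ
  par_root : par root = root
  rank_par : ∀ v, v ≠ root → rank (par v) < rank v

namespace RTree

variable {V : Type*} (R : RTree V)

/-- `u` is `v` itself or an iterated parent of `v`. -/
def Anc (u v : V) : Prop := ∃ n : ℕ, R.par^[n] v = u

variable {R}

theorem Anc.refl (v : V) : R.Anc v v := ⟨0, rfl⟩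

theorem Anc.trans {u v w : V} (h : R.Anc u v) (h' : R.Anc v w) : R.Anc u w := by
  obtain ⟨n, rfl⟩ := h
  obtain ⟨m, rfl⟩ := h'
  exact ⟨n + m, Function.iterate_add_apply _ _ _ _⟩

theorem anc_par (v : V) : R.Anc (R.par v) v := ⟨1, rfl⟩

theorem anc_iff {u v : V} : R.Anc u v ↔ u = v ∨ v ≠ R.root ∧ R.Anc u (R.par v) := by
  constructor
  · rintro ⟨n, rfl⟩
    cases n with
    | zero => exact Or.inl rfl
    | succ n =>
      by_cases hv : v = R.root
      · left
        rw [hv]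
        exact Function.iterate_fixed R.par_root _
      · exact Or.inr ⟨hv, n, rfl⟩
  · rintro (rfl | ⟨-, h⟩)
    · exact Anc.refl _
    · exact h.trans (anc_par v)

theorem anc_of_ne {u v : V} (h : R.Anc u v) (hne : u ≠ v) : v ≠ R.root ∧ R.Anc u (R.par v) :=
  (anc_iff.1 h).resolve_left hne

theorem rank_par_le (v : V) : R.rank (R.par v) ≤ R.rank v := by
  by_cases h : v = R.root
  · rw [h, R.par_root]
  · exact (R.rank_par v h).le

theorem Anc.rank_le {u v : V} (h : R.Anc u v) : R.rank u ≤ R.rank v := by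
  obtain ⟨n, rfl⟩ := h
  induction n with
  | zero => exact le_rfl
  | succ n ih =>
    rw [Function.iterate_succ_apply']
    exact (rank_par_le _).trans ih

theorem Anc.rank_lt {u v : V} (h : R.Anc u v) (hne : u ≠ v) : R.rank u < R.rank v := by
  obtain ⟨h1, h2⟩ := anc_of_ne h hne
  exact h2.rank_le.trans_lt (R.rank_par v h1)

theorem Anc.antisymm {u v : V} (h : R.Anc u v) (h' : R.Anc v u) : u = v := by
  by_contra hne
  exact absurd (h.rank_lt hne) (not_lt.2 h'.rank_le)

theorem Anc.total {a b v : V} (ha : R.Anc a v) (hb : R.Anc b v) : R.Anc a b ∨ R.Anc b a := by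
  obtain ⟨n, rfl⟩ := ha
  obtain ⟨m, rfl⟩ := hb
  rcases le_total n m with h | h
  · right
    obtain ⟨k, rfl⟩ := Nat.exists_eq_add_of_le' h
    exact ⟨k, (Function.iterate_add_apply _ _ _ _).symm⟩
  · left
    obtain ⟨k, rfl⟩ := Nat.exists_eq_add_of_le' h
    exact ⟨k, (Function.iterate_add_apply _ _ _ _).symm⟩

/-- Induction from the root towards the leaves. -/
theorem induction_on {P : V → Prop} (v : V) (h : ∀ v, (∀ u, R.rank u < R.rank v → P u) → P v) :
    P v := by
  induction hn : R.rank v using Nat.strong_induction_on generalizing v with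
  | _ n ih => exact h v fun u hu => ih _ (hn ▸ hu) u rfl

theorem root_anc (v : V) : R.Anc R.root v := by
  refine R.induction_on v fun v ih => ?_
  by_cases hv : v = R.root
  · rw [hv]; exact Anc.refl _
  · exact (ih _ (R.rank_par v hv)).trans (anc_par v)

theorem anc_root {u : V} (h : R.Anc u R.root) : u = R.root := h.antisymm (root_anc u)

theorem Anc.ne_root {u v : V} (h : R.Anc u v) (hu : u ≠ R.root) : v ≠ R.root := by
  rintro rfl
  exact hu (anc_root h)

theorem par_ne {v : V} (hv : v ≠ R.root) : R.par v ≠ v := fun h => by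
  have := R.rank_par v hv
  rw [h] at this
  exact lt_irrefl _ this

theorem not_anc_par {v : V} (hv : v ≠ R.root) : ¬ R.Anc v (R.par v) := fun h =>
  par_ne hv ((anc_par v).antisymm h)

variable [Fintype V] (R)

/-- The vertices on the path from the root to `v`. -/
def anc (v : V) : Finset V := univ.filter fun a => R.Anc a v

/-- The vertices of the subtree spanned by the root and `U`. -/
def span (U : Finset V) : Finset V := univ.filter fun a => ∃ u ∈ U, R.Anc a u

variable {R}

@[simp] theorem mem_anc {a v : V} : a ∈ R.anc v ↔ R.Anc a v := by simp [anc]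

@[simp] theorem mem_span {a : V} {U : Finset V} : a ∈ R.span U ↔ ∃ u ∈ U, R.Anc a u := by
  simp [span]

/-- The weighted distance of `v` to the root; `wt a` stands for the weight of the edge between `a`
and its parent. -/
def dist (R : RTree V) (wt : V → ℝ) (v : V) : ℝ := ∑ a ∈ R.anc v, wt a

variable {wt : V → ℝ}

theorem anc_subset {u v : V} (h : R.Anc u v) : R.anc u ⊆ R.anc v := fun a ha => by
  simp only [mem_anc] at *
  exact ha.trans h

theorem anc_eq_insert [DecidableEq V] {v : V} (hv : v ≠ R.root) :
    R.anc v = insert v (R.anc (R.par v)) := by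
  ext a
  simp only [mem_anc, mem_insert]
  rw [anc_iff]
  simp [hv]

theorem dist_eq_add {v : V} (hv : v ≠ R.root) : R.dist wt v = wt v + R.dist wt (R.par v) := by
  rw [dist, anc_eq_insert hv, sum_insert (by simpa using not_anc_par hv)]
  rfl

theorem dist_root (h0 : wt R.root = 0) : R.dist wt R.root = 0 := by
  have : R.anc R.root = {R.root} := by
    ext a
    simp only [mem_anc, mem_singleton]
    exact ⟨anc_root, fun h => h ▸ Anc.refl _⟩
  rw [dist, this, sum_singleton, h0]

theorem dist_nonneg (hw : ∀ v, 0 ≤ wt v) (v : V) : 0 ≤ R.dist wt v := sum_nonneg fun a _ => hw a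

theorem dist_mono (hw : ∀ v, 0 ≤ wt v) {u v : V} (h : R.Anc u v) : R.dist wt u ≤ R.dist wt v :=
  sum_le_sum_of_subset_of_nonneg (anc_subset h) fun a _ _ => hw a

theorem sum_anc_sdiff [DecidableEq V] {u v : V} (h : R.Anc u v) :
    ∑ a ∈ R.anc v \ R.anc u, wt a = R.dist wt v - R.dist wt u := by
  rw [eq_sub_iff_add_eq]
  exact sum_sdiff (anc_subset h)

theorem dist_le_span (hw : ∀ v, 0 ≤ wt v) {u : V} {U : Finset V} (hu : u ∈ U) :
    R.dist wt u ≤ ∑ a ∈ R.span U, wt a :=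
  sum_le_sum_of_subset_of_nonneg (fun _ ha => mem_span.2 ⟨u, hu, mem_anc.1 ha⟩) fun a _ _ => hw a

theorem anc_mem_span {a b : V} {U : Finset V} (h : R.Anc a b) (hb : b ∈ R.span U) :
    a ∈ R.span U := by
  obtain ⟨u, hu, h'⟩ := mem_span.1 hb
  exact mem_span.2 ⟨u, hu, h.trans h'⟩

end RTree

/-! ### Networks with a parent function -/

namespace Network

variable {V : Type*}

/-- The graph of `N` is the rooted tree `R`: the edges join the non-root vertices to their
parents. -/
structure Represents (N : Network V) (R : RTree V) : Prop where
  root_eq : N.root = R.root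
  adj_iff : ∀ u v, N.graph.Adj u v ↔ (u ≠ R.root ∧ R.par u = v) ∨ (v ≠ R.root ∧ R.par v = u)

/-- The weight of the edge between `v` and its parent (zero for the root). -/
def parWt (N : Network V) (R : RTree V) (v : V) : ℝ :=
  if v = R.root then 0 else N.weight s(v, R.par v)

namespace Represents

variable {N : Network V} {R : RTree V}

theorem parWt_root : N.parWt R R.root = 0 := if_pos rfl

theorem parWt_of_ne {v : V} (hv : v ≠ R.root) : N.parWt R v = N.weight s(v, R.par v) := if_neg hv

theorem edge_inj {a b : V} (ha : a ≠ R.root) (hb : b ≠ R.root)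
    (hab : s(a, R.par a) = s(b, R.par b)) : a = b := by
  rcases Sym2.eq_iff.1 hab with ⟨h1, -⟩ | ⟨h1, h2⟩
  · exact h1
  · have h3 := R.rank_par a ha
    have h4 := R.rank_par b hb
    rw [h2] at h3
    rw [← h1] at h4
    omega

theorem adj_par {v : V} (h : N.Represents R) (hv : v ≠ R.root) : N.graph.Adj v (R.par v) :=
  (h.adj_iff _ _).2 (Or.inl ⟨hv, rfl⟩)

theorem mem_edgeSet_iff (h : N.Represents R) {e : Sym2 V} :
    e ∈ N.graph.edgeSet ↔ ∃ v, v ≠ R.root ∧ e = s(v, R.par v) := by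
  induction e with
  | _ x y =>
    rw [SimpleGraph.mem_edgeSet, h.adj_iff]
    constructor
    · rintro (⟨h1, rfl⟩ | ⟨h1, rfl⟩)
      · exact ⟨x, h1, rfl⟩
      · exact ⟨y, h1, Sym2.eq_swap⟩
    · rintro ⟨v, hv, he⟩
      rcases Sym2.eq_iff.1 he with ⟨rfl, rfl⟩ | ⟨rfl, rfl⟩
      · exact Or.inl ⟨hv, rfl⟩
      · exact Or.inr ⟨hv, rfl⟩

theorem parWt_nonneg (h : N.Represents R) (hw : ∀ e ∈ N.graph.edgeSet, 0 ≤ N.weight e) (v : V) :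
    0 ≤ N.parWt R v := by
  by_cases hv : v = R.root
  · rw [hv, parWt_root]
  · rw [parWt_of_ne hv]
    exact hw _ (h.adj_par hv)

theorem exists_path (h : N.Represents R) (v : V) :
    ∃ p : N.graph.Walk R.root v, p.IsPath ∧ ∀ a, a ∈ p.support ↔ R.Anc a v := by
  induction v using RTree.induction_on (R := R) with | _ v ih
  by_cases hv : v = R.root
  · subst hv
    exact ⟨SimpleGraph.Walk.nil, SimpleGraph.Walk.IsPath.nil, fun a => by
      simpa using ⟨fun h => h ▸ RTree.Anc.refl _, RTree.anc_root⟩⟩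
  · obtain ⟨p, hp, hs⟩ := ih _ (R.rank_par v hv)
    refine ⟨p.concat (h.adj_par hv).symm, ?_, fun a => ?_⟩
    · rw [SimpleGraph.Walk.concat_isPath_iff]
      exact ⟨hp, fun hm => RTree.not_anc_par hv ((hs v).1 hm)⟩
    · rw [SimpleGraph.Walk.support_concat, List.mem_append, hs,
        RTree.anc_iff (v := v)]
      simp [hv, or_comm]

/-- A walk that leaves the subtree of `a` uses the edge between `a` and its parent. -/
theorem mem_edges_of_anc (h : N.Represents R) {a u v : V} (p : N.graph.Walk u v) (hu : R.Anc a u)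
    (hv : ¬ R.Anc a v) : s(a, R.par a) ∈ p.edges := by
  induction p with
  | nil => exact absurd hu hv
  | @cons u w v hadj p ih =>
    rw [SimpleGraph.Walk.edges_cons, List.mem_cons]
    by_cases hw : R.Anc a w
    · exact Or.inr (ih hw hv)
    · left
      rcases (h.adj_iff _ _).1 hadj with ⟨h1, rfl⟩ | ⟨h1, rfl⟩
      · by_cases ha : a = u
        · rw [ha]
        · exact absurd (RTree.anc_of_ne hu ha).2 hw
      · exact absurd (hu.trans (RTree.anc_par w)) hw

theorem mem_edges_of_anc' (h : N.Represents R) {a u v : V} (p : N.graph.Walk u v)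
    (hu : ¬ R.Anc a u) (hv : R.Anc a v) : s(a, R.par a) ∈ p.edges := by
  have := h.mem_edges_of_anc p.reverse hv hu
  rwa [SimpleGraph.Walk.edges_reverse, List.mem_reverse] at this

theorem connected (h : N.Represents R) : N.graph.Connected := by
  have h0 : ∀ v, N.graph.Reachable R.root v := fun v => (h.exists_path v).elim fun p _ => ⟨p⟩
  exact (SimpleGraph.connected_iff _).2 ⟨fun u v => (h0 u).symm.trans (h0 v), ⟨R.root⟩⟩

theorem isTree (h : N.Represents R) : N.graph.IsTree := by
  refine ⟨h.connected, ?_⟩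
  rw [SimpleGraph.isAcyclic_iff_forall_isBridge]
  intro e he
  obtain ⟨v, hv, rfl⟩ := h.mem_edgeSet_iff.1 he
  rw [SimpleGraph.isBridge_iff_forall_walk_mem_edges]
  exact fun p => h.mem_edges_of_anc p (RTree.Anc.refl v) (RTree.not_anc_par hv)

theorem path_support (h : N.Represents R) {v : V} (p : N.graph.Walk R.root v) (hp : p.IsPath)
    (a : V) : a ∈ p.support ↔ R.Anc a v := by
  obtain ⟨q, hq, hs⟩ := h.exists_path v
  rw [(h.isTree.existsUnique_path _ _).unique hp hq]
  exact hs a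

theorem isAncestor_iff (h : N.Represents R) {u v : V} : N.IsAncestor u v ↔ R.Anc u v := by
  unfold IsAncestor
  rw [h.root_eq]
  constructor
  · rintro ⟨p, hp, hu⟩
    exact (h.path_support p hp u).1 hu
  · intro hu
    obtain ⟨p, hp, hs⟩ := h.exists_path v
    exact ⟨p, hp, (hs u).2 hu⟩

theorem isChild_iff (h : N.Represents R) {u v : V} :
    N.IsChild u v ↔ v ≠ R.root ∧ R.par v = u := by
  unfold IsChild
  rw [h.isAncestor_iff, h.adj_iff]
  constructor
  · rintro ⟨⟨h1, h2⟩ | h1, h3⟩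
    · exact absurd (h2 ▸ h3) (RTree.not_anc_par h1)
    · exact h1
  · rintro ⟨h1, rfl⟩
    exact ⟨Or.inr ⟨h1, rfl⟩, RTree.anc_par v⟩

theorem isLeaf_iff (h : N.Represents R) {v : V} :
    N.IsLeaf v ↔ ∀ u, u ≠ R.root → R.par u ≠ v := by
  simp only [IsLeaf, h.isChild_iff, not_and, ne_eq]

theorem cost_append {u v w : V} (p : N.graph.Walk u v) (q : N.graph.Walk v w) :
    N.cost (p.append q) = N.cost p + N.cost q := by
  simp [cost]

theorem cost_nonneg (hw : ∀ e ∈ N.graph.edgeSet, 0 ≤ N.weight e) {u v : V}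
    (p : N.graph.Walk u v) : 0 ≤ N.cost p := by
  refine List.sum_nonneg fun x hx => ?_
  obtain ⟨e, he, rfl⟩ := List.mem_map.1 hx
  exact hw e (p.edges_subset_edgeSet he)

/-- A walk costs at least the total weight of any set of edges that it uses. -/
theorem sum_parWt_le_cost (hw : ∀ e ∈ N.graph.edgeSet, 0 ≤ N.weight e)
    {u v : V} (p : N.graph.Walk u v) (A : Finset V)
    (hA : ∀ a ∈ A, a ≠ R.root → s(a, R.par a) ∈ p.edges) :
    ∑ a ∈ A, N.parWt R a ≤ N.cost p := by
  have h1 : ∑ a ∈ A, N.parWt R a = ∑ a ∈ A.filter (· ≠ R.root), N.weight s(a, R.par a) := by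
    rw [sum_filter]
    refine sum_congr rfl fun a _ => ?_
    by_cases ha : a = R.root <;> simp [parWt, ha]
  have h2 : ∑ a ∈ A.filter (· ≠ R.root), N.weight s(a, R.par a)
      = ∑ e ∈ (A.filter (· ≠ R.root)).image (fun a => s(a, R.par a)), N.weight e := by
    rw [sum_image]
    intro a ha b hb hab
    exact edge_inj (by simpa using (mem_filter.1 ha).2) (by simpa using (mem_filter.1 hb).2) hab
  have hmem : ∀ e ∈ p.edges, 0 ≤ N.weight e := fun e he => hw e (p.edges_subset_edgeSet he)
  rw [h1, h2, cost, Finset.sum_list_map_count]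
  refine (sum_le_sum_of_subset_of_nonneg (t := p.edges.toFinset) ?_ ?_).trans
    (sum_le_sum fun e he => ?_)
  · intro e he
    obtain ⟨a, ha, rfl⟩ := mem_image.1 he
    rw [mem_filter] at ha
    exact List.mem_toFinset.2 (hA a ha.1 ha.2)
  · intro e he _
    exact hmem e (List.mem_toFinset.1 he)
  · have hc : 1 ≤ p.edges.count e := List.count_pos_iff.2 (List.mem_toFinset.1 he)
    have := hmem e (List.mem_toFinset.1 he)
    rw [nsmul_eq_mul]
    have : (1 : ℝ) ≤ p.edges.count e := by exact_mod_cast hc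
    nlinarith

theorem wdist_comm (u v : V) : N.wdist u v = N.wdist v u := by
  refine Equiv.iInf_congr ⟨SimpleGraph.Walk.reverse, SimpleGraph.Walk.reverse,
    SimpleGraph.Walk.reverse_reverse, SimpleGraph.Walk.reverse_reverse⟩ fun p => ?_
  simp [cost]

/-- A subtree that contains the root has a closed walk that uses each of its edges exactly twice. -/
theorem exists_closed_walk (h : N.Represents R) (A : Finset V)
    (hA : ∀ a ∈ A, ∀ b, R.Anc b a → b ∈ A) :
    ∃ p : N.graph.Walk N.root N.root,
      (∀ a ∈ A, a ∈ p.support) ∧ N.cost p = 2 * ∑ a ∈ A, N.parWt R a := by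
  induction hn : A.card generalizing A with
  | zero =>
    rw [card_eq_zero] at hn
    subst hn
    exact ⟨SimpleGraph.Walk.nil, by simp, by simp [cost]⟩
  | succ n ih =>
    obtain ⟨x, hx, hmax⟩ := A.exists_max_image R.rank (card_pos.1 (by omega))
    obtain ⟨p, hp, hc⟩ := ih (A.erase x) (fun a ha b hb => by
      rw [mem_erase] at ha ⊢
      refine ⟨?_, hA a ha.2 b hb⟩
      rintro rfl
      exact absurd (hb.rank_lt (Ne.symm ha.1)) (not_lt.2 (hmax a ha.2)))
      (by rw [card_erase_of_mem hx]; omega)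
    by_cases hx0 : x = R.root
    · refine ⟨p, fun a ha => ?_, ?_⟩
      · by_cases hax : a = x
        · rw [hax, hx0, ← h.root_eq]
          exact p.start_mem_support
        · exact hp a (mem_erase.2 ⟨hax, ha⟩)
      · rw [hc, ← add_sum_erase A _ hx, hx0, parWt_root, zero_add]
    · have hpx : R.par x ∈ p.support :=
        hp _ (mem_erase.2 ⟨RTree.par_ne hx0, hA x hx _ (RTree.anc_par x)⟩)
      let d : N.graph.Walk (R.par x) (R.par x) :=
        SimpleGraph.Walk.cons (h.adj_par hx0).symm
          (SimpleGraph.Walk.cons (h.adj_par hx0) SimpleGraph.Walk.nil)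
      refine ⟨((p.takeUntil _ hpx).append d).append (p.dropUntil _ hpx), fun a ha => ?_, ?_⟩
      · by_cases hax : a = x
        · simp only [SimpleGraph.Walk.mem_support_append_iff]
          left; right
          simp [d, hax]
        · have := hp a (mem_erase.2 ⟨hax, ha⟩)
          rw [← p.take_spec hpx, SimpleGraph.Walk.mem_support_append_iff] at this
          simp only [SimpleGraph.Walk.mem_support_append_iff]
          tauto
      · have e1 : N.cost p = N.cost (p.takeUntil _ hpx) + N.cost (p.dropUntil _ hpx) := by
          rw [← cost_append, p.take_spec]
        have e2 : N.cost d = 2 * N.parWt R x := by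
          simp [d, cost, parWt_of_ne hx0, Sym2.eq_swap, two_mul]
        rw [cost_append, cost_append, e2, ← add_sum_erase A _ hx, mul_add, ← hc, e1]
        ring

variable [Fintype V]

theorem wdist_of_anc (h : N.Represents R) (hw : ∀ e ∈ N.graph.edgeSet, 0 ≤ N.weight e)
    {u v : V} (huv : R.Anc u v) :
    N.wdist v u = R.dist (N.parWt R) v - R.dist (N.parWt R) u := by
  have hlow : ∀ p : N.graph.Walk v u,
      R.dist (N.parWt R) v - R.dist (N.parWt R) u ≤ N.cost p := by
    intro p
    rw [← RTree.sum_anc_sdiff huv]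
    refine sum_parWt_le_cost hw p _ fun a ha _ => ?_
    simp only [mem_sdiff, RTree.mem_anc] at ha
    exact h.mem_edges_of_anc p ha.1 ha.2
  have hex : ∃ p : N.graph.Walk v u,
      N.cost p = R.dist (N.parWt R) v - R.dist (N.parWt R) u := by
    clear hlow
    induction hn : R.rank v using Nat.strong_induction_on generalizing v with
    | _ n ih =>
      by_cases he : u = v
      · subst he
        exact ⟨SimpleGraph.Walk.nil, by simp [cost]⟩
      · obtain ⟨h1, h2⟩ := RTree.anc_of_ne huv he
        obtain ⟨p, hp⟩ := ih _ (hn ▸ R.rank_par v h1) h2 rfl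
        refine ⟨SimpleGraph.Walk.cons (h.adj_par h1) p, ?_⟩
        rw [RTree.dist_eq_add h1, parWt_of_ne h1, add_sub_assoc, ← hp]
        simp [cost]
  obtain ⟨p, hp⟩ := hex
  refine le_antisymm ?_ ?_
  · rw [← hp]
    exact ciInf_le ⟨_, fun x hx => hx.elim fun q hq => (hlow q).trans_eq hq⟩ p
  · have : Nonempty (N.graph.Walk v u) := ⟨p⟩
    exact le_ciInf hlow

theorem depotDist_eq (h : N.Represents R) (hw : ∀ e ∈ N.graph.edgeSet, 0 ≤ N.weight e) (v : V) :
    N.depotDist v = R.dist (N.parWt R) v := by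
  rw [depotDist, wdist_comm, h.root_eq, h.wdist_of_anc hw (RTree.root_anc v),
    RTree.dist_root parWt_root, sub_zero]

/-- A closed walk from the root uses every edge of the subtree spanned by the vertices that it
visits at least twice. -/
theorem two_mul_span_le_cost (h : N.Represents R) (hw : ∀ e ∈ N.graph.edgeSet, 0 ≤ N.weight e)
    (p : N.graph.Walk N.root N.root) (U : Finset V) (hU : ∀ u ∈ U, u ∈ p.support) :
    2 * ∑ a ∈ R.span U, N.parWt R a ≤ N.cost p := by
  have h1 : ∑ a ∈ R.span U, N.parWt R a
      = ∑ e ∈ ((R.span U).filter (· ≠ R.root)).image (fun a => s(a, R.par a)), N.weight e := by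
    rw [sum_image, sum_filter]
    · refine sum_congr rfl fun a _ => ?_
      by_cases ha : a = R.root <;> simp [parWt, ha]
    · intro a ha b hb hab
      exact edge_inj (by simpa using (mem_filter.1 ha).2) (by simpa using (mem_filter.1 hb).2) hab
  have hmem : ∀ e ∈ p.edges, 0 ≤ N.weight e := fun e he => hw e (p.edges_subset_edgeSet he)
  have hcount : ∀ a ∈ R.span U, a ≠ R.root → 2 ≤ p.edges.count s(a, R.par a) := by
    intro a ha ha0
    obtain ⟨u, hu, hau⟩ := RTree.mem_span.1 ha
    have hr : ¬ R.Anc a N.root := fun hh => ha0 (RTree.anc_root (h.root_eq ▸ hh))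
    rw [← p.take_spec (hU u hu), SimpleGraph.Walk.edges_append, List.count_append]
    have e1 := List.count_pos_iff.2 (h.mem_edges_of_anc' (p.takeUntil u (hU u hu)) hr hau)
    have e2 := List.count_pos_iff.2 (h.mem_edges_of_anc (p.dropUntil u (hU u hu)) hau hr)
    omega
  rw [h1, cost, Finset.sum_list_map_count, mul_sum]
  refine (sum_le_sum (g := fun e => p.edges.count e • N.weight e) fun e he => ?_).trans
    (sum_le_sum_of_subset_of_nonneg ?_ fun e he _ => ?_)
  · obtain ⟨a, ha, rfl⟩ := mem_image.1 he
    rw [mem_filter] at ha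
    have hc := hcount a ha.1 ha.2
    have h0 := hmem _ (List.count_pos_iff.1 (by omega : 0 < p.edges.count s(a, R.par a)))
    rw [nsmul_eq_mul]
    have : (2 : ℝ) ≤ p.edges.count s(a, R.par a) := by exact_mod_cast hc
    nlinarith
  · intro e he
    obtain ⟨a, ha, rfl⟩ := mem_image.1 he
    rw [mem_filter] at ha
    have hc := hcount a ha.1 ha.2
    exact List.mem_toFinset.2 (List.count_pos_iff.1 (by omega))
  · exact nsmul_nonneg (hmem e (List.mem_toFinset.1 he)) _

end Represents

/-- Every finite tree network is represented by a parent function. -/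
theorem exists_represents (N : Network V) (hN : N.graph.IsTree) :
    ∃ R : RTree V, N.Represents R := by
  let P : ∀ v, N.graph.Walk v N.root := fun v => (hN.existsUnique_path v N.root).choose
  have hP : ∀ v, (P v).IsPath := fun v => (hN.existsUnique_path v N.root).choose_spec.1
  have huniq : ∀ v (q : N.graph.Walk v N.root), q.IsPath → q = P v := fun v q hq =>
    (hN.existsUnique_path v N.root).unique hq (hP v)
  have hnil : ∀ v, v ≠ N.root → ¬ (P v).Nil := fun v hv hn => hv hn.eq
  have htail : ∀ v (hv : v ≠ N.root), (P v).tail = P (P v).snd := fun v hv =>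
    huniq _ _ ((hP v).tail)
  have hroot : (P N.root).Nil := by
    rw [← huniq N.root SimpleGraph.Walk.nil SimpleGraph.Walk.IsPath.nil]
    exact SimpleGraph.Walk.Nil.nil
  refine ⟨⟨N.root, fun v => (P v).snd, fun v => (P v).length, ?_, ?_⟩, rfl, ?_⟩
  · exact (SimpleGraph.Walk.getVert_of_length_le _ (by
      rw [SimpleGraph.Walk.length_eq_zero_iff.2 hroot]; omega))
  · intro v hv
    have := SimpleGraph.Walk.length_tail_add_one (hnil v hv)
    rw [htail v hv] at this
    show (P (P v).snd).length < (P v).length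
    omega
  · intro u v
    show N.graph.Adj u v ↔ (u ≠ N.root ∧ (P u).snd = v) ∨ (v ≠ N.root ∧ (P v).snd = u)
    constructor
    · intro hadj
      by_cases hv : v ∈ (P u).support
      · left
        refine ⟨?_, (hN.isAcyclic.eq_snd_of_adj_start (hP u) hadj hv).symm⟩
        rintro rfl
        rw [SimpleGraph.Walk.nil_iff_support_eq.1 hroot, List.mem_singleton] at hv
        exact hadj.ne hv.symm
      · right
        have hq : (SimpleGraph.Walk.cons hadj.symm (P u)).IsPath :=
          (SimpleGraph.Walk.cons_isPath_iff _ _).2 ⟨hP u, hv⟩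
        refine ⟨?_, ?_⟩
        · rintro rfl
          exact hv (SimpleGraph.Walk.end_mem_support _)
        · rw [← huniq v _ hq]
          simp
    · rintro (⟨h1, rfl⟩ | ⟨h1, rfl⟩)
      · exact SimpleGraph.Walk.adj_snd (hnil u h1)
      · exact (SimpleGraph.Walk.adj_snd (hnil v h1)).symm

end Network

/-! ### Regrouping small pieces -/

/-- A finite collection of items of size less than `a` can be divided into groups of total size in
`[a, 2a)` and a rest of total size less than `a`. -/
theorem exists_grouping {ι : Type*} (s : ι → ℝ) {a : ℝ} (ha : 0 < a) (S : Finset ι)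
    (hs : ∀ i ∈ S, s i < a) :
    ∃ P : Finset (Finset ι), (∀ g ∈ P, g ⊆ S ∧ a ≤ ∑ i ∈ g, s i ∧ ∑ i ∈ g, s i < 2 * a) ∧
      (P : Set (Finset ι)).PairwiseDisjoint id ∧ ∑ i ∈ S \ P.biUnion id, s i < a := by
  induction hn : S.card using Nat.strong_induction_on generalizing S with
  | _ n ih =>
    by_cases hlt : ∑ i ∈ S, s i < a
    · exact ⟨∅, by simp, by simp, by simpa using hlt⟩
    obtain ⟨g, hgS, hmin⟩ := (S.powerset.filter fun g => a ≤ ∑ i ∈ g, s i).exists_minimal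
      ⟨S, by simpa using hlt⟩
    · rw [mem_filter, mem_powerset] at hgS
      obtain ⟨x, hx⟩ : g.Nonempty := by
        rw [nonempty_iff_ne_empty]
        rintro rfl
        have := hgS.2
        simp only [sum_empty] at this
        linarith
      have hx2 : ∑ i ∈ g.erase x, s i < a := by
        by_contra hcon
        have := hmin (y := g.erase x) (mem_filter.2
          ⟨mem_powerset.2 ((erase_subset _ _).trans hgS.1), not_lt.1 hcon⟩) (erase_subset _ _)
        exact notMem_erase x g (this hx)
      have hg2 : ∑ i ∈ g, s i < 2 * a := by
        rw [← add_sum_erase g s hx]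
        linarith [hs x (hgS.1 hx)]
      have hcard : (S \ g).card < n := by
        rw [← hn]
        exact card_lt_card (sdiff_ssubset hgS.1 ⟨x, hx⟩)
      obtain ⟨P, h1, h2, h3⟩ := ih _ hcard (S \ g) (fun i hi => hs i (mem_sdiff.1 hi).1) rfl
      refine ⟨insert g P, ?_, ?_, ?_⟩
      · intro g' hg'
        rcases mem_insert.1 hg' with rfl | hg'
        · exact ⟨hgS.1, hgS.2, hg2⟩
        · exact ⟨(h1 g' hg').1.trans sdiff_subset, (h1 g' hg').2⟩
      · rw [coe_insert, Set.pairwiseDisjoint_insert]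
        refine ⟨h2, fun g' hg' _ => ?_⟩
        exact disjoint_sdiff.mono_right (h1 g' hg').1
      · convert h3 using 2
        ext i
        simp only [biUnion_insert, id, mem_sdiff, mem_union, not_or, and_assoc]

/-- Rounding of a fractional assignment. Every `b : B` is shared by the elements of `A`, `a` having
the part `w a b`. Then all `b` but at most `card A` ones can be given entirely to an element of
`A` that has a part of it, and nobody gets more in total than before. -/
theorem exists_partial_assignment {A B : Type*} [Fintype A] [Fintype B] (w : A → B → ℝ)
    (hw : ∀ a b, 0 ≤ w a b) (hpos : ∀ b, ∃ a, 0 < w a b) :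
    ∃ f : B → Option A, (∀ b a, f b = some a → 0 < w a b) ∧
      (∀ a, ∑ b ∈ univ.filter (fun b => f b = some a), ∑ a', w a' b ≤ ∑ b, w a b) ∧
      (univ.filter fun b => f b = none).card ≤ Fintype.card A := by
  let Flow : (A × B → ℝ) → Prop := fun y => (∀ p, 0 ≤ y p) ∧ (∀ p, y p ≠ 0 → w p.1 p.2 ≠ 0) ∧
    (∀ a, ∑ b, y (a, b) = ∑ b, w a b) ∧ ∀ b, ∑ a, y (a, b) = ∑ a, w a b
  let supp : (A × B → ℝ) → Finset (A × B) := fun y => univ.filter fun p => y p ≠ 0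
  have hex : ∃ n y, Flow y ∧ (supp y).card = n :=
    ⟨_, fun p => w p.1 p.2, ⟨fun p => hw _ _, fun p hp => hp, fun _ => rfl, fun _ => rfl⟩, rfl⟩
  obtain ⟨y, hy, hcard⟩ := Nat.find_spec hex
  have hmin : ∀ y', Flow y' → (supp y).card ≤ (supp y').card := fun y' hy' => by
    rw [hcard]
    exact Nat.find_min' hex ⟨y', hy', rfl⟩
  obtain ⟨hy0, hyw, hyA, hyB⟩ := hy
  -- A fractional assignment of minimal support has at most `card A + card B` shares, as otherwise
  -- a nonzero perturbation of the shares preserves all sums.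
  have hsupp : (supp y).card ≤ Fintype.card A + Fintype.card B := by
    by_contra hlt
    rw [not_le] at hlt
    let E : (supp y → ℝ) →ₗ[ℝ] (A × B → ℝ) :=
      Function.ExtendByZero.linearMap ℝ (Subtype.val : supp y → A × B)
    let Φ : (supp y → ℝ) →ₗ[ℝ] (A → ℝ) × (B → ℝ) :=
      (LinearMap.prod
        (LinearMap.pi fun a => ∑ b, LinearMap.proj (a, b))
        (LinearMap.pi fun b => ∑ a, LinearMap.proj (a, b))).comp E
    have hker : LinearMap.ker Φ ≠ ⊥ := by
      apply LinearMap.ker_ne_bot_of_finrank_lt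
      simpa using hlt
    obtain ⟨g, hg, hg0⟩ := (Submodule.ne_bot_iff _).1 hker
    have key : ∃ G : A × B → ℝ, (∀ p, y p = 0 → G p = 0) ∧ (∃ p, G p < 0) ∧
        (∀ a, ∑ b, G (a, b) = 0) ∧ ∀ b, ∑ a, G (a, b) = 0 := by
      have hE : ∀ p (hp : p ∈ supp y), E g p = g ⟨p, hp⟩ := fun p hp =>
        Subtype.val_injective.extend_apply g 0 (⟨p, hp⟩ : supp y)
      have hE0 : ∀ p, y p = 0 → E g p = 0 := fun p hp =>
        Function.extend_apply' (f := (Subtype.val : supp y → A × B)) g 0 p (by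
          rintro ⟨⟨q, hq⟩, rfl⟩
          exact (mem_filter.1 hq).2 hp)
      have hA : ∀ a, ∑ b, E g (a, b) = 0 := fun a => by
        have := congrFun (congrArg Prod.fst (LinearMap.mem_ker.1 hg)) a
        simpa [Φ] using this
      have hB : ∀ b, ∑ a, E g (a, b) = 0 := fun b => by
        have := congrFun (congrArg Prod.snd (LinearMap.mem_ker.1 hg)) b
        simpa [Φ] using this
      obtain ⟨⟨p, hp⟩, hgp⟩ := Function.ne_iff.1 hg0
      rw [← hE p hp] at hgp
      rcases lt_or_gt_of_ne hgp with h | h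
      · exact ⟨E g, hE0, ⟨p, h⟩, hA, hB⟩
      · refine ⟨fun p => - E g p, fun p hp => by simp [hE0 p hp], ⟨p, by simpa using h⟩,
          fun a => ?_, fun b => ?_⟩
        · rw [sum_neg_distrib, hA, neg_zero]
        · rw [sum_neg_distrib, hB, neg_zero]
    obtain ⟨G, hG0, ⟨p0, hp0⟩, hGA, hGB⟩ := key
    obtain ⟨q, hq, hqmin⟩ := (univ.filter fun p => G p < 0).exists_min_image
      (fun p => y p / (- G p)) ⟨p0, by simpa using hp0⟩
    have hqn : G q < 0 := (mem_filter.1 hq).2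
    set l := y q / (- G q) with hl
    have hl0 : 0 ≤ l := div_nonneg (hy0 q) (by linarith)
    let y' : A × B → ℝ := fun p => y p + l * G p
    have hy' : Flow y' := by
      refine ⟨fun p => ?_, fun p hp => hyw p fun h0 => hp ?_, fun a => ?_, fun b => ?_⟩
      · rcases lt_or_ge (G p) 0 with h | h
        · have := hqmin p (mem_filter.2 ⟨mem_univ _, h⟩)
          have h2 : l * (- G p) ≤ y p := by
            rwa [← le_div_iff₀ (by linarith)]
          show 0 ≤ y p + l * G p
          linarith
        · exact add_nonneg (hy0 p) (mul_nonneg hl0 h)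
      · simp [y', h0, hG0 p h0]
      · simp only [y', sum_add_distrib, ← mul_sum, hGA, mul_zero, add_zero, hyA]
      · simp only [y', sum_add_distrib, ← mul_sum, hGB, mul_zero, add_zero, hyB]
    have hlt2 : (supp y').card < (supp y).card := by
      apply card_lt_card
      rw [ssubset_iff_of_subset]
      · refine ⟨q, mem_filter.2 ⟨mem_univ _, fun h0 => hqn.ne (hG0 q h0)⟩, fun hq' => ?_⟩
        refine (mem_filter.1 hq').2 ?_
        show y q + l * G q = 0
        rw [hl, div_neg, neg_mul, div_mul_cancel₀ _ hqn.ne, add_neg_cancel]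
      · intro p hp
        refine mem_filter.2 ⟨mem_univ _, fun h0 => (mem_filter.1 hp).2 ?_⟩
        simp [y', h0, hG0 p h0]
    exact absurd (hmin y' hy') (not_le.2 hlt2)
  let nb : B → Finset A := fun b => univ.filter fun a => y (a, b) ≠ 0
  have hnb : ∀ b, 1 ≤ (nb b).card := fun b => by
    rw [Nat.succ_le_iff, card_pos]
    by_contra hne
    rw [not_nonempty_iff_eq_empty] at hne
    have h0 : ∑ a, y (a, b) = 0 := sum_eq_zero fun a _ => by
      by_contra h
      exact notMem_empty a (hne ▸ mem_filter.2 ⟨mem_univ _, h⟩)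
    obtain ⟨a, ha⟩ := hpos b
    rw [hyB] at h0
    exact ha.ne' ((sum_eq_zero_iff_of_nonneg fun a _ => hw a b).1 h0 a (mem_univ _))
  have hsum : (supp y).card = ∑ b, (nb b).card := by
    have : supp y = univ.biUnion fun b => (nb b).map (Function.Embedding.sectL A b) := by
      ext ⟨a, b⟩
      simp [supp, nb]
    rw [this, card_biUnion]
    · simp
    · intro b _ b' _ hbb
      rw [Function.onFun, disjoint_left]
      rintro ⟨a, b''⟩ h1 h2
      simp only [mem_map, Function.Embedding.sectL_apply, Prod.mk.injEq] at h1 h2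
      obtain ⟨_, _, _, rfl⟩ := h1
      obtain ⟨_, _, _, rfl⟩ := h2
      exact hbb rfl
  let f : B → Option A := fun b => if h : ∃ a, nb b = {a} then some h.choose else none
  have hf : ∀ b a, f b = some a → nb b = {a} := by
    intro b a hba
    by_cases h : ∃ a, nb b = {a}
    · have h2 : f b = some h.choose := dif_pos h
      rw [h2, Option.some.injEq] at hba
      rw [← hba]
      exact h.choose_spec
    · rw [show f b = none from dif_neg h] at hba
      cases hba
  have hval : ∀ b a, f b = some a → ∑ a', w a' b = y (a, b) := by
    intro b a hba
    rw [← hyB b]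
    refine sum_eq_single a (fun a' _ hne => ?_) (by simp)
    by_contra h0
    have : a' ∈ nb b := mem_filter.2 ⟨mem_univ _, h0⟩
    rw [hf b a hba, mem_singleton] at this
    exact hne this
  refine ⟨f, fun b a hba => ?_, fun a => ?_, ?_⟩
  · have : a ∈ nb b := by rw [hf b a hba, mem_singleton]
    exact lt_of_le_of_ne (hw a b) (hyw _ (mem_filter.1 this).2).symm
  · rw [← hyA a]
    refine (sum_congr rfl fun b hb => hval b a (mem_filter.1 hb).2).trans_le ?_
    exact sum_le_sum_of_subset_of_nonneg (subset_univ _) fun b _ _ => hy0 _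
  · have h2 : ∀ b, f b = none → 2 ≤ (nb b).card := by
      intro b hb
      by_contra hlt
      have h1 : (nb b).card = 1 := by
        have := hnb b
        omega
      rw [show f b = some (card_eq_one.1 h1).choose from dif_pos (card_eq_one.1 h1)] at hb
      cases hb
    have h3 : ∑ b, (1 + if f b = none then 1 else 0) ≤ ∑ b, (nb b).card :=
      sum_le_sum fun b _ => by
        have := hnb b
        split_ifs with h
        · exact h2 b h
        · simpa using this
    rw [sum_add_distrib, ← hsum, sum_boole] at h3
    simp only [sum_const, card_univ, smul_eq_mul, mul_one, Nat.cast_id] at h3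
    omega

/-- Redistribution of pieces. Tour `i` has a piece of size `s i c` in the component `c`; each piece
carries a flag. The pieces are given to tours (`Sum.inl`) and to the bins `b ≤ u c / j` of their
component (`Sum.inr b`) such that no tour gets more in total than before, each tour or bin gets
nothing or at least `a` from a component (with the possible exception of the bin `0`), and pieces
of size less than `a` are only given to tours that have such a piece with the same flag in the same
component. -/
theorem exists_redistribution {I C : Type*} [Fintype I] [Fintype C] (s : I → C → ℝ)
    (hs : ∀ i c, 0 ≤ s i c) (flag : I → C → Bool) {a : ℝ} (ha : 0 < a) {k j : ℕ} (hj : 1 ≤ j)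
    (haj : 2 * a * j ≤ k) :
    ∃ (u : C → ℕ) (σ : I → C → I ⊕ ℕ), ∑ c, u c ≤ Fintype.card I ∧
      (∀ i c, ¬ (0 < s i c ∧ s i c < a) → σ i c = Sum.inl i) ∧
      (∀ i c i', 0 < s i c ∧ s i c < a → σ i c = Sum.inl i' →
        (0 < s i' c ∧ s i' c < a) ∧ flag i c = flag i' c) ∧
      (∀ i c b, σ i c = Sum.inr b → b ≤ u c / j) ∧
      (∀ i', ∑ c, ∑ i ∈ univ.filter (fun i => σ i c = Sum.inl i'), s i c ≤ ∑ c, s i' c) ∧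
      (∀ i' c, ∑ i ∈ univ.filter (fun i => σ i c = Sum.inl i'), s i c = 0 ∨
        a ≤ ∑ i ∈ univ.filter (fun i => σ i c = Sum.inl i'), s i c) ∧
      (∀ c b, ∑ i ∈ univ.filter (fun i => σ i c = Sum.inr b), s i c ≤ k) ∧
      (∀ c b, b ≠ 0 → ∑ i ∈ univ.filter (fun i => σ i c = Sum.inr b), s i c = 0 ∨
        a ≤ ∑ i ∈ univ.filter (fun i => σ i c = Sum.inr b), s i c) := by
  -- The small pieces in a component with the same flag are put into groups; `B` is the set of all
  -- groups.
  let small : I → C → Prop := fun i c => 0 < s i c ∧ s i c < a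
  let Sm : C → Bool → Finset I := fun c q => univ.filter fun i => small i c ∧ flag i c = q
  have hSm : ∀ c q i, i ∈ Sm c q ↔ small i c ∧ flag i c = q := fun c q i => by simp [Sm]
  choose P hP1 hP2 hP3 using fun c q => exists_grouping (fun i => s i c) ha (Sm c q)
    (fun i hi => ((hSm c q i).1 hi).1.2)
  let B := {x : C × Bool × Finset I // x.2.2 ∈ P x.1 x.2.1}
  let comp : B → C := fun x => x.1.1
  let grp : B → Finset I := fun x => x.1.2.2
  have hgrp : ∀ (x : B) i, i ∈ grp x → small i (comp x) ∧ flag i (comp x) = x.1.2.1 :=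
    fun x i hi => (hSm _ _ _).1 ((hP1 _ _ _ x.2).1 hi)
  have hlow : ∀ x : B, a ≤ ∑ i ∈ grp x, s i (comp x) := fun x => (hP1 _ _ _ x.2).2.1
  have hup : ∀ x : B, ∑ i ∈ grp x, s i (comp x) ≤ 2 * a := fun x => (hP1 _ _ _ x.2).2.2.le
  have huniq : ∀ (x x' : B) i, i ∈ grp x → i ∈ grp x' → comp x = comp x' → x = x' := by
    rintro ⟨⟨c, q, g⟩, hg⟩ ⟨⟨c', q', g'⟩, hg'⟩ i hi hi' hcc
    have h1 := hgrp _ i hi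
    have h2 := hgrp _ i hi'
    simp only [comp, grp] at h1 h2 hi hi' hcc hg hg'
    subst hcc
    obtain rfl : q = q' := h1.2.symm.trans h2.2
    have : g = g' := (hP2 c q).elim_finset hg hg' i hi hi'
    subst this
    rfl
  -- A tour shares a group to the extent of its piece in the group.
  let w : I → B → ℝ := fun i x => if i ∈ grp x then s i (comp x) else 0
  have hwsum : ∀ x, ∑ i, w i x = ∑ i ∈ grp x, s i (comp x) := fun x => by simp [w]
  obtain ⟨f, hf1, hf2, hf3⟩ := exists_partial_assignment w
    (fun i x => by simp only [w]; split_ifs; exacts [hs _ _, le_rfl]) (fun x => by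
      by_contra hcon
      push Not at hcon
      have := sum_nonpos fun i (_ : i ∈ univ) => hcon i
      rw [hwsum] at this
      linarith [hlow x])
  have hfmem : ∀ x i, f x = some i → i ∈ grp x := fun x i hx => by
    by_contra hcon
    have := hf1 x i hx
    simp [w, hcon] at this
  -- The unassigned groups of a component are counted from 1, so that bin 0 takes one group less and
  -- has room for the two rests (one for each flag), which have size less than `2 * a` together.
  let Un : C → Finset B := fun c => univ.filter fun x => f x = none ∧ comp x = c
  have hidx : ∀ c, ∃ e : B → ℕ, Set.InjOn e (Un c) ∧ ∀ x ∈ Un c, 1 ≤ e x ∧ e x ≤ (Un c).card := by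
    intro c
    refine ⟨fun x => if h : x ∈ Un c then (Un c).equivFin ⟨x, h⟩ + 1 else 0, ?_, ?_⟩
    · intro x hx y hy hxy
      rw [mem_coe] at hx hy
      simp only [hx, hy, dif_pos, Nat.add_right_cancel_iff] at hxy
      simpa using (Un c).equivFin.injective (Fin.ext hxy)
    · intro x hx
      simp only [hx, dif_pos]
      have := ((Un c).equivFin ⟨x, hx⟩).2
      omega
  choose idx hidx1 hidx2 using hidx
  let σ : I → C → I ⊕ ℕ := fun i c =>
    if small i c then
      if h : ∃ x : B, comp x = c ∧ i ∈ grp x then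
        match f h.choose with
        | some i' => Sum.inl i'
        | none => Sum.inr (idx c h.choose / j)
      else Sum.inr 0
    else Sum.inl i
  have hσ1 : ∀ i c, ¬ small i c → σ i c = Sum.inl i := fun i c h => if_neg h
  have hσ2 : ∀ x i, i ∈ grp x → σ i (comp x) = match f x with
        | some i' => Sum.inl i'
        | none => Sum.inr (idx (comp x) x / j) := by
    intro x i hi
    have h : ∃ y : B, comp y = comp x ∧ i ∈ grp y := ⟨x, rfl, hi⟩
    have e : h.choose = x := huniq _ _ i h.choose_spec.2 hi h.choose_spec.1
    simp only [σ, if_pos (hgrp x i hi).1, dif_pos h]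
    rw [e]
  have hσ3 : ∀ i c, small i c → (¬ ∃ x : B, comp x = c ∧ i ∈ grp x) → σ i c = Sum.inr 0 :=
    fun i c h1 h2 => by simp only [σ, if_pos h1, dif_neg h2]
  have hinl : ∀ i c i', σ i c = Sum.inl i' →
      (¬ small i c ∧ i = i') ∨ ∃ x, comp x = c ∧ i ∈ grp x ∧ f x = some i' := by
    intro i c i' h
    by_cases h1 : small i c
    · by_cases h2 : ∃ x : B, comp x = c ∧ i ∈ grp x
      · obtain ⟨x, rfl, hx⟩ := h2
        right
        refine ⟨x, rfl, hx, ?_⟩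
        rw [hσ2 x i hx] at h
        cases hfx : f x with
        | none => simp [hfx] at h
        | some y => simpa [hfx] using h
      · simp [hσ3 i c h1 h2] at h
    · rw [hσ1 i c h1] at h
      exact Or.inl ⟨h1, Sum.inl_injective h⟩
  have hinr : ∀ i c b, σ i c = Sum.inr b →
      (∃ x, comp x = c ∧ i ∈ grp x ∧ f x = none ∧ b = idx c x / j) ∨
      (b = 0 ∧ small i c ∧ ¬ ∃ x : B, comp x = c ∧ i ∈ grp x) := by
    intro i c b h
    by_cases h1 : small i c
    · by_cases h2 : ∃ x : B, comp x = c ∧ i ∈ grp x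
      · obtain ⟨x, rfl, hx⟩ := h2
        left
        refine ⟨x, rfl, hx, ?_⟩
        rw [hσ2 x i hx] at h
        cases hfx : f x with
        | none => simpa [hfx, eq_comm] using h
        | some y => simp [hfx] at h
      · rw [hσ3 i c h1 h2] at h
        exact Or.inr ⟨(Sum.inr_injective h).symm, h1, h2⟩
    · simp [hσ1 i c h1] at h
  have hbin : ∀ c b, (((Un c).filter fun x => idx c x / j = b).card : ℝ)
      + (if b = 0 then 1 else 0) ≤ j := by
    intro c b
    have h1 : ((Un c).filter fun x => idx c x / j = b).card
        ≤ (Ico (if b = 0 then 1 else b * j) (b * j + j)).card := by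
      refine card_le_card_of_injOn (idx c) (fun x hx => ?_)
        ((hidx1 c).mono fun x hx => (mem_filter.1 hx).1)
      obtain ⟨hx1, hx2⟩ := mem_filter.1 hx
      have h3 := (Nat.div_eq_iff hj).1 hx2
      have h4 := (hidx2 c x hx1).1
      rw [mem_coe, mem_Ico]
      split_ifs with hb <;> constructor <;> omega
    rw [Nat.card_Ico] at h1
    split_ifs at h1 ⊢ with hb
    · subst hb
      rw [zero_mul, zero_add] at h1
      have : ((Un c).filter fun x => idx c x / j = 0).card + 1 ≤ j := by omega
      exact_mod_cast this
    · have : ((Un c).filter fun x => idx c x / j = b).card + 0 ≤ j := by omega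
      exact_mod_cast this
  refine ⟨fun c => (Un c).card, σ, ?_, hσ1, ?_, ?_, ?_, ?_, ?_, ?_⟩
  · refine le_trans (le_of_eq ?_) hf3
    rw [card_eq_sum_card_fiberwise (f := comp) (t := univ) (fun _ _ => mem_coe.2 (mem_univ _))]
    refine sum_congr rfl fun c _ => ?_
    rw [filter_filter]
  · intro i c i' hi h
    rcases hinl i c i' h with ⟨h1, -⟩ | ⟨x, rfl, h1, h2⟩
    · exact absurd hi h1
    · have h3 := hgrp x i' (hfmem x i' h2)
      exact ⟨h3.1, (hgrp x i h1).2.trans h3.2.symm⟩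
  · intro i c b h
    rcases hinr i c b h with ⟨x, hx, -, h2, rfl⟩ | ⟨rfl, -⟩
    · exact Nat.div_le_div_right (hidx2 c x (mem_filter.2 ⟨mem_univ _, h2, hx⟩)).2
    · exact Nat.zero_le _
  · -- The tour `i'` gives away its small pieces, which are its shares of the groups.
    intro i'
    have h1 : ∀ c, ∑ i ∈ univ.filter (fun i => σ i c = Sum.inl i'), s i c
        ≤ (if small i' c then 0 else s i' c)
          + ∑ x ∈ univ.filter (fun x => f x = some i'), if comp x = c then ∑ i, w i x else 0 := by
      intro c
      have hnn : ∀ x, 0 ≤ if comp x = c then ∑ i, w i x else 0 := fun x => by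
        split_ifs
        · rw [hwsum]; exact ha.le.trans (hlow x)
        · exact le_rfl
      by_cases hsm : small i' c
      · rw [if_pos hsm, zero_add]
        by_cases hx : ∃ x, comp x = c ∧ f x = some i'
        · obtain ⟨x, rfl, hfx⟩ := hx
          refine le_trans ?_ (single_le_sum (fun x _ => hnn x)
            (mem_filter.2 ⟨mem_univ x, hfx⟩))
          rw [if_pos rfl, hwsum]
          refine sum_le_sum_of_subset_of_nonneg (fun i hi => ?_) fun i _ _ => hs _ _
          rcases hinl i _ i' (mem_filter.1 hi).2 with ⟨h1, rfl⟩ | ⟨y, hy, h1, h2⟩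
          · exact absurd hsm h1
          · rwa [← huniq y x i' (hfmem y i' h2) (hfmem x i' hfx) hy]
        · rw [sum_eq_zero]
          · exact sum_nonneg fun x _ => hnn x
          · intro i hi
            rcases hinl i c i' (mem_filter.1 hi).2 with ⟨h1, rfl⟩ | ⟨y, hy, h1, h2⟩
            · exact absurd hsm h1
            · exact absurd ⟨y, hy, h2⟩ hx
      · rw [if_neg hsm]
        refine le_trans (sum_le_sum_of_subset_of_nonneg (t := {i'}) (fun i hi => ?_)
          fun i _ _ => hs _ _) ?_
        · rcases hinl i c i' (mem_filter.1 hi).2 with ⟨h1, rfl⟩ | ⟨y, rfl, h1, h2⟩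
          · exact mem_singleton_self _
          · exact absurd (hgrp y i' (hfmem y i' h2)).1 hsm
        · rw [sum_singleton]
          exact le_add_of_nonneg_right (sum_nonneg fun x _ => hnn x)
    have h2 : ∀ c, ∑ x, (if comp x = c then w i' x else 0)
        ≤ if small i' c then s i' c else 0 := by
      intro c
      by_cases hx : ∃ x, comp x = c ∧ i' ∈ grp x
      · obtain ⟨x, rfl, hx⟩ := hx
        rw [if_pos (hgrp x i' hx).1, sum_eq_single x]
        · simp [w, hx]
        · intro y _ hyx
          split_ifs with hy
          · have : i' ∉ grp y := fun h => hyx (huniq y x i' h hx hy)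
            simp [w, this]
          · rfl
        · simp
      · rw [sum_eq_zero]
        · split_ifs
          exacts [hs _ _, le_rfl]
        · intro x _
          split_ifs with hc
          · have : i' ∉ grp x := fun h => hx ⟨x, hc, h⟩
            simp [w, this]
          · rfl
    refine (sum_le_sum fun c _ => h1 c).trans ?_
    rw [sum_add_distrib, sum_comm (t := univ.filter fun x => f x = some i')]
    simp only [sum_ite_eq, mem_univ, if_true]
    have h3 : ∑ x, w i' x ≤ ∑ c, if small i' c then s i' c else 0 := by
      refine le_trans (le_of_eq ?_) (sum_le_sum fun c _ => h2 c)
      rw [sum_comm]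
      simp
    refine (add_le_add_right ((hf2 i').trans h3) _).trans (le_of_eq ?_)
    rw [← sum_add_distrib]
    refine sum_congr rfl fun c _ => ?_
    split_ifs <;> simp
  · intro i' c
    by_cases hx : ∃ x, comp x = c ∧ f x = some i'
    · right
      obtain ⟨x, rfl, hfx⟩ := hx
      refine (hlow x).trans (sum_le_sum_of_subset_of_nonneg (fun i hi => ?_) fun i _ _ => hs _ _)
      rw [mem_filter, hσ2 x i hi, hfx]
      exact ⟨mem_univ _, rfl⟩
    · by_cases hsm : small i' c
      · left
        refine sum_eq_zero fun i hi => ?_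
        rcases hinl i c i' (mem_filter.1 hi).2 with ⟨h1, rfl⟩ | ⟨y, hy, h1, h2⟩
        · exact absurd hsm h1
        · exact absurd ⟨y, hy, h2⟩ hx
      · have : univ.filter (fun i => σ i c = Sum.inl i') = {i'} := by
          ext i
          rw [mem_filter, mem_singleton]
          constructor
          · rintro ⟨-, h⟩
            rcases hinl i c i' h with ⟨h1, rfl⟩ | ⟨y, hy, h1, h2⟩
            · rfl
            · exact absurd ⟨y, hy, h2⟩ hx
          · rintro rfl
            exact ⟨mem_univ _, hσ1 _ _ hsm⟩
        rw [this, sum_singleton]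
        rcases (hs i' c).eq_or_lt with h | h
        · exact Or.inl h.symm
        · exact Or.inr (not_lt.1 fun h' => hsm ⟨h, h'⟩)
  · intro c b
    let Rest : Bool → Finset I := fun q => Sm c q \ (P c q).biUnion id
    let X := (Un c).filter fun x => idx c x / j = b
    have h1 : ∑ i ∈ univ.filter (fun i => σ i c = Sum.inr b), s i c
        ≤ ∑ x ∈ X, ∑ i ∈ grp x, s i c
          + if b = 0 then ∑ i ∈ Rest true, s i c + ∑ i ∈ Rest false, s i c else 0 := by
      have e1 : ∑ x ∈ X, ∑ i ∈ grp x, s i c = ∑ i, ∑ x ∈ X, if i ∈ grp x then s i c else 0 := by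
        rw [sum_comm]
        simp
      have e2 : (if b = 0 then ∑ i ∈ Rest true, s i c + ∑ i ∈ Rest false, s i c else 0)
          = ∑ i, if b = 0 then (if i ∈ Rest true then s i c else 0)
              + (if i ∈ Rest false then s i c else 0) else 0 := by
        split_ifs
        · rw [sum_add_distrib]; simp
        · simp
      rw [e1, e2, ← sum_add_distrib]
      have hnn : ∀ (i : I) (p : Prop) [Decidable p], 0 ≤ if p then s i c else 0 := fun i p _ => by
        split_ifs
        exacts [hs _ _, le_rfl]
      have hnn2 : ∀ i : I, 0 ≤ if b = 0 then (if i ∈ Rest true then s i c else 0)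
              + (if i ∈ Rest false then s i c else 0) else 0 := fun i => by
        split_ifs <;> first | exact le_rfl | (have := hs i c; linarith)
      refine (sum_le_sum fun i hi => ?_).trans (sum_le_sum_of_subset_of_nonneg (subset_univ _)
        fun i _ _ => add_nonneg (sum_nonneg fun x _ => hnn i _) (hnn2 i))
      rcases hinr i c b (mem_filter.1 hi).2 with ⟨x, rfl, h1, h2, h3⟩ | ⟨rfl, h1, h2⟩
      · refine le_trans ?_ (add_le_add (single_le_sum (fun x _ => hnn i _)
          (mem_filter.2 ⟨mem_filter.2 ⟨mem_univ x, h2, rfl⟩, h3.symm⟩)) (hnn2 i))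
        rw [if_pos h1, add_zero]
      · refine le_trans ?_ (add_le_add_left (sum_nonneg fun x _ => hnn i _) _)
        have h3 : i ∈ Rest (flag i c) := by
          rw [mem_sdiff, hSm, mem_biUnion]
          refine ⟨⟨h1, rfl⟩, ?_⟩
          rintro ⟨g, hg, hig⟩
          exact h2 ⟨⟨(c, flag i c, g), hg⟩, rfl, hig⟩
        have h4 := hnn i (i ∈ Rest true)
        have h5 := hnn i (i ∈ Rest false)
        rw [if_pos rfl]
        cases hfl : flag i c <;> rw [hfl] at h3 <;> rw [if_pos h3] at * <;> linarith
    have h2 : ∑ x ∈ X, ∑ i ∈ grp x, s i c ≤ X.card * (2 * a) := by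
      rw [← nsmul_eq_mul]
      refine sum_le_card_nsmul _ _ _ fun x hx => ?_
      have := (mem_filter.1 (mem_filter.1 hx).1).2.2
      rw [← this]
      exact hup x
    have h3 := hbin c b
    have h4 : (if b = 0 then ∑ i ∈ Rest true, s i c + ∑ i ∈ Rest false, s i c else 0)
        ≤ (if b = 0 then 1 else 0) * (2 * a) := by
      split_ifs
      · have := hP3 c true
        have := hP3 c false
        simp only [Rest]
        linarith
      · simp
    have h5 := mul_le_mul_of_nonneg_right h3 (by linarith : 0 ≤ 2 * a)
    rw [add_mul] at h5
    linarith
  · intro c b hb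
    rcases (univ.filter fun i => σ i c = Sum.inr b).eq_empty_or_nonempty with h | ⟨i, hi⟩
    · left
      rw [h, sum_empty]
    · right
      rcases hinr i c b (mem_filter.1 hi).2 with ⟨x, rfl, h1, h2, h3⟩ | ⟨h0, -⟩
      · refine (hlow x).trans (sum_le_sum_of_subset_of_nonneg (fun i hi => ?_)
          fun i _ _ => hs _ _)
        rw [mem_filter, hσ2 x i hi, h2, h3]
        exact ⟨mem_univ _, rfl⟩
      · exact absurd h0 hb

/-! ### Partitions of a rooted tree into components -/

/-- A partition of the edges of a rooted tree into components with labels in `C`, in terms of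
vertices: a non-root vertex stands for the edge to its parent. -/
structure RTree.Partition {V : Type*} (R : RTree V) (C : Type*) where
  /-- the component of the edge between a non-root vertex and its parent -/
  comp : V → C
  /-- the root vertex of a component -/
  top : C → V
  /-- the exit vertex of an internal component, the root vertex of a leaf component -/
  exit : C → V
  step : ∀ v, v ≠ R.root → R.par v = top (comp v) ∨
    (R.par v ≠ R.root ∧ comp (R.par v) = comp v)
  exists_child : ∀ c, ∃ v, v ≠ R.root ∧ comp v = c ∧ R.par v = top c
  par_eq_exit : ∀ v, v ≠ R.root → R.par v ≠ R.root → comp (R.par v) ≠ comp v →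
    R.par v = exit (comp (R.par v))
  exit_cases : ∀ c, exit c = top c ∨ (exit c ≠ R.root ∧ comp (exit c) = c ∧ ∃ d, top d = exit c)

namespace RTree.Partition

variable {V C : Type*} {R : RTree V} (D : R.Partition C)

theorem comp_par_of_ne {v : V} (hv : v ≠ R.root) (h : R.par v ≠ D.top (D.comp v)) :
    R.par v ≠ R.root ∧ D.comp (R.par v) = D.comp v :=
  (D.step v hv).resolve_left h

theorem top_anc_par {v : V} (hv : v ≠ R.root) : R.Anc (D.top (D.comp v)) (R.par v) := by
  induction v using RTree.induction_on (R := R) with | _ v ih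
  rcases D.step v hv with h | ⟨h1, h2⟩
  · rw [← h]; exact Anc.refl _
  · rw [← h2]
    exact (ih _ (R.rank_par v hv) h1).trans (anc_par _)

theorem top_anc {v : V} (hv : v ≠ R.root) : R.Anc (D.top (D.comp v)) v :=
  (D.top_anc_par hv).trans (anc_par v)

theorem rank_top_lt {v : V} (hv : v ≠ R.root) : R.rank (D.top (D.comp v)) < R.rank v :=
  (D.top_anc_par hv).rank_le.trans_lt (R.rank_par v hv)

theorem top_ne {v : V} (hv : v ≠ R.root) : D.top (D.comp v) ≠ v := fun h => by
  have := D.rank_top_lt hv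
  rw [h] at this
  exact lt_irrefl _ this

/-- A proper ancestor in another component is an ancestor of the root of the component. -/
theorem anc_top_of_ne {a v : V} (h : R.Anc a v) (hne : D.comp a ≠ D.comp v) :
    R.Anc a (D.top (D.comp v)) := by
  induction v using RTree.induction_on (R := R) with | _ v ih
  have hav : a ≠ v := by rintro rfl; exact hne rfl
  obtain ⟨hv, h2⟩ := anc_of_ne h hav
  rcases D.step v hv with h3 | ⟨h3, h4⟩
  · rwa [← h3]
  · rw [← h4]
    rw [← h4] at hne
    exact ih _ (R.rank_par v hv) h2 hne

theorem not_anc_top {a : V} (ha : a ≠ R.root) : ¬ R.Anc a (D.top (D.comp a)) := fun h =>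
  D.top_ne ha ((D.top_anc ha).antisymm h)

/-- If a component is left on the way down from `a` to `v`, then at its exit vertex. -/
theorem exit_between {a v : V} (ha : a ≠ R.root) (h : R.Anc a v) (hne : D.comp a ≠ D.comp v) :
    R.Anc a (D.exit (D.comp a)) ∧ R.Anc (D.exit (D.comp a)) v := by
  induction v using RTree.induction_on (R := R) with | _ v ih
  have hav : a ≠ v := by rintro rfl; exact hne rfl
  obtain ⟨hv, h2⟩ := anc_of_ne h hav
  have hp : R.par v ≠ R.root := h2.ne_root ha
  by_cases h3 : D.comp a = D.comp (R.par v)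
  · have := D.par_eq_exit v hv hp (by rwa [← h3])
    rw [h3, ← this]
    exact ⟨h2, anc_par v⟩
  · obtain ⟨h4, h5⟩ := ih _ (R.rank_par v hv) h2 h3
    exact ⟨h4, h5.trans (anc_par v)⟩

theorem eq_exit_of_top {d : C} (hd : D.top d ≠ R.root) :
    D.top d = D.exit (D.comp (D.top d)) := by
  obtain ⟨v, hv, rfl, hp⟩ := D.exists_child d
  rw [← hp] at hd ⊢
  exact D.par_eq_exit v hv hd fun h => D.top_ne hd (by rw [h, hp])

theorem top_anc_exit (c : C) : R.Anc (D.top c) (D.exit c) := by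
  rcases D.exit_cases c with h | ⟨h1, h2, -⟩
  · rw [h]; exact Anc.refl _
  · have := D.top_anc h1
    rwa [h2] at this

end RTree.Partition

namespace Network

variable {V : Type*}

theorem IsDecomposition.exists_isCompRoot {N : Network V} {R : RTree V} (h : N.Represents R)
    {ε : ℝ} {k : ℕ} {𝒞 : Set (Set (Sym2 V))} (hd : N.IsDecomposition ε k 𝒞) {c : Set (Sym2 V)}
    (hc : c ∈ 𝒞) : ∃ v, N.IsCompRoot c v := by
  have hsub : ∀ e ∈ c, e ∈ N.graph.edgeSet := fun e he => hd.sUnion_eq ▸ ⟨c, hc, he⟩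
  have hne : (verts c).Nonempty := by
    obtain ⟨e, he⟩ := hd.nonempty c hc
    induction e with
    | _ x y => exact ⟨x, _, he, Sym2.mem_mk_left x y⟩
  obtain ⟨v, hv, hmin⟩ : ∃ v ∈ verts c, ∀ u ∈ verts c, R.rank v ≤ R.rank u := by
    obtain ⟨v, hv⟩ := WellFounded.has_min (measure R.rank).wf _ hne
    exact ⟨v, hv.1, fun u hu => not_lt.1 (hv.2 u hu)⟩
  refine ⟨v, hv, fun u hu => h.isAncestor_iff.2 ?_⟩
  obtain ⟨p⟩ := hd.connected c hc u hu v hv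
  induction p with
  | nil => exact RTree.Anc.refl _
  | @cons a b w hadj p ih =>
    rw [SimpleGraph.fromEdgeSet_adj] at hadj
    have hb : R.Anc w b := ih hv hmin ⟨_, hadj.1, Sym2.mem_mk_right _ _⟩
    have hab : N.graph.Adj a b := hsub _ hadj.1
    rcases (h.adj_iff _ _).1 hab with ⟨h1, rfl⟩ | ⟨h1, rfl⟩
    · exact hb.trans (RTree.anc_par _)
    · by_cases hvb : w = b
      · have := hmin _ hu
        have h2 := R.rank_par b h1
        rw [hvb] at this
        omega
      · exact (RTree.anc_of_ne hb hvb).2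

/-- The partition `D` of the rooted tree `R` is the one into the components of `𝒞`. -/
structure IsPartitionOf (N : Network V) {R : RTree V} (𝒞 : Set (Set (Sym2 V)))
    (D : R.Partition 𝒞) : Prop where
  top_eq : ∀ c : 𝒞, D.top c = N.compRoot c
  mem_iff : ∀ (e : Sym2 V) (c : 𝒞),
    e ∈ (c : Set (Sym2 V)) ↔ ∃ v, v ≠ R.root ∧ e = s(v, R.par v) ∧ D.comp v = c

theorem IsPartitionOf.mem_verts_iff {N : Network V} {R : RTree V} {𝒞 : Set (Set (Sym2 V))}
    {D : R.Partition 𝒞} (h : N.IsPartitionOf 𝒞 D) {c : 𝒞} {v : V} :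
    v ∈ verts (c : Set (Sym2 V)) ↔ v = D.top c ∨ (v ≠ R.root ∧ D.comp v = c) := by
  constructor
  · rintro ⟨e, he, hv⟩
    obtain ⟨u, hu, rfl, rfl⟩ := (h.mem_iff e c).1 he
    rcases Sym2.mem_iff.1 hv with rfl | rfl
    · exact Or.inr ⟨hu, rfl⟩
    · exact D.step u hu
  · rintro (rfl | ⟨hv, rfl⟩)
    · obtain ⟨u, hu, hc, hp⟩ := D.exists_child c
      exact ⟨_, (h.mem_iff _ c).2 ⟨u, hu, rfl, hc⟩, hp ▸ Sym2.mem_mk_right _ _⟩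
    · exact ⟨_, (h.mem_iff _ _).2 ⟨v, hv, rfl, rfl⟩, Sym2.mem_mk_left _ _⟩

/-- The partition of the tree given by a component decomposition. -/
theorem IsDecomposition.exists_partition {N : Network V} {R : RTree V} (h : N.Represents R)
    {ε : ℝ} {k : ℕ} {𝒞 : Set (Set (Sym2 V))} (hd : N.IsDecomposition ε k 𝒞)
    (hV : ∃ v, v ≠ R.root) :
    ∃ D : R.Partition 𝒞, N.IsPartitionOf 𝒞 D := by
  have hroot : ∀ c ∈ 𝒞, N.IsCompRoot c (N.compRoot c) := fun c hc =>
    Classical.epsilon_spec_aux _ _ (hd.exists_isCompRoot h hc)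
  have hedge : ∀ c ∈ 𝒞, ∀ e ∈ c, e ∈ N.graph.edgeSet := fun c hc e he =>
    hd.sUnion_eq ▸ ⟨c, hc, he⟩
  have hex : ∀ v, v ≠ R.root → ∃ c : 𝒞, s(v, R.par v) ∈ c.1 := by
    intro v hv
    have : s(v, R.par v) ∈ N.graph.edgeSet := h.adj_par hv
    rw [← hd.sUnion_eq] at this
    obtain ⟨c, hc, he⟩ := this
    exact ⟨⟨c, hc⟩, he⟩
  have huniq : ∀ c ∈ 𝒞, ∀ d ∈ 𝒞, ∀ e, e ∈ c → e ∈ d → c = d := fun c hc d hd' e h1 h2 =>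
    hd.disjoint.elim_set hc hd' e h1 h2
  have hanc : ∀ c ∈ 𝒞, ∀ u ∈ verts c, R.Anc (N.compRoot c) u := fun c hc u hu =>
    h.isAncestor_iff.1 ((hroot c hc).2 u hu)
  -- a vertex of a component other than its root has its parent edge in the component
  have hpar : ∀ c ∈ 𝒞, ∀ u ∈ verts c, u ≠ N.compRoot c → u ≠ R.root ∧ s(u, R.par u) ∈ c := by
    intro c hc u hu hne
    refine ⟨(RTree.anc_of_ne (hanc c hc u hu) hne.symm).1, ?_⟩
    by_contra hcon
    obtain ⟨p⟩ := hd.connected c hc u hu _ (hroot c hc).1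
    have key : ∀ x y : V, (SimpleGraph.fromEdgeSet c).Walk x y → R.Anc u x → R.Anc u y := by
      intro x y q
      induction q with
      | nil => exact id
      | @cons a b _ hadj q ih =>
        intro hua
        apply ih
        rw [SimpleGraph.fromEdgeSet_adj] at hadj
        have hab : N.graph.Adj a b := hedge c hc _ hadj.1
        rcases (h.adj_iff _ _).1 hab with ⟨h1, rfl⟩ | ⟨h1, rfl⟩
        · by_cases hx : u = a
          · exact absurd (hx ▸ hadj.1) hcon
          · exact (RTree.anc_of_ne hua hx).2
        · exact hua.trans (RTree.anc_par b)
    exact hne ((key _ _ p (RTree.Anc.refl u)).antisymm (hanc c hc u hu))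
  obtain ⟨v0, hv0⟩ := hV
  let comp : V → 𝒞 := fun v =>
    if hv : v ≠ R.root then (hex v hv).choose else (hex v0 hv0).choose
  have hcomp : ∀ v, v ≠ R.root → s(v, R.par v) ∈ (comp v).1 := fun v hv => by
    simp only [comp, dif_pos hv]
    exact (hex v hv).choose_spec
  have hcomp' : ∀ v, v ≠ R.root → ∀ c : 𝒞, s(v, R.par v) ∈ c.1 → comp v = c := fun v hv c hc =>
    Subtype.ext (huniq _ (comp v).2 _ c.2 _ (hcomp v hv) hc)
  have hmem : ∀ v, v ≠ R.root → v ∈ verts (comp v).1 ∧ R.par v ∈ verts (comp v).1 := fun v hv =>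
    ⟨⟨_, hcomp v hv, Sym2.mem_mk_left _ _⟩, ⟨_, hcomp v hv, Sym2.mem_mk_right _ _⟩⟩
  have hexit : ∀ c : 𝒞, ∃ e, (∀ v, v ≠ R.root → R.par v ≠ R.root → comp (R.par v) ≠ comp v →
      comp (R.par v) = c → R.par v = e) ∧
      (e = N.compRoot c ∨ (e ≠ R.root ∧ comp e = c ∧ ∃ d : 𝒞, N.compRoot d = e)) := by
    intro c
    by_cases hl : N.IsLeafComp c
    · refine ⟨N.compRoot c, fun v hv hp hne hvc => ?_, Or.inl rfl⟩
      have h1 := (hmem _ hp).1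
      rw [hvc] at h1 hne
      exact hd.leaf_inter c c.2 hl (comp v) (comp v).2 (fun h => hne (Subtype.ext h).symm)
        ⟨h1, (hmem v hv).2⟩
    · obtain ⟨e, he, hne, ⟨d, hd1, hd2, hd3⟩, hex⟩ := hd.exit c c.2 hl
      refine ⟨e, fun v hv hp hne hvc => ?_, Or.inr ?_⟩
      · have h1 := (hmem _ hp).1
        have h2 := (hpar _ (comp (R.par v)).2 _ h1)
        rw [hvc] at h1 hne
        rcases hex (comp v) (comp v).2 (fun h => hne (Subtype.ext h).symm)
          ⟨h1, (hmem v hv).2⟩ with h3 | h3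
        · have h4 := hcomp _ hp
          rw [hvc] at h4
          have h5 := hanc c c.2 _ ⟨_, h4, Sym2.mem_mk_right _ _⟩
          rw [← h3] at h5
          exact absurd h5 (RTree.not_anc_par hp)
        · exact h3
      · obtain ⟨h1, h2⟩ := hpar c c.2 e he hne
        refine ⟨h1, hcomp' e h1 c h2, ⟨d, hd1⟩, ?_⟩
        by_contra hcon
        exact hd2 (huniq _ hd1 _ c.2 _ (hpar d hd1 e hd3 (Ne.symm hcon)).2 h2)
  choose exit hexit1 hexit2 using hexit
  refine ⟨⟨comp, fun c => N.compRoot c, exit, fun v hv => ?_, fun c => ?_,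
    fun v hv hp hne => hexit1 _ v hv hp hne rfl, hexit2⟩, fun c => rfl, fun e c => ⟨fun he => ?_, ?_⟩⟩
  · by_cases hp : R.par v = N.compRoot (comp v)
    · exact Or.inl hp
    · obtain ⟨h1, h2⟩ := hpar _ (comp v).2 _ (hmem v hv).2 hp
      exact Or.inr ⟨h1, hcomp' _ h1 _ h2⟩
  · obtain ⟨e, he, hre⟩ := (hroot c c.2).1
    obtain ⟨v, hv, rfl⟩ := h.mem_edgeSet_iff.1 (hedge c c.2 e he)
    refine ⟨v, hv, hcomp' v hv c he, ?_⟩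
    rcases Sym2.mem_iff.1 hre with h1 | h1
    · have h5 := hanc c c.2 _ ⟨_, he, Sym2.mem_mk_right _ _⟩
      rw [h1] at h5
      exact absurd h5 (RTree.not_anc_par hv)
    · exact h1.symm
  · obtain ⟨v, hv, rfl⟩ := h.mem_edgeSet_iff.1 (hedge c c.2 e he)
    exact ⟨v, hv, rfl, hcomp' v hv c he⟩
  · rintro ⟨v, hv, rfl, rfl⟩
    exact hcomp v hv

end Network

/-! ### Critical vertices -/

/-- The data of critical vertices of the components of a partition that matter for the
height-reduced tree: the critical vertex and the distance class of each component. The distance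
classes have width `W`. -/
structure RTree.Partition.Critical {V C : Type*} {R : RTree V} [Fintype V] (D : R.Partition C)
    (wt : V → ℝ) (W : ℝ) where
  crit : C → V
  cls : C → ℕ
  crit_anc : ∀ c, R.Anc (crit c) (D.top c)
  dist_top_lt : ∀ c, R.dist wt (D.top c) < R.dist wt (crit c) + W
  /-- the components between the critical vertex and the root of a component have the same critical
  vertex -/
  crit_comp : ∀ c b, b ≠ R.root → R.Anc b (D.top c) → ¬ R.Anc b (crit c) →
    crit (D.comp b) = crit c
  /-- the component above the critical vertex belongs to a lower class -/
  cls_lt : ∀ c, crit c ≠ R.root → cls (D.comp (crit c)) < cls c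
  one_le_cls : ∀ c, 1 ≤ cls c
  cls_le : ∀ c, ((cls c : ℝ) - 1) * W ≤ R.dist wt (D.top c)

namespace Network

variable {V : Type*} {N : Network V} {ε : ℝ} {𝒞 : Set (Set (Sym2 V))}

theorem IsMaxConnected.subset {i : ℕ} {S : Set (Set (Sym2 V))} (hS : N.IsMaxConnected ε 𝒞 i S) :
    S ⊆ N.compClass ε 𝒞 i := hS.prop.1

theorem IsMaxConnected.mem_of_inter {i : ℕ} {S : Set (Set (Sym2 V))}
    (hS : N.IsMaxConnected ε 𝒞 i S) {c d : Set (Sym2 V)} (hc : c ∈ S)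
    (hd : d ∈ N.compClass ε 𝒞 i) {v : V} (hvc : v ∈ verts c) (hvd : v ∈ verts d) : d ∈ S := by
  by_cases hcd : c = d
  · rwa [← hcd]
  have hadj : (compGraph V).Adj c d :=
    (SimpleGraph.fromRel_adj _ _ _).2 ⟨hcd, Or.inl ⟨v, hvc, hvd⟩⟩
  refine hS.le_of_ge (y := S ∪ {c, d}) ⟨?_, ?_⟩ Set.subset_union_left (Or.inr (Or.inr rfl))
  · rintro x (hx | rfl | rfl)
    exacts [hS.subset hx, hS.subset hc, hd]
  · exact SimpleGraph.induce_union_connected hS.prop.2.preconnected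
      (SimpleGraph.induce_pair_connected_of_adj hadj).preconnected ⟨c, hc, Or.inl rfl⟩

theorem IsMaxConnected.eq_of_mem {i : ℕ} {S S' : Set (Set (Sym2 V))}
    (hS : N.IsMaxConnected ε 𝒞 i S) (hS' : N.IsMaxConnected ε 𝒞 i S') {c : Set (Sym2 V)}
    (hc : c ∈ S) (hc' : c ∈ S') : S = S' := by
  have hu : (S ∪ S') ⊆ N.compClass ε 𝒞 i ∧ ((compGraph V).induce (S ∪ S')).Connected :=
    ⟨Set.union_subset hS.subset hS'.subset, SimpleGraph.induce_union_connected
      hS.prop.2.preconnected hS'.prop.2.preconnected ⟨c, hc, hc'⟩⟩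
  exact (Set.subset_union_left.antisymm (hS.le_of_ge hu Set.subset_union_left)).trans
    ((hS'.le_of_ge hu Set.subset_union_right).antisymm Set.subset_union_right)

theorem exists_isMaxConnected [Finite V] {i : ℕ} {c : Set (Sym2 V)}
    (hc : c ∈ N.compClass ε 𝒞 i) : ∃ S, N.IsMaxConnected ε 𝒞 i S ∧ c ∈ S := by
  have h1 : ({c} : Set (Set (Sym2 V))) ⊆ N.compClass ε 𝒞 i ∧
      ((compGraph V).induce {c}).Connected := by
    refine ⟨Set.singleton_subset_iff.2 hc, ?_⟩
    exact (SimpleGraph.connected_iff _).2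
      ⟨fun x y => Subsingleton.elim x y ▸ SimpleGraph.Reachable.refl _, ⟨⟨c, rfl⟩⟩⟩
  obtain ⟨S, h2, h3⟩ := (Set.toFinite {S' | S' ⊆ N.compClass ε 𝒞 i ∧
      ((compGraph V).induce S').Connected}).exists_le_maximal h1
  exact ⟨S, h3, h2 rfl⟩

theorem compClass_unique {i i' : ℕ} {c : Set (Sym2 V)} (hW : 0 < N.classWidth ε)
    (h : c ∈ N.compClass ε 𝒞 i) (h' : c ∈ N.compClass ε 𝒞 i') : i = i' := by
  have key : ∀ a b : ℕ, c ∈ N.compClass ε 𝒞 a → c ∈ N.compClass ε 𝒞 b → a ≤ b := by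
    intro a b ha hb
    have := lt_of_mul_lt_mul_right (ha.2.1.trans_lt hb.2.2) hW.le
    have h3 : (a : ℝ) < b + 1 := by linarith
    exact Nat.lt_succ_iff.1 (by exact_mod_cast h3)
  exact le_antisymm (key _ _ h h') (key _ _ h' h)

theorem IsPartitionOf.exists_isCritical {R : RTree V} (h : N.Represents R) {D : R.Partition 𝒞}
    (hD : N.IsPartitionOf 𝒞 D) {i : ℕ} {S : Set (Set (Sym2 V))}
    (hS : N.IsMaxConnected ε 𝒞 i S) : ∃ z, N.IsCritical S z := by
  have hsub : ∀ c ∈ S, c ∈ 𝒞 := fun c hc => (hS.subset hc).1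
  obtain ⟨c0, hc0, hmin⟩ : ∃ c ∈ S, ∀ d ∈ S, R.rank (N.compRoot c) ≤ R.rank (N.compRoot d) := by
    obtain ⟨⟨c, hc⟩⟩ := hS.prop.2.nonempty
    obtain ⟨d, hd⟩ := WellFounded.has_min
      (InvImage.wf (fun c => R.rank (N.compRoot c)) Nat.lt_wfRel.wf) S ⟨c, hc⟩
    exact ⟨d, hd.1, fun u hu => not_lt.1 (hd.2 u hu)⟩
  refine ⟨_, c0, hc0, rfl, fun d hd => h.isAncestor_iff.2 ?_⟩
  obtain ⟨p⟩ := hS.prop.2.preconnected ⟨c0, hc0⟩ ⟨d, hd⟩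
  have key : ∀ x y : S, ((compGraph V).induce S).Walk x y →
      R.Anc (N.compRoot c0) (N.compRoot x) → R.Anc (N.compRoot c0) (N.compRoot y) := by
    intro x y q
    induction q with
    | nil => exact id
    | @cons a b _ hadj q ih =>
      intro ha
      apply ih
      have hadj' : (compGraph V).Adj a b := hadj
      obtain ⟨v, hva, hvb⟩ : ∃ v, v ∈ verts a.1 ∧ v ∈ verts b.1 := by
        rcases ((SimpleGraph.fromRel_adj _ _ _).1 hadj').2 with ⟨v, h1, h2⟩ | ⟨v, h1, h2⟩
        exacts [⟨v, h1, h2⟩, ⟨v, h2, h1⟩]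
      have htop : ∀ e : S, v ∈ verts e.1 → R.Anc (N.compRoot e) v := by
        intro e hv
        rcases (hD.mem_verts_iff (c := ⟨e.1, hsub e e.2⟩)).1 hv with h1 | ⟨h1, h2⟩
        · rw [h1, hD.top_eq]; exact RTree.Anc.refl _
        · have := D.top_anc h1
          rwa [h2, hD.top_eq] at this
      rcases (htop a hva).total (htop b hvb) with h1 | h1
      · exact ha.trans h1
      · rcases ha.total h1 with h2 | h2
        · exact h2
        · by_cases h3 : N.compRoot b = N.compRoot c0
          · rw [h3]; exact RTree.Anc.refl _
          · exact absurd (h2.rank_lt h3) (not_lt.2 (hmin b b.2))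
  exact key _ _ p (RTree.Anc.refl _)

/-- Every component of a decomposition has exactly one critical vertex. -/
theorem IsPartitionOf.exists_critical [Fintype V] {R : RTree V} (h : N.Represents R)
    (hw : ∀ e ∈ N.graph.edgeSet, 0 ≤ N.weight e) {D : R.Partition 𝒞}
    (hD : N.IsPartitionOf 𝒞 D) (hW : 0 < N.classWidth ε) :
    ∃ K : D.Critical (N.parWt R) (N.classWidth ε),
      ∀ (c : 𝒞) u, N.IsCriticalFor ε 𝒞 c u ↔ u = K.crit c := by
  set W := N.classWidth ε with hWdef
  have hwt := h.parWt_nonneg hw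
  have hdist : ∀ c : 𝒞, N.depotDist (N.compRoot c) = R.dist (N.parWt R) (D.top c) := fun c => by
    rw [h.depotDist_eq hw, hD.top_eq]
  let cls : 𝒞 → ℕ := fun c => ⌊R.dist (N.parWt R) (D.top c) / W⌋₊ + 1
  have hcls1 : ∀ c, ((cls c : ℝ) - 1) * W ≤ R.dist (N.parWt R) (D.top c) := fun c => by
    have := Nat.floor_le (div_nonneg (RTree.dist_nonneg (R := R) hwt (D.top c)) hW.le)
    rw [le_div_iff₀ hW] at this
    simpa [cls] using this
  have hcls2 : ∀ c, R.dist (N.parWt R) (D.top c) < cls c * W := fun c => by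
    have := Nat.lt_floor_add_one (R.dist (N.parWt R) (D.top c) / W)
    rw [div_lt_iff₀ hW] at this
    simpa [cls] using this
  have hmem : ∀ c : 𝒞, c.1 ∈ N.compClass ε 𝒞 (cls c) := fun c =>
    ⟨c.2, by rw [hdist]; exact hcls1 c, by rw [hdist]; exact hcls2 c⟩
  have hmem' : ∀ (c : 𝒞) (i : ℕ), ((i : ℝ) - 1) * W ≤ R.dist (N.parWt R) (D.top c) →
      R.dist (N.parWt R) (D.top c) < i * W → c.1 ∈ N.compClass ε 𝒞 i := fun c i h1 h2 =>
    ⟨c.2, by rw [hdist]; exact h1, by rw [hdist]; exact h2⟩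
  choose S hS hcS using fun c : 𝒞 => exists_isMaxConnected (hmem c)
  choose z hz using fun c : 𝒞 => hD.exists_isCritical h (hS c)
  have hzS : ∀ c, ∃ c0 : 𝒞, c0.1 ∈ S c ∧ z c = D.top c0 := fun c => by
    obtain ⟨c0, h1, h2, -⟩ := hz c
    exact ⟨⟨c0, ((hS c).subset h1).1⟩, h1, by rw [h2, hD.top_eq]⟩
  have hzanc : ∀ c d : 𝒞, d.1 ∈ S c → R.Anc (z c) (D.top d) := fun c d hd => by
    obtain ⟨c0, h1, h2, h3⟩ := hz c
    rw [hD.top_eq]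
    exact h.isAncestor_iff.1 (h3 d hd)
  have hiff : ∀ (c : 𝒞) u, N.IsCriticalFor ε 𝒞 c u ↔ u = z c := by
    intro c u
    constructor
    · rintro ⟨i, S', hi, hS', hcS', hu⟩
      obtain rfl : i = cls c := compClass_unique hW (hS'.subset hcS') (hmem c)
      rw [hS'.eq_of_mem (hS c) hcS' (hcS c)] at hu
      obtain ⟨c1, h1, rfl, h3⟩ := hu
      obtain ⟨c0, h4, h5, h6⟩ := hz c
      refine (h.isAncestor_iff.1 ?_ : R.Anc _ _).antisymm (h.isAncestor_iff.1 (h6 c1 h1))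
      rw [h5]
      exact h3 c0 h4
    · rintro rfl
      exact ⟨cls c, S c, Nat.le_add_left _ _, hS c, hcS c, hz c⟩
  have htopv : ∀ d : 𝒞, D.top d ∈ verts d.1 := fun d => hD.mem_verts_iff.2 (Or.inl rfl)
  -- a component whose root is not critical hangs at a component of the same connected set
  have hup : ∀ c d : 𝒞, d.1 ∈ S c → D.top d ≠ z c → D.top d ≠ R.root →
      (D.comp (D.top d)).1 ∈ S c := by
    intro c d hd hne hr
    set d' := D.comp (D.top d) with hd'
    have hzd := hzanc c d hd
    have hvd : D.top d ∈ verts d'.1 := hD.mem_verts_iff.2 (Or.inr ⟨hr, rfl⟩)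
    have hr' : R.Anc (D.top d') (D.top d) := D.top_anc hr
    obtain ⟨c0, hc0, hzc0⟩ := hzS c
    have hmain : R.Anc (z c) (D.top d') → d'.1 ∈ S c := by
      intro hz'
      refine (hS c).mem_of_inter hd (hmem' d' _ ?_ ?_) (htopv d) hvd
      · have := ((hS c).subset hc0).2.1
        rw [hdist, ← hzc0] at this
        exact this.trans (RTree.dist_mono hwt hz')
      · have := ((hS c).subset hd).2.2
        rw [hdist] at this
        exact (RTree.dist_mono hwt hr').trans_lt this
    rcases hzd.total hr' with h1 | h1
    · exact hmain h1
    · by_cases h2 : D.top d' = z c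
      · exact hmain (h2 ▸ RTree.Anc.refl _)
      · exfalso
        have hz0 : z c ≠ R.root := (RTree.anc_of_ne h1 h2).1
        have hcz : D.comp (z c) = d' := by
          by_contra hcon
          exact h2 (h1.antisymm (D.anc_top_of_ne hzd hcon))
        have e1 : z c = D.exit d' := by
          rw [← hcz, hzc0]
          exact D.eq_exit_of_top (hzc0 ▸ hz0)
        exact hne ((D.eq_exit_of_top hr).trans e1.symm)
  have hbetween : ∀ c d b, d.1 ∈ S c → b ≠ R.root → R.Anc b (D.top d) → ¬ R.Anc b (z c) →
      (D.comp b).1 ∈ S c := by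
    intro c d b hd hb hbd hbz
    induction hn : R.rank (D.top d) using Nat.strong_induction_on generalizing d with
    | _ n ih =>
      have hr : D.top d ≠ R.root := hbd.ne_root hb
      have h1 := hup c d hd (fun he => hbz (he ▸ hbd)) hr
      by_cases h2 : D.comp b = D.comp (D.top d)
      · rwa [h2]
      · exact ih _ (hn ▸ D.rank_top_lt hr) _ h1 (D.anc_top_of_ne hbd h2) rfl
  refine ⟨⟨z, cls, fun c => hzanc c c (hcS c), fun c => ?_, fun c b hb hbt hbz => ?_, fun c hr => ?_,
    fun c => Nat.le_add_left _ _, hcls1⟩, hiff⟩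
  · obtain ⟨c0, hc0, hzc0⟩ := hzS c
    have h1 := ((hS c).subset hc0).2.1
    rw [hdist, ← hzc0] at h1
    have h2 := hcls2 c
    change (_ - 1) * W ≤ _ at h1
    nlinarith
  · refine ((hiff _ _).1 ⟨cls c, S c, Nat.le_add_left _ _, hS c, ?_, hz c⟩).symm
    exact hbetween c c b (hcS c) hb hbt hbz
  · obtain ⟨c0, hc0, hzc0⟩ := hzS c
    have hanc := D.top_anc hr
    have h1 := RTree.dist_mono hwt hanc
    have h2 := RTree.dist_mono hwt (hzanc c c (hcS c))
    have hle : cls (D.comp (z c)) ≤ cls c :=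
      Nat.add_le_add_right (Nat.floor_mono (div_le_div_of_nonneg_right (h1.trans h2) hW.le)) 1
    refine lt_of_le_of_ne hle fun heq => ?_
    have h3 : (D.comp (z c)).1 ∈ S c := by
      refine (hS c).mem_of_inter hc0 (heq ▸ hmem (D.comp (z c))) (htopv c0) ?_
      rw [← hzc0]
      exact hD.mem_verts_iff.2 (Or.inr ⟨hr, rfl⟩)
    exact D.not_anc_top hr (hzanc c _ h3)

end Network

/-! ### The height-reduced tree -/

namespace RTree.Partition.Critical

variable {V C : Type*} {R : RTree V} [Fintype V] {D : R.Partition C} {wt : V → ℝ} {W : ℝ}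
  (K : D.Critical wt W)

/-- The height-reduced tree as a rooted tree: `Sum.inr c` is the duplicate of the root of `c`, whose
parent is the critical vertex of `c`. -/
def hatTree : RTree (V ⊕ C) where
  root := Sum.inl R.root
  par
    | Sum.inl v => if v = R.root then Sum.inl R.root else
        if R.par v = D.top (D.comp v) then Sum.inr (D.comp v) else Sum.inl (R.par v)
    | Sum.inr c => Sum.inl (K.crit c)
  rank
    | Sum.inl v => 2 * R.rank v
    | Sum.inr c => 2 * R.rank (D.top c) + 1
  par_root := by simp
  rank_par := by
    rintro (v | c) hv
    · have hv' : v ≠ R.root := fun h => hv (by rw [h])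
      have := R.rank_par v hv'
      simp only [if_neg hv']
      split_ifs with h
      · rw [h] at this
        show 2 * R.rank (D.top (D.comp v)) + 1 < 2 * R.rank v
        omega
      · show 2 * R.rank (R.par v) < 2 * R.rank v
        omega
    · have := (K.crit_anc c).rank_le
      show 2 * R.rank (K.crit c) < 2 * R.rank (D.top c) + 1
      omega

/-- The edge weights of the height-reduced tree. -/
def hatWt : V ⊕ C → ℝ
  | Sum.inl v => wt v
  | Sum.inr c => R.dist wt (D.top c) - R.dist wt (K.crit c)

/-- The component of a non-root vertex of the height-reduced tree. -/
def hatComp (D : R.Partition C) : V ⊕ C → C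
  | Sum.inl v => D.comp v
  | Sum.inr c => c

/-- The vertex of the original tree from which a vertex of the height-reduced tree comes. -/
def proj (D : R.Partition C) : V ⊕ C → V
  | Sum.inl v => v
  | Sum.inr c => D.top c

theorem inl_ne_root {v : V} (hv : v ≠ R.root) : (Sum.inl v : V ⊕ C) ≠ K.hatTree.root :=
  fun h => hv (Sum.inl_injective h)

theorem inr_ne_root (c : C) : (Sum.inr c : V ⊕ C) ≠ K.hatTree.root := Sum.inr_ne_inl

theorem par_inl_top {v : V} (hv : v ≠ R.root) (h : R.par v = D.top (D.comp v)) :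
    K.hatTree.par (Sum.inl v) = Sum.inr (D.comp v) := by
  simp [hatTree, hv, h]

theorem par_inl_of_ne {v : V} (hv : v ≠ R.root) (h : R.par v ≠ D.top (D.comp v)) :
    K.hatTree.par (Sum.inl v) = Sum.inl (R.par v) := by
  simp [hatTree, hv, h]

theorem par_inr (c : C) : K.hatTree.par (Sum.inr c) = Sum.inl (K.crit c) := rfl

theorem crit_anc_inr (c : C) : K.hatTree.Anc (Sum.inl (K.crit c)) (Sum.inr c) := anc_par _

theorem inr_anc_inl {v : V} (hv : v ≠ R.root) :
    K.hatTree.Anc (Sum.inr (D.comp v)) (Sum.inl v) := by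
  induction v using RTree.induction_on (R := R) with | _ v ih
  by_cases h : R.par v = D.top (D.comp v)
  · rw [← K.par_inl_top hv h]
    exact anc_par _
  · obtain ⟨h1, h2⟩ := D.comp_par_of_ne hv h
    have := ih _ (R.rank_par v hv) h1
    rw [h2, ← K.par_inl_of_ne hv h] at this
    exact this.trans (anc_par _)

theorem inl_anc_inl {a v : V} (ha : a ≠ R.root) (h : R.Anc a v) (hc : D.comp a = D.comp v) :
    K.hatTree.Anc (Sum.inl a) (Sum.inl v) := by
  induction v using RTree.induction_on (R := R) with | _ v ih
  by_cases hav : a = v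
  · rw [hav]; exact Anc.refl _
  obtain ⟨hv, h2⟩ := anc_of_ne h hav
  by_cases h3 : R.par v = D.top (D.comp v)
  · rw [h3, ← hc] at h2
    exact absurd h2 (D.not_anc_top ha)
  · obtain ⟨h4, h5⟩ := D.comp_par_of_ne hv h3
    have := ih _ (R.rank_par v hv) h2 (hc.trans h5.symm)
    rw [← K.par_inl_of_ne hv h3] at this
    exact this.trans (anc_par _)

theorem hatAnc_inl_cases {x : V ⊕ C} {u : V} (hu : u ≠ R.root)
    (h : K.hatTree.Anc x (Sum.inl u)) : K.hatTree.Anc x (Sum.inr (D.comp u)) ∨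
      ∃ v, v ≠ R.root ∧ x = Sum.inl v ∧ D.comp v = D.comp u ∧ R.Anc v u := by
  induction u using RTree.induction_on (R := R) with | _ u ih
  rcases anc_iff.1 h with rfl | ⟨-, h2⟩
  · exact Or.inr ⟨u, hu, rfl, rfl, Anc.refl _⟩
  · by_cases h3 : R.par u = D.top (D.comp u)
    · rw [K.par_inl_top hu h3] at h2
      exact Or.inl h2
    · obtain ⟨h4, h5⟩ := D.comp_par_of_ne hu h3
      rw [K.par_inl_of_ne hu h3] at h2
      have := ih _ (R.rank_par u hu) h4 h2
      rw [h5] at this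
      rcases this with h6 | ⟨v, h6, h7, h8, h9⟩
      · exact Or.inl h6
      · exact Or.inr ⟨v, h6, h7, h8, h9.trans (anc_par _)⟩

/-- An ancestor `b` of `v` in the original tree either remains an ancestor in the height-reduced
tree, or it is not much farther from the root than the critical vertex of its component, which
is an ancestor of `v` in the height-reduced tree. -/
theorem anc_inl_or_dist_lt (hw : ∀ v, 0 ≤ wt v) {b v : V} (hb : b ≠ R.root) (h : R.Anc b v) :
    K.hatTree.Anc (Sum.inl (K.crit (D.comp b))) (Sum.inl v) ∧
      (K.hatTree.Anc (Sum.inl b) (Sum.inl v) ∨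
        R.dist wt b < R.dist wt (K.crit (D.comp b)) + W) := by
  induction v using RTree.induction_on (R := R) with | _ v ih
  have hv := h.ne_root hb
  by_cases hc : D.comp b = D.comp v
  · rw [hc]
    exact ⟨(K.crit_anc_inr _).trans (K.inr_anc_inl hv), Or.inl (K.inl_anc_inl hb h hc)⟩
  · have h1 := D.anc_top_of_ne h hc
    have hz := (K.crit_anc_inr (D.comp v)).trans (K.inr_anc_inl hv)
    by_cases h2 : R.Anc b (K.crit (D.comp v))
    · obtain ⟨h3, h4⟩ := ih _ ((K.crit_anc _).rank_le.trans_lt (D.rank_top_lt hv)) h2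
      exact ⟨h3.trans hz, h4.imp_left fun h5 => h5.trans hz⟩
    · rw [K.crit_comp _ b hb h1 h2]
      exact ⟨hz, Or.inr ((dist_mono hw h1).trans_lt (K.dist_top_lt _))⟩

/-- The version of `anc_inl_or_dist_lt` for the duplicate of the root of a component. -/
theorem anc_inr_or_dist_lt (hw : ∀ v, 0 ≤ wt v) {b : V} {c : C} (hb : b ≠ R.root)
    (h : R.Anc b (D.top c)) :
    K.hatTree.Anc (Sum.inl (K.crit (D.comp b))) (Sum.inr c) ∧
      (K.hatTree.Anc (Sum.inl b) (Sum.inr c) ∨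
        R.dist wt b < R.dist wt (K.crit (D.comp b)) + W) := by
  by_cases h2 : R.Anc b (K.crit c)
  · obtain ⟨h3, h4⟩ := K.anc_inl_or_dist_lt hw hb h2
    exact ⟨h3.trans (K.crit_anc_inr c), h4.imp_left fun h5 => h5.trans (K.crit_anc_inr c)⟩
  · rw [K.crit_comp _ b hb h h2]
    exact ⟨K.crit_anc_inr c, Or.inr ((dist_mono hw h).trans_lt (K.dist_top_lt _))⟩

theorem hatWt_nonneg (hw : ∀ v, 0 ≤ wt v) (x : V ⊕ C) : 0 ≤ K.hatWt x := by
  rcases x with v | c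
  · exact hw v
  · exact sub_nonneg.2 (dist_mono hw (K.crit_anc c))

variable [Fintype C]

/-- Distances to the root are the same in both trees. -/
theorem hat_dist (h0 : wt R.root = 0) (x : V ⊕ C) :
    K.hatTree.dist K.hatWt x = R.dist wt (proj D x) := by
  induction x using RTree.induction_on (R := K.hatTree) with | _ x ih
  by_cases hx : x = K.hatTree.root
  · subst hx
    rw [dist_root (R := K.hatTree) (wt := K.hatWt) h0]
    exact (dist_root h0).symm
  · rw [dist_eq_add hx, ih _ (K.hatTree.rank_par x hx)]
    rcases x with v | c
    · have hv : v ≠ R.root := fun h => hx (by rw [h]; rfl)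
      rw [show proj D (Sum.inl v) = v from rfl, dist_eq_add hv]
      by_cases h : R.par v = D.top (D.comp v)
      · rw [K.par_inl_top hv h, h]; rfl
      · rw [K.par_inl_of_ne hv h]; rfl
    · rw [par_inr]
      simp [hatWt, proj]

/-- The components on the path from the root to `x` belong to different classes. -/
theorem card_comp_anc_le {x : V ⊕ C} (hx : x ≠ K.hatTree.root) :
    (((K.hatTree.anc x).filter (· ≠ K.hatTree.root)).image (hatComp D)).card
      ≤ K.cls (hatComp D x) := by
  induction x using RTree.induction_on (R := K.hatTree) with | _ x ih
  rw [anc_eq_insert hx, filter_insert, if_pos hx, image_insert]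
  by_cases hp : K.hatTree.par x = K.hatTree.root
  · have : (K.hatTree.anc (K.hatTree.par x)).filter (· ≠ K.hatTree.root) = ∅ := by
      ext y
      simp only [mem_filter, mem_anc, notMem_empty, iff_false, not_and, not_not, hp]
      exact anc_root
    rw [this]
    simpa using K.one_le_cls _
  · have h1 := ih _ (K.hatTree.rank_par x hx) hp
    by_cases hc : hatComp D (K.hatTree.par x) = hatComp D x
    · rw [hc] at h1
      rwa [insert_eq_of_mem]
      rw [mem_image]
      exact ⟨_, mem_filter.2 ⟨mem_anc.2 (Anc.refl _), hp⟩, hc⟩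
    · refine (card_insert_le _ _).trans ?_
      rcases x with v | c
      · exfalso
        have hv : v ≠ R.root := fun h => hx (by rw [h]; rfl)
        by_cases h : R.par v = D.top (D.comp v)
        · exact hc (by rw [K.par_inl_top hv h]; rfl)
        · exact hc (by rw [K.par_inl_of_ne hv h]; exact (D.comp_par_of_ne hv h).2)
      · have h2 := K.cls_lt c fun h => hp (by rw [par_inr, h]; rfl)
        have h3 : hatComp D (K.hatTree.par (Sum.inr c)) = D.comp (K.crit c) := rfl
        rw [h3] at h1
        show _ ≤ K.cls c
        omega

/-- Attaching a component to a subtree costs at most `W` more in the height-reduced tree than in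
the original tree. -/
theorem hat_attach_le (h0 : wt R.root = 0) (hw : ∀ v, 0 ≤ wt v) (hW : 0 ≤ W) (U : Finset V)
    (c : C) :
    ∑ x ∈ K.hatTree.anc (Sum.inr c) \ K.hatTree.span (U.image Sum.inl), K.hatWt x
      ≤ ∑ a ∈ R.anc (D.top c) \ R.span U, wt a + W := by
  have hhat := K.hatWt_nonneg hw
  have hdiff : ∑ a ∈ R.anc (D.top c) \ R.span U, wt a
      = R.dist wt (D.top c) - ∑ a ∈ R.anc (D.top c) ∩ R.span U, wt a := by
    rw [eq_sub_iff_add_eq, add_comm]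
    exact sum_inter_add_sum_sdiff _ _ _
  rw [hdiff]
  have hdc : K.hatTree.dist K.hatWt (Sum.inr c) = R.dist wt (D.top c) := K.hat_dist h0 _
  rcases ((R.anc (D.top c) ∩ R.span U).filter (· ≠ R.root)).eq_empty_or_nonempty with hY | hY
  · have : ∑ a ∈ R.anc (D.top c) ∩ R.span U, wt a = 0 := sum_eq_zero fun a ha => by
      by_cases har : a = R.root
      · rw [har, h0]
      · exact absurd (hY ▸ mem_filter.2 ⟨ha, har⟩) (notMem_empty a)
    rw [this, sub_zero, ← hdc]
    exact (sum_le_sum_of_subset_of_nonneg sdiff_subset fun x _ _ => hhat x).trans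
      (le_add_of_nonneg_right hW)
  · obtain ⟨b, hb, hmax⟩ := exists_max_image _ R.rank hY
    simp only [mem_filter, mem_inter, mem_anc, mem_span] at hb hmax
    obtain ⟨⟨hbc, u, hu, hbu⟩, hb0⟩ := hb
    have h1 : ∑ a ∈ R.anc (D.top c) ∩ R.span U, wt a ≤ R.dist wt b := by
      refine sum_le_sum_of_subset_of_nonneg (fun a ha => ?_) fun a _ _ => hw a
      rw [mem_inter, mem_anc, mem_span] at ha
      rw [mem_anc]
      by_cases har : a = R.root
      · rw [har]; exact root_anc b
      · rcases ha.1.total hbc with h | h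
        · exact h
        · by_cases hba : b = a
          · rw [hba]; exact Anc.refl _
          · exact absurd (h.rank_lt hba) (not_lt.2 (hmax a ⟨ha, har⟩))
    obtain ⟨y, hy1, hy2, hy3⟩ : ∃ y, K.hatTree.Anc y (Sum.inr c) ∧
        K.hatTree.Anc y (Sum.inl u) ∧ R.dist wt b ≤ K.hatTree.dist K.hatWt y + W := by
      obtain ⟨h2, h3⟩ := K.anc_inr_or_dist_lt hw hb0 hbc
      obtain ⟨h4, h5⟩ := K.anc_inl_or_dist_lt hw hb0 hbu
      by_cases h6 : R.dist wt b < R.dist wt (K.crit (D.comp b)) + W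
      · exact ⟨_, h2, h4, by rw [K.hat_dist h0]; exact h6.le⟩
      · refine ⟨_, h3.resolve_right h6, h5.resolve_right h6, ?_⟩
        rw [K.hat_dist h0]
        exact le_add_of_nonneg_right hW
    have h2 : ∑ x ∈ K.hatTree.anc (Sum.inr c) \ K.hatTree.span (U.image Sum.inl), K.hatWt x
        ≤ ∑ x ∈ K.hatTree.anc (Sum.inr c) \ K.hatTree.anc y, K.hatWt x := by
      refine sum_le_sum_of_subset_of_nonneg (fun x hx => ?_) fun x _ _ => hhat x
      rw [mem_sdiff] at hx ⊢
      refine ⟨hx.1, fun hxy => hx.2 (mem_span.2 ⟨_, mem_image_of_mem _ hu, ?_⟩)⟩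
      exact (mem_anc.1 hxy).trans hy2
    rw [sum_anc_sdiff hy1, hdc] at h2
    linarith

/-- A set of vertices in few components spans a subtree of the height-reduced tree that is not much
heavier than the subtree that it spans in the original tree. The components are attached in the
order of the ranks of their roots, so that nothing below a component is present when it is
attached. -/
theorem hat_span_le (h0 : wt R.root = 0) (hw : ∀ v, 0 ≤ wt v) (hW : 0 ≤ W) (U : Finset V)
    (hU : ∀ u ∈ U, u ≠ R.root) :
    ∑ x ∈ K.hatTree.span (U.image Sum.inl), K.hatWt x
      ≤ ∑ a ∈ R.span U, wt a + (U.image D.comp).card * W := by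
  induction hn : (U.image D.comp).card generalizing U with
  | zero =>
    rw [card_eq_zero, image_eq_empty] at hn
    subst hn
    simp [span]
  | succ n ih =>
    obtain ⟨c, hc, hmax⟩ := exists_max_image (U.image D.comp) (fun c => R.rank (D.top c))
      (card_pos.1 (by omega))
    have hU' : (U.filter (D.comp · ≠ c)).image D.comp = (U.image D.comp).erase c := by
      ext d
      simp only [mem_image, mem_filter, mem_erase]
      constructor
      · rintro ⟨u, ⟨h1, h2⟩, rfl⟩
        exact ⟨h2, u, h1, rfl⟩
      · rintro ⟨h1, u, h2, rfl⟩
        exact ⟨u, ⟨h2, h1⟩, rfl⟩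
    set U' := U.filter (D.comp · ≠ c) with hU'def
    have hih := ih U' (fun u hu => hU u (mem_filter.1 hu).1)
      (by rw [hU', card_erase_of_mem hc]; omega)
    have hatt := K.hat_attach_le h0 hw hW U' c
    let F : Finset V := univ.filter fun v => v ≠ R.root ∧ D.comp v = c ∧ v ∈ R.span U
    have hF : ∀ v, v ∈ F ↔ v ≠ R.root ∧ D.comp v = c ∧ v ∈ R.span U := fun v => by simp [F]
    have h1 : ∑ x ∈ K.hatTree.span (U.image Sum.inl), K.hatWt x
        ≤ ∑ x ∈ K.hatTree.span (U'.image Sum.inl), K.hatWt x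
          + ∑ x ∈ K.hatTree.anc (Sum.inr c) \ K.hatTree.span (U'.image Sum.inl), K.hatWt x
          + ∑ v ∈ F, wt v := by
      have e1 : ∑ v ∈ F, wt v = ∑ x ∈ F.image Sum.inl, K.hatWt x := by
        rw [sum_image fun _ _ _ _ h => Sum.inl_injective h]
        rfl
      rw [e1, ← sum_union disjoint_sdiff, union_sdiff_self_eq_union]
      refine le_trans (sum_le_sum_of_subset_of_nonneg (fun x hx => ?_)
        fun x _ _ => K.hatWt_nonneg hw x) ((le_add_of_nonneg_right
          (sum_nonneg fun x _ => K.hatWt_nonneg hw x)).trans_eq sum_union_inter)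
      obtain ⟨y, hy, hxy⟩ := mem_span.1 hx
      obtain ⟨u, hu, rfl⟩ := mem_image.1 hy
      by_cases huc : D.comp u = c
      · rcases K.hatAnc_inl_cases (hU u hu) hxy with h2 | ⟨v, h2, rfl, h4, h5⟩
        · rw [huc] at h2
          exact mem_union_left _ (mem_union_right _ (mem_anc.2 h2))
        · refine mem_union_right _ (mem_image_of_mem _ ((hF v).2 ⟨h2, h4.trans huc, ?_⟩))
          exact mem_span.2 ⟨u, hu, h5⟩
      · refine mem_union_left _ (mem_union_left _ (mem_span.2 ⟨_, ?_, hxy⟩))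
        exact mem_image_of_mem _ (mem_filter.2 ⟨hu, huc⟩)
    have h2 : ∑ a ∈ R.span U', wt a + ∑ a ∈ R.anc (D.top c) \ R.span U', wt a + ∑ v ∈ F, wt v
        ≤ ∑ a ∈ R.span U, wt a := by
      have hd : Disjoint (R.span U' ∪ R.anc (D.top c)) F := by
        rw [disjoint_left]
        intro v hv hvF
        obtain ⟨hv0, hvc, -⟩ := (hF v).1 hvF
        rcases mem_union.1 hv with hv | hv
        · obtain ⟨u, hu, hvu⟩ := mem_span.1 hv
          rw [mem_filter] at hu
          have h3 := (D.anc_top_of_ne hvu (by rw [hvc]; exact hu.2.symm)).rank_le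
          have h4 := hmax _ (mem_image_of_mem _ hu.1)
          have h5 := D.rank_top_lt hv0
          rw [hvc] at h5
          omega
        · rw [mem_anc, ← hvc] at hv
          exact D.not_anc_top hv0 hv
      rw [← sum_union disjoint_sdiff, union_sdiff_self_eq_union, ← sum_union hd]
      refine sum_le_sum_of_subset_of_nonneg (fun v hv => ?_) fun v _ _ => hw v
      rw [mem_union, mem_union] at hv
      rcases hv with (hv | hv) | hv
      · obtain ⟨u, hu, hvu⟩ := mem_span.1 hv
        exact mem_span.2 ⟨u, (mem_filter.1 hu).1, hvu⟩
      · obtain ⟨u, hu, rfl⟩ := mem_image.1 hc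
        exact mem_span.2 ⟨u, hu, (mem_anc.1 hv).trans (D.top_anc (hU u hu))⟩
      · exact ((hF v).1 hv).2.2
    push_cast
    linarith

end RTree.Partition.Critical

namespace Network

variable {V : Type*} {N : Network V} {R : RTree V} {ε W : ℝ} {𝒞 : Set (Set (Sym2 V))}
  {D : R.Partition 𝒞}

theorem IsPartitionOf.mk_top_mem_iff (hD : N.IsPartitionOf 𝒞 D) {c : 𝒞} {u : V} :
    s(u, N.compRoot c) ∈ (c : Set (Sym2 V)) ↔
      u ≠ R.root ∧ D.comp u = c ∧ R.par u = D.top c := by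
  rw [← hD.top_eq, hD.mem_iff]
  constructor
  · rintro ⟨v, hv, he, rfl⟩
    rcases Sym2.eq_iff.1 he with ⟨rfl, h1⟩ | ⟨-, h1⟩
    · exact ⟨hv, rfl, h1.symm⟩
    · exact absurd h1 (D.top_ne hv)
  · rintro ⟨h1, h2, h3⟩
    exact ⟨u, h1, by rw [h3], h2⟩

variable [Fintype V]

/-- The height-reduced graph is the height-reduced rooted tree. -/
theorem IsPartitionOf.hat_represents (h : N.Represents R) (hD : N.IsPartitionOf 𝒞 D)
    (K : D.Critical (N.parWt R) W) (hK : ∀ (c : 𝒞) u, N.IsCriticalFor ε 𝒞 c u ↔ u = K.crit c) :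
    (N.hat ε 𝒞).Represents K.hatTree := by
  have hroot : K.hatTree.root = Sum.inl R.root := rfl
  have hll : ∀ u v, N.hatRel ε 𝒞 (Sum.inl u) (Sum.inl v) →
      (u ≠ R.root ∧ K.hatTree.par (Sum.inl u) = Sum.inl v) ∨
      (v ≠ R.root ∧ K.hatTree.par (Sum.inl v) = Sum.inl u) := by
    rintro u v ⟨c, hc, he, hu, hv⟩
    obtain ⟨w, hw, he', hwc⟩ := (hD.mem_iff _ ⟨c, hc⟩).1 he
    have htop : D.top (D.comp w) = N.compRoot c := by rw [hwc, hD.top_eq]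
    rcases Sym2.eq_iff.1 he' with ⟨rfl, rfl⟩ | ⟨rfl, rfl⟩
    · exact Or.inl ⟨hw, K.par_inl_of_ne hw (by rwa [htop])⟩
    · exact Or.inr ⟨hw, K.par_inl_of_ne hw (by rwa [htop])⟩
  have hpar : ∀ u v, u ≠ R.root → K.hatTree.par (Sum.inl u) = Sum.inl v →
      R.par u = v ∧ N.hatRel ε 𝒞 (Sum.inl u) (Sum.inl v) := by
    intro u v hu hp
    by_cases ht : R.par u = D.top (D.comp u)
    · rw [K.par_inl_top hu ht] at hp
      cases hp
    · rw [K.par_inl_of_ne hu ht] at hp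
      have hp' : R.par u = v := Sum.inl_injective hp
      refine ⟨hp', (D.comp u).1, (D.comp u).2, ?_, ?_, ?_⟩
      · rw [← hp']
        exact (hD.mem_iff _ _).2 ⟨u, hu, rfl, rfl⟩
      · rw [← hD.top_eq]
        exact (D.top_ne hu).symm
      · rw [← hD.top_eq, ← hp']
        exact ht
  have hlr : ∀ u (c : 𝒞), N.hatRel ε 𝒞 (Sum.inl u) (Sum.inr c) ↔
      (u ≠ R.root ∧ K.hatTree.par (Sum.inl u) = Sum.inr c) ∨
      K.hatTree.par (Sum.inr c) = Sum.inl u := by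
    intro u c
    show (s(u, N.compRoot c) ∈ c.1 ∨ N.IsCriticalFor ε 𝒞 c.1 u) ↔ _
    rw [hD.mk_top_mem_iff, hK, K.par_inr]
    refine or_congr (and_congr_right fun hu => ?_)
      ⟨fun h => by rw [h], fun h => (Sum.inl_injective h).symm⟩
    constructor
    · rintro ⟨rfl, h2⟩
      exact K.par_inl_top hu h2
    · intro hp
      by_cases ht : R.par u = D.top (D.comp u)
      · rw [K.par_inl_top hu ht] at hp
        rw [← Sum.inr_injective hp]
        exact ⟨rfl, ht⟩
      · rw [K.par_inl_of_ne hu ht] at hp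
        cases hp
  have hne : ∀ (v : V), (Sum.inl v : V ⊕ 𝒞) ≠ K.hatTree.root ↔ v ≠ R.root := fun v => by
    rw [hroot, ne_eq, Sum.inl.injEq]
  refine ⟨by rw [hroot, ← h.root_eq]; rfl, ?_⟩
  rintro (u | c) (v | d)
  · rw [hne, hne]
    refine (SimpleGraph.fromRel_adj _ _ _).trans ⟨?_, ?_⟩
    · rintro ⟨-, h1 | h1⟩
      · exact hll u v h1
      · exact (hll v u h1).symm
    · rintro (⟨h1, h2⟩ | ⟨h1, h2⟩)
      · obtain ⟨h3, h4⟩ := hpar u v h1 h2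
        refine ⟨fun he => ?_, Or.inl h4⟩
        rw [← Sum.inl_injective he] at h3
        exact RTree.par_ne h1 h3
      · obtain ⟨h3, h4⟩ := hpar v u h1 h2
        refine ⟨fun he => ?_, Or.inr h4⟩
        rw [Sum.inl_injective he] at h3
        exact RTree.par_ne h1 h3
  · refine (SimpleGraph.fromRel_adj _ _ _).trans ?_
    rw [hlr, hne]
    have := K.inr_ne_root d
    simp only [ne_eq, reduceCtorEq, not_false_eq_true, true_and, this]
    exact or_iff_left id
  · refine (SimpleGraph.fromRel_adj _ _ _).trans ?_
    rw [hlr, hne]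
    have := K.inr_ne_root c
    simp only [ne_eq, reduceCtorEq, not_false_eq_true, true_and, this]
    rw [or_iff_right (show ¬ N.hatRel ε 𝒞 (Sum.inr c) (Sum.inl v) from id), or_comm]
  · refine (SimpleGraph.fromRel_adj _ _ _).trans ?_
    rw [K.par_inr, K.par_inr]
    have h1 : ¬ N.hatRel ε 𝒞 (Sum.inr c) (Sum.inr d) := id
    have h2 : ¬ N.hatRel ε 𝒞 (Sum.inr d) (Sum.inr c) := id
    simp [h1, h2]

theorem IsPartitionOf.hat_parWt (h : N.Represents R)
    (hw : ∀ e ∈ N.graph.edgeSet, 0 ≤ N.weight e) (hD : N.IsPartitionOf 𝒞 D)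
    (K : D.Critical (N.parWt R) W) : (N.hat ε 𝒞).parWt K.hatTree = K.hatWt := by
  funext x
  by_cases hx : x = K.hatTree.root
  · rw [hx, Represents.parWt_root]
    exact (Represents.parWt_root (N := N) (R := R)).symm
  rw [Represents.parWt_of_ne hx]
  rcases x with v | c
  · have hv : v ≠ R.root := fun hv => hx (by rw [hv]; rfl)
    show _ = N.parWt R v
    rw [Represents.parWt_of_ne hv]
    by_cases ht : R.par v = D.top (D.comp v)
    · rw [K.par_inl_top hv ht]
      show N.hatRootWeight (D.comp v).1 v = _
      have hm : s(v, N.compRoot (D.comp v)) ∈ (D.comp v).1 := hD.mk_top_mem_iff.2 ⟨hv, rfl, ht⟩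
      rw [hatRootWeight, if_pos hm, ht, hD.top_eq]
    · rw [K.par_inl_of_ne hv ht]
      rfl
  · rw [K.par_inr]
    show N.hatRootWeight c.1 (K.crit c) = _
    have hm : ¬ s(K.crit c, N.compRoot c) ∈ c.1 := fun hm => by
      obtain ⟨h1, -, h3⟩ := hD.mk_top_mem_iff.1 hm
      have := K.crit_anc c
      rw [← h3] at this
      exact RTree.not_anc_par h1 this
    rw [hatRootWeight, if_neg hm, ← hD.top_eq, h.wdist_of_anc hw (K.crit_anc c)]
    rfl

theorem IsPartitionOf.mem_hatVerts_iff (hD : N.IsPartitionOf 𝒞 D)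
    (K : D.Critical (N.parWt R) W) {c : 𝒞} {x : V ⊕ 𝒞} :
    x ∈ N.hatVerts c ↔ x ≠ K.hatTree.root ∧ RTree.Partition.Critical.hatComp D x = c := by
  rcases x with v | d
  · have e1 : (Sum.inl v : V ⊕ 𝒞) ∈ N.hatVerts c ↔ v ∈ verts c.1 ∧ v ≠ N.compRoot c := by
      simp [hatVerts]
    have e2 : (Sum.inl v : V ⊕ 𝒞) ≠ K.hatTree.root ↔ v ≠ R.root := by
      rw [show K.hatTree.root = Sum.inl R.root from rfl, ne_eq, Sum.inl.injEq]
    rw [e1, e2, hD.mem_verts_iff, ← hD.top_eq]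
    constructor
    · rintro ⟨h1 | h1, h2⟩
      · exact absurd h1 h2
      · exact h1
    · rintro ⟨h1, h2⟩
      have h3 : D.comp v = c := h2
      exact ⟨Or.inr ⟨h1, h3⟩, fun h4 => D.top_ne h1 (by rw [h3, h4])⟩
  · have e1 : (Sum.inr d : V ⊕ 𝒞) ∈ N.hatVerts c ↔ d = c := by simp [hatVerts]
    rw [e1]
    exact ⟨fun h => ⟨K.inr_ne_root d, h⟩, fun h => h.2⟩

/-- The duplicate of the root of a component is not a leaf. -/
theorem IsPartitionOf.not_isLeaf_inr (h : N.Represents R) (hD : N.IsPartitionOf 𝒞 D)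
    (K : D.Critical (N.parWt R) W) (hK : ∀ (c : 𝒞) u, N.IsCriticalFor ε 𝒞 c u ↔ u = K.crit c)
    (c : 𝒞) : ¬ (N.hat ε 𝒞).IsLeaf (Sum.inr c) := by
  rw [(hD.hat_represents h K hK).isLeaf_iff]
  intro hl
  obtain ⟨v, hv, rfl, hp⟩ := D.exists_child c
  exact hl (Sum.inl v) (K.inl_ne_root hv) (K.par_inl_top hv hp)

end Network

/-! ### The weight of the redistributed tours -/

theorem sum_biUnion_le_of_nonneg {ι α : Type*} {f : α → ℝ} (hf : ∀ a, 0 ≤ f a) (s : Finset ι)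
    (t : ι → Finset α) : ∑ a ∈ s.biUnion t, f a ≤ ∑ i ∈ s, ∑ a ∈ t i, f a := by
  induction s using Finset.induction_on with
  | empty => simp
  | insert i s hi ih =>
    rw [biUnion_insert, sum_insert hi]
    have h1 : ∑ a ∈ t i ∪ s.biUnion t, f a ≤ ∑ a ∈ t i, f a + ∑ a ∈ s.biUnion t, f a :=
      (le_add_of_nonneg_right (sum_nonneg fun a _ => hf a)).trans_eq sum_union_inter
    linarith

namespace RTree.Partition

variable {V C I : Type*} {R : RTree V} (D : R.Partition C)
  {wt : V → ℝ} (L : Finset V) (τ : V → I)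

/-- The terminals in the component `c` that are visited by tour `i`; `L` is the set of terminals and
`τ x` is the tour that visits `x`. -/
def piece (i : I) (c : C) : Finset V := L.filter fun x => τ x = i ∧ D.comp x = c

/-- Tour `i` passes through the component `c` to visit a terminal in another component. -/
def Passes (i : I) (c : C) : Prop :=
  ∃ v, v ≠ R.root ∧ D.comp v = c ∧ ∃ x ∈ L, τ x = i ∧ D.comp x ≠ c ∧ R.Anc v x

variable {L τ}

theorem mem_piece {i : I} {c : C} {x : V} :
    x ∈ D.piece L τ i c ↔ x ∈ L ∧ τ x = i ∧ D.comp x = c := by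
  simp [piece]

variable [Fintype V] (L τ)

/-- The edges in the component `c` that tour `i` uses only to visit its terminals in `c`. -/
def priv (i : I) (c : C) : Finset V :=
  univ.filter fun v => v ≠ R.root ∧ D.comp v = c ∧ (∃ x ∈ D.piece L τ i c, R.Anc v x) ∧
    ¬ ∃ x ∈ L, τ x = i ∧ D.comp x ≠ c ∧ R.Anc v x

variable {L τ}

theorem mem_priv {i : I} {c : C} {v : V} : v ∈ D.priv L τ i c ↔
    v ≠ R.root ∧ D.comp v = c ∧ (∃ x ∈ D.piece L τ i c, R.Anc v x) ∧
      ¬ ∃ x ∈ L, τ x = i ∧ D.comp x ≠ c ∧ R.Anc v x := by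
  simp [priv]

variable {small : I → C → Prop} {σ : I → C → I ⊕ ℕ}

/-- An edge used by a tour after the redistribution was used by this tour before, outside of the
private edges of the small pieces, or is a private edge of a small piece that is now given to
the tour. -/
theorem span_redistributed_subset (hL : ∀ x ∈ L, x ≠ R.root)
    (hne : ∀ i c, small i c → (D.piece L τ i c).Nonempty)
    (h1 : ∀ i c, ¬ small i c → σ i c = Sum.inl i)
    (h2 : ∀ i c i', small i c → σ i c = Sum.inl i' →
      small i' c ∧ (D.Passes L τ i c → D.Passes L τ i' c)) {i' : I} {v : V} (hv : v ≠ R.root)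
    (hvU : v ∈ R.span (L.filter fun x => σ (τ x) (D.comp x) = Sum.inl i')) :
    (v ∈ R.span (L.filter fun x => τ x = i') ∧ ∀ c, small i' c → v ∉ D.priv L τ i' c) ∨
      ∃ i c, small i c ∧ σ i c = Sum.inl i' ∧ v ∈ D.priv L τ i c := by
  obtain ⟨u, hu, hvu⟩ := mem_span.1 hvU
  obtain ⟨huL, hσ⟩ := mem_filter.1 hu
  -- a terminal of `i'` below `v` outside of the component of `v` keeps the edge at `v` public
  have hkeep : ∀ x ∈ L, τ x = i' → R.Anc v x → (D.comp x = D.comp v → ¬ small i' (D.comp v)) →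
      (v ∈ R.span (L.filter fun x => τ x = i') ∧ ∀ c, small i' c → v ∉ D.priv L τ i' c) := by
    intro x hx hxi hvx hc
    refine ⟨mem_span.2 ⟨x, mem_filter.2 ⟨hx, hxi⟩, hvx⟩, fun c hsm hm => ?_⟩
    obtain ⟨-, rfl, -, h4⟩ := D.mem_priv.1 hm
    by_cases h5 : D.comp x = D.comp v
    · exact hc h5 hsm
    · exact h4 ⟨x, hx, hxi, h5, hvx⟩
  by_cases hsm : small (τ u) (D.comp u)
  · obtain ⟨hsm', hpass⟩ := h2 _ _ _ hsm hσ
    by_cases hm : v ∈ D.priv L τ (τ u) (D.comp u)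
    · exact Or.inr ⟨_, _, hsm, hσ, hm⟩
    left
    by_cases hc : D.comp v = D.comp u
    · have h3 : ∃ x ∈ L, τ x = τ u ∧ D.comp x ≠ D.comp u ∧ R.Anc v x := by
        by_contra hcon
        exact hm (D.mem_priv.2 ⟨hv, hc, ⟨u, D.mem_piece.2 ⟨huL, rfl, rfl⟩, hvu⟩, hcon⟩)
      obtain ⟨w, hw0, hwc, y, hy, hyi, hyc, hwy⟩ := hpass ⟨v, hv, hc, h3⟩
      obtain ⟨x, -, -, hxc, hvx⟩ := h3
      have e1 := (D.exit_between hv hvx (by rw [hc]; exact hxc.symm)).1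
      have e2 := (D.exit_between hw0 hwy (by rw [hwc]; exact hyc.symm)).2
      rw [hc] at e1
      rw [hwc] at e2
      exact hkeep y hy hyi (e1.trans e2) fun h => absurd (h.trans hc) hyc
    · obtain ⟨y, hy⟩ := hne _ _ hsm'
      obtain ⟨hyL, hyi, hyc⟩ := D.mem_piece.1 hy
      refine hkeep y hyL hyi ?_ fun h => absurd (h.symm.trans hyc) hc
      have := D.anc_top_of_ne hvu hc
      rw [← hyc] at this
      exact this.trans (D.top_anc (hL y hyL))
  · left
    have h3 : τ u = i' := Sum.inl_injective ((h1 _ _ hsm).symm.trans hσ)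
    refine hkeep u huL h3 hvu fun h => ?_
    rw [← h, ← h3]
    exact hsm

/-- An edge used by a bin of `c` is on the path to the exit vertex of `c`, or was used by a tour only
to visit a piece that it gave to this bin. -/
theorem span_bin_subset (h1 : ∀ i c, ¬ small i c → σ i c = Sum.inl i) {c : C} {b : ℕ} {v : V}
    (hv : v ≠ R.root)
    (hvU : v ∈ R.span (L.filter fun x => D.comp x = c ∧ σ (τ x) c = Sum.inr b)) :
    R.Anc v (D.exit c) ∨ ∃ i, small i c ∧ σ i c = Sum.inr b ∧ v ∈ D.priv L τ i c := by
  obtain ⟨u, hu, hvu⟩ := mem_span.1 hvU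
  obtain ⟨huL, rfl, hσ⟩ := mem_filter.1 hu
  have hsm : small (τ u) (D.comp u) := by
    by_contra hcon
    rw [h1 _ _ hcon] at hσ
    cases hσ
  by_cases hm : v ∈ D.priv L τ (τ u) (D.comp u)
  · exact Or.inr ⟨_, hsm, hσ, hm⟩
  left
  by_cases hc : D.comp v = D.comp u
  · have h3 : ∃ x ∈ L, τ x = τ u ∧ D.comp x ≠ D.comp u ∧ R.Anc v x := by
      by_contra hcon
      exact hm (D.mem_priv.2 ⟨hv, hc, ⟨u, D.mem_piece.2 ⟨huL, rfl, rfl⟩, hvu⟩, hcon⟩)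
    obtain ⟨x, -, -, hxc, hvx⟩ := h3
    have := (D.exit_between hv hvx (by rw [hc]; exact hxc.symm)).1
    rwa [hc] at this
  · exact (D.anc_top_of_ne hvu hc).trans (D.top_anc_exit _)

variable [Fintype C]

/-- Each component is the parent component of at most one exit vertex, so the exit vertices are on
average not farther away than two roots of components. -/
theorem sum_dist_exit_le (hw : ∀ v, 0 ≤ wt v) :
    ∑ c, R.dist wt (D.exit c) ≤ 2 * ∑ c, R.dist wt (D.top c) := by
  let T : Finset C := univ.filter fun c => D.exit c ≠ D.top c
  have hT : ∀ c, ∃ d, c ∈ T → D.top d = D.exit c ∧ D.comp (D.top d) = c := by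
    intro c
    rcases D.exit_cases c with h | ⟨-, h2, d, hd⟩
    · exact ⟨c, fun hc => absurd h (mem_filter.1 hc).2⟩
    · exact ⟨d, fun _ => ⟨hd, by rw [hd, h2]⟩⟩
  choose g hg using hT
  have h1 : ∑ c, R.dist wt (D.exit c)
      ≤ ∑ c, R.dist wt (D.top c) + ∑ c ∈ T, R.dist wt (D.exit c) := by
    rw [show T = univ.filter fun c => D.exit c ≠ D.top c from rfl, sum_filter, ← sum_add_distrib]
    refine sum_le_sum fun c _ => ?_
    have := dist_nonneg (R := R) hw (D.top c)
    by_cases h : D.exit c = D.top c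
    · rw [h]; simp
    · rw [if_pos h]; linarith
  have h2 : ∑ c ∈ T, R.dist wt (D.exit c) ≤ ∑ c, R.dist wt (D.top c) := by
    calc ∑ c ∈ T, R.dist wt (D.exit c) = ∑ c ∈ T, R.dist wt (D.top (g c)) :=
          sum_congr rfl fun c hc => by rw [(hg c hc).1]
      _ = ∑ d ∈ T.image g, R.dist wt (D.top d) := by
          rw [sum_image]
          intro c hc d hd hcd
          rw [← (hg c hc).2, ← (hg d hd).2, hcd]
      _ ≤ _ := sum_le_sum_of_subset_of_nonneg (subset_univ _) fun d _ _ => dist_nonneg hw _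
  linarith

variable [Fintype I]

/-- The redistribution increases the total weight of the tours by at most the weights of the paths
to the exit vertices, one path for each bin. -/
theorem sum_redistributed_le (h0 : wt R.root = 0) (hw : ∀ v, 0 ≤ wt v)
    (hL : ∀ x ∈ L, x ≠ R.root)
    (hne : ∀ i c, small i c → (D.piece L τ i c).Nonempty)
    (h1 : ∀ i c, ¬ small i c → σ i c = Sum.inl i)
    (h2 : ∀ i c i', small i c → σ i c = Sum.inl i' →
      small i' c ∧ (D.Passes L τ i c → D.Passes L τ i' c)) (n : C → ℕ) :
    ∑ i', ∑ a ∈ R.span (L.filter fun x => σ (τ x) (D.comp x) = Sum.inl i'), wt a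
      + ∑ c, ∑ b ∈ range (n c),
          ∑ a ∈ R.span (L.filter fun x => D.comp x = c ∧ σ (τ x) c = Sum.inr b), wt a
      ≤ ∑ i, ∑ a ∈ R.span (L.filter fun x => τ x = i), wt a
        + ∑ c, (n c : ℝ) * R.dist wt (D.exit c) := by
  let M : I → C → Finset V := fun i c => if small i c then D.priv L τ i c else ∅
  let m : I → C → ℝ := fun i c => ∑ a ∈ M i c, wt a
  have hm0 : ∀ i c, 0 ≤ m i c := fun i c => sum_nonneg fun a _ => hw a
  have hroot : ∀ A B : Finset V, (∀ v ∈ A, v ≠ R.root → v ∈ B) →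
      ∑ a ∈ A, wt a ≤ ∑ a ∈ B, wt a := by
    intro A B hAB
    rw [← sum_filter_of_ne (p := fun v => v ≠ R.root) (s := A)
      (fun v _ hv hr => hv (by rw [hr, h0]))]
    exact sum_le_sum_of_subset_of_nonneg (fun v hv => hAB v (mem_filter.1 hv).1 (mem_filter.1 hv).2)
      fun v _ _ => hw v
  have hMmem : ∀ {i c v}, v ∈ M i c ↔ small i c ∧ v ∈ D.priv L τ i c := by
    intro i c v
    simp only [M]
    split_ifs with h <;> simp [h]
  have hA : ∀ i', ∑ a ∈ R.span (L.filter fun x => σ (τ x) (D.comp x) = Sum.inl i'), wt a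
      ≤ ∑ a ∈ R.span (L.filter fun x => τ x = i'), wt a - ∑ c, m i' c
        + ∑ c, ∑ i, if σ i c = Sum.inl i' then m i c else 0 := by
    intro i'
    have e1 : ∑ c, m i' c = ∑ a ∈ univ.biUnion (M i'), wt a := by
      rw [sum_biUnion]
      intro c _ d _ hcd
      rw [Function.onFun, disjoint_left]
      intro v hv hv'
      exact hcd ((D.mem_priv.1 (hMmem.1 hv).2).2.1.symm.trans (D.mem_priv.1 (hMmem.1 hv').2).2.1)
    have e2 : univ.biUnion (M i') ⊆ R.span (L.filter fun x => τ x = i') := by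
      intro v hv
      obtain ⟨c, -, hv⟩ := mem_biUnion.1 hv
      obtain ⟨-, -, ⟨x, hx, hvx⟩, -⟩ := D.mem_priv.1 (hMmem.1 hv).2
      obtain ⟨h3, h4, -⟩ := D.mem_piece.1 hx
      exact mem_span.2 ⟨x, mem_filter.2 ⟨h3, h4⟩, hvx⟩
    have e3 := sum_sdiff (f := wt) e2
    have e4 : ∑ c, ∑ i, (if σ i c = Sum.inl i' then m i c else 0)
        = ∑ p ∈ (univ : Finset (I × C)).filter (fun p => σ p.1 p.2 = Sum.inl i'),
            ∑ a ∈ M p.1 p.2, wt a := by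
      rw [sum_filter, ← univ_product_univ, sum_product_right]
    rw [e1, ← e3, e4, add_sub_cancel_right]
    refine le_trans ?_ (add_le_add_right (sum_biUnion_le_of_nonneg hw _ _) _)
    refine le_trans (hroot _ _ fun v hv hv0 => ?_) ((le_add_of_nonneg_right
          (sum_nonneg fun x _ => hw x)).trans_eq sum_union_inter)
    rw [mem_union]
    rcases D.span_redistributed_subset hL hne h1 h2 hv0 hv with ⟨h3, h4⟩ | ⟨i, c, h3, h4, h5⟩
    · left
      rw [mem_sdiff]
      refine ⟨h3, fun h5 => ?_⟩
      obtain ⟨c, -, h6⟩ := mem_biUnion.1 h5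
      exact h4 c (hMmem.1 h6).1 (hMmem.1 h6).2
    · right
      exact mem_biUnion.2 ⟨(i, c), mem_filter.2 ⟨mem_univ _, h4⟩, hMmem.2 ⟨h3, h5⟩⟩
  have hB : ∀ c b, ∑ a ∈ R.span (L.filter fun x => D.comp x = c ∧ σ (τ x) c = Sum.inr b), wt a
      ≤ R.dist wt (D.exit c) + ∑ i, if σ i c = Sum.inr b then m i c else 0 := by
    intro c b
    rw [← sum_filter]
    refine le_trans ?_ (add_le_add_right (sum_biUnion_le_of_nonneg hw _ _) _)
    refine le_trans (hroot _ _ fun v hv hv0 => ?_) ((le_add_of_nonneg_right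
          (sum_nonneg fun x _ => hw x)).trans_eq sum_union_inter)
    rw [mem_union, mem_anc]
    rcases D.span_bin_subset h1 hv0 hv with h3 | ⟨i, h3, h4, h5⟩
    · exact Or.inl h3
    · exact Or.inr (mem_biUnion.2 ⟨i, mem_filter.2 ⟨mem_univ _, h4⟩, hMmem.2 ⟨h3, h5⟩⟩)
  have hC : ∑ i', ∑ c, ∑ i, (if σ i c = Sum.inl i' then m i c else 0)
      + ∑ c, ∑ b ∈ range (n c), ∑ i, (if σ i c = Sum.inr b then m i c else 0)
      ≤ ∑ i, ∑ c, m i c := by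
    rw [sum_comm, ← sum_add_distrib, sum_comm (s := (univ : Finset I)) (t := (univ : Finset C))]
    refine sum_le_sum fun c _ => ?_
    rw [sum_comm, sum_comm (s := range (n c)), ← sum_add_distrib]
    refine sum_le_sum fun i _ => ?_
    cases hσ : σ i c with
    | inl j => simp
    | inr b =>
      simp only [reduceCtorEq, if_false, sum_const_zero, Sum.inr.injEq, zero_add, sum_ite_eq]
      split_ifs
      exacts [le_rfl, hm0 _ _]
  have e1 := sum_le_sum fun i' (_ : i' ∈ (univ : Finset I)) => hA i'
  have e2 := sum_le_sum fun c (_ : c ∈ (univ : Finset C)) =>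
    sum_le_sum fun b (_ : b ∈ range (n c)) => hB c b
  simp only [sum_add_distrib, sum_sub_distrib, sum_const, card_range, nsmul_eq_mul] at e1 e2
  linarith

end RTree.Partition

/-! ### Tours in the height-reduced tree -/

namespace Network

variable {V : Type*} [Fintype V] {N : Network V} {R : RTree V} {ε : ℝ}

theorem Represents.exists_terminal (h : N.Represents R) (v : V) :
    ∃ x ∈ N.terminals, R.Anc v x := by
  obtain ⟨x, hx, hmax⟩ := (univ.filter fun x => R.Anc v x).exists_max_image R.rank
    ⟨v, by simpa using RTree.Anc.refl v⟩
  have hvx : R.Anc v x := by simpa using hx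
  refine ⟨x, h.isLeaf_iff.2 fun u hu hp => ?_, hvx⟩
  have h1 := R.rank_par u hu
  rw [hp] at h1
  have h2 := hmax u (by simpa using hvx.trans (hp ▸ RTree.anc_par u))
  omega

theorem Represents.Dmin_le (h : N.Represents R) (hw : ∀ e ∈ N.graph.edgeSet, 0 ≤ N.weight e)
    {x : V} (hx : x ∈ N.terminals) : N.Dmin ≤ R.dist (N.parWt R) x := by
  rw [← h.depotDist_eq hw]
  exact csInf_le (Set.toFinite _).bddBelow ⟨x, hx, rfl⟩

/-- Every vertex lies above a terminal, so `D_max` bounds all distances to the root. -/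
theorem Represents.dist_le_Dmax (h : N.Represents R)
    (hw : ∀ e ∈ N.graph.edgeSet, 0 ≤ N.weight e) (v : V) :
    R.dist (N.parWt R) v ≤ N.Dmax := by
  obtain ⟨x, hx, hvx⟩ := h.exists_terminal v
  refine (RTree.dist_mono (h.parWt_nonneg hw) hvx).trans ?_
  rw [← h.depotDist_eq hw]
  exact le_csSup (Set.toFinite _).bddAbove ⟨x, hx, rfl⟩

theorem Represents.Dmin_pos (h : N.Represents R) (hw : ∀ e ∈ N.graph.edgeSet, 0 ≤ N.weight e)
    (hε : 0 < ε) (hd : N.HasBoundedDistances ε) : 0 < N.Dmin := by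
  have h1 := (RTree.dist_nonneg (R := R) (h.parWt_nonneg hw) R.root).trans (h.dist_le_Dmax hw _)
  have h2 : 0 < (1 / ε) ^ (1 / ε - 1) * N.Dmin := h1.trans_lt hd
  exact pos_of_mul_pos_right h2 (Real.rpow_nonneg (by positivity) _)

theorem Represents.terminal_ne_root (h : N.Represents R)
    (hw : ∀ e ∈ N.graph.edgeSet, 0 ≤ N.weight e) (hD0 : 0 < N.Dmin) {x : V}
    (hx : x ∈ N.terminals) : x ≠ R.root := by
  rintro rfl
  have := h.Dmin_le hw hx
  rw [RTree.dist_root Represents.parWt_root] at this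
  linarith

variable {W : ℝ} {𝒞 : Set (Set (Sym2 V))} {D : R.Partition 𝒞}

theorem IsPartitionOf.numTerminals_eq (h : N.Represents R) (hD : N.IsPartitionOf 𝒞 D)
    (hroot : ∀ x ∈ N.terminals, x ≠ R.root) (c : 𝒞) :
    N.numTerminals c = (univ.filter fun x => x ∈ N.terminals ∧ D.comp x = c).card := by
  rw [numTerminals, ← Set.ncard_coe_finset]
  congr 1
  ext x
  simp only [Set.mem_inter_iff, hD.mem_verts_iff, coe_filter, mem_univ, true_and, Set.mem_ofPred_eq]
  constructor
  · rintro ⟨rfl | ⟨h1, h2⟩, h3⟩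
    · obtain ⟨v, hv, -, hp⟩ := D.exists_child c
      exact absurd hp (h.isLeaf_iff.1 h3 v hv)
    · exact ⟨h3, h2⟩
  · rintro ⟨h1, h2⟩
    exact ⟨Or.inr ⟨hroot x h1, h2⟩, h1⟩

/-- A distribution `q` of the terminals to tours, together with `pad c` dummy terminals in `c` for
the tour `p₀ c`, gives a solution in the height-reduced tree. Here `U j` is the set of terminals of
the tour `j`. A tour that visits at least `α k` terminals in each of its components visits at most
`1 / α` components, and pays at most one class width for each of them; the tours other than `p₀ c`
have `α k` real terminals in `c`, so their number is bounded by the number of terminals in `c`. -/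
theorem exists_hat_solution (h : N.Represents R) (hw : ∀ e ∈ N.graph.edgeSet, 0 ≤ N.weight e)
    (hε : 0 < ε) (hD0 : 0 < N.Dmin) {k : ℕ} (hk : 1 ≤ k) (hD : N.IsPartitionOf 𝒞 D)
    (hnum : ∀ c ∈ 𝒞, (N.numTerminals c : ℝ) ≤ 2 * Γ ε * k)
    (K : D.Critical (N.parWt R) (N.classWidth ε))
    (hK : ∀ (c : 𝒞) u, N.IsCriticalFor ε 𝒞 c u ↔ u = K.crit c)
    {J : Type*} [Fintype J] (q : V → J) (pad : 𝒞 → ℕ) (p₀ : 𝒞 → J) (U : J → Finset V)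
    (hU : ∀ j x, x ∈ U j ↔ x ∈ N.terminals ∧ q x = j)
    (hpad : ∀ c, 0 < pad c → ∃ x ∈ U (p₀ c), D.comp x = c)
    (hload : ∀ j, (U j).card + ∑ c ∈ univ.filter (fun c => p₀ c = j), pad c ≤ k)
    (hpart : ∀ j c, ((U j).filter (D.comp · = c)).Nonempty →
      α ε * k ≤ (((U j).filter (D.comp · = c)).card : ℝ) + if p₀ c = j then (pad c : ℝ) else 0)
    (hpart' : ∀ j c, ((U j).filter (D.comp · = c)).Nonempty → j ≠ p₀ c →
      α ε * k ≤ (((U j).filter (D.comp · = c)).card : ℝ)) :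
    ∃ (m : ℕ) (E : Fin m → V ⊕ 𝒞) (n : ℕ) (S : Fin n → (N.hat ε 𝒞).Tour (N.hatLoc E)),
      (∀ j, ¬ (N.hat ε 𝒞).IsLeaf (E j)) ∧
      IsFeasible k S ∧
      (∀ c : 𝒞, ({i | ∃ x ∈ (S i).visited, N.hatLoc E x ∈ N.hatVerts c}.ncard : ℝ) ≤
        2 * Γ ε / α ε + 1) ∧
      (∀ (c : 𝒞) (i : Fin n), (∃ x ∈ (S i).visited, N.hatLoc E x ∈ N.hatVerts c) →
        α ε * k ≤ ({x | x ∈ (S i).visited ∧ N.hatLoc E x ∈ N.hatVerts c}.ncard : ℝ)) ∧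
      totalCost S ≤ (1 + ε) * ∑ j, 2 * ∑ a ∈ R.span (U j), N.parWt R a := by
  have hα : 0 < α ε := Real.rpow_pos_of_pos hε _
  have hk0 : (0 : ℝ) < k := by exact_mod_cast hk
  have ha : 0 < α ε * k := mul_pos hα hk0
  have hwt := h.parWt_nonneg hw
  have hrep := hD.hat_represents h K hK
  have hhw : (N.hat ε 𝒞).parWt K.hatTree = K.hatWt := hD.hat_parWt h hw K
  have hroot : ∀ x ∈ N.terminals, x ≠ R.root := fun x hx => h.terminal_ne_root hw hD0 hx
  have hUroot : ∀ j, ∀ x ∈ U j, x ≠ R.root := fun j x hx => hroot x ((hU j x).1 hx).1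
  have hWpos : 0 ≤ N.classWidth ε := by unfold classWidth; positivity
  -- the dummy terminals in `c` are placed at the duplicate of the root of `c`
  let Δ := Σ c : 𝒞, Fin (pad c)
  let e : Fin (Fintype.card Δ) ≃ Δ := (Fintype.equivFin Δ).symm
  let E : Fin (Fintype.card Δ) → V ⊕ 𝒞 := fun t => Sum.inr (e t).1
  let ρ : N.terminals ⊕ Fin (Fintype.card Δ) → J :=
    Sum.elim (fun x => q x.1) fun t => p₀ (e t).1
  -- Counting the tokens of the tours means counting terminals and adding up `pad`.
  have hcount : ∀ (f : V → Prop) (g : 𝒞 → Prop) (A : Finset V) (B : Finset 𝒞),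
      (∀ x, x ∈ A ↔ x ∈ N.terminals ∧ f x) → (∀ c, c ∈ B ↔ g c) →
      (univ.filter fun y : N.terminals ⊕ Fin (Fintype.card Δ) =>
        Sum.elim (fun x => f x.1) (fun t => g (e t).1) y).card = A.card + ∑ c ∈ B, pad c := by
    intro f g A B hA hB
    have e1 : (univ.filter fun y : N.terminals ⊕ Fin (Fintype.card Δ) =>
        Sum.elim (fun x => f x.1) (fun t => g (e t).1) y)
        = (univ.filter fun x : N.terminals => f x.1).disjSum
          (univ.filter fun t => (e t).1 ∈ B) := by
      ext y
      rcases y with x | t <;> simp [hB]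
    have e2 : (univ.filter fun x : N.terminals => f x.1).map (Function.Embedding.subtype _)
        = A := by
      ext x
      simp [hA, and_comm]
    rw [e1, card_disjSum, ← e2, card_map, card_filter (fun t => (e t).1 ∈ B),
      e.sum_comp (fun y : Δ => if y.1 ∈ B then 1 else 0), Fintype.sum_sigma]
    congr 1
    rw [← univ_inter B, ← filter_mem_eq_inter, sum_filter]
    refine sum_congr rfl fun c _ => ?_
    by_cases hc : c ∈ B <;> simp [hc]
  choose walk hwalk1 hwalk2 using fun j : J => hrep.exists_closed_walk
    (K.hatTree.span ((U j).image Sum.inl)) (fun a ha b hb => RTree.anc_mem_span hb ha)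
  have hdummy : ∀ c, 0 < pad c →
      (Sum.inr c : V ⊕ 𝒞) ∈ K.hatTree.span ((U (p₀ c)).image Sum.inl) := by
    intro c hc
    obtain ⟨x, hx, rfl⟩ := hpad c hc
    exact RTree.mem_span.2 ⟨_, mem_image_of_mem _ hx, K.inr_anc_inl (hUroot _ x hx)⟩
  have hloc : ∀ y : N.terminals ⊕ Fin (Fintype.card Δ),
      N.hatLoc E y ∈ K.hatTree.span ((U (ρ y)).image Sum.inl) := by
    rintro (x | t)
    · exact RTree.mem_span.2 ⟨_, mem_image_of_mem _ ((hU _ _).2 ⟨x.2, rfl⟩), RTree.Anc.refl _⟩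
    · exact hdummy _ (Fin.pos (e t).2)
  let eJ : Fin (Fintype.card J) ≃ J := (Fintype.equivFin J).symm
  let S : Fin (Fintype.card J) → (N.hat ε 𝒞).Tour (N.hatLoc E) := fun i =>
    { walk := walk (eJ i)
      visited := univ.filter fun y => ρ y = eJ i
      visited_on_walk := fun y hy => hwalk1 _ _ (by
        rw [← (mem_filter.1 hy).2]
        exact hloc y) }
  have hSv : ∀ i y, y ∈ (S i).visited ↔ ρ y = eJ i := fun i y => by simp [S]
  have hcomp : ∀ (c : 𝒞) y, N.hatLoc E y ∈ N.hatVerts c ↔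
      Sum.elim (fun x : N.terminals => D.comp x.1 = c) (fun t => (e t).1 = c) y := by
    intro c y
    rw [hD.mem_hatVerts_iff K]
    rcases y with x | t
    · exact and_iff_right (K.inl_ne_root (hroot x.1 x.2))
    · exact and_iff_right (K.inr_ne_root _)
  -- a tour that visits a token in a component visits a real terminal there
  have hreal : ∀ (c : 𝒞) i, (∃ y ∈ (S i).visited, N.hatLoc E y ∈ N.hatVerts c) →
      ((U (eJ i)).filter (D.comp · = c)).Nonempty := by
    rintro c i ⟨y, hy, hyc⟩
    rw [hSv] at hy
    rw [hcomp] at hyc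
    rcases y with x | t
    · exact ⟨x.1, mem_filter.2 ⟨(hU _ _).2 ⟨x.2, hy⟩, hyc⟩⟩
    · obtain ⟨x, hx, hxc⟩ := hpad _ (Fin.pos (e t).2)
      exact ⟨x, mem_filter.2 ⟨by rwa [← hy], hxc.trans hyc⟩⟩
  refine ⟨_, E, _, S, fun t => hD.not_isLeaf_inr h K hK _, ⟨fun i => ?_, fun y => ?_⟩, fun c => ?_,
    fun c i hi => ?_, ?_⟩
  · have e1 : (S i).visited = univ.filter fun y : N.terminals ⊕ Fin (Fintype.card Δ) =>
        Sum.elim (fun x : N.terminals => q x.1 = eJ i) (fun t => p₀ (e t).1 = eJ i) y := by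
      ext y
      rw [hSv, mem_filter]
      rcases y with x | t <;> simp [ρ]
    rw [e1, hcount (fun x => q x = eJ i) (fun c => p₀ c = eJ i) (U (eJ i))
      (univ.filter fun c => p₀ c = eJ i) (hU _) (fun c => by simp)]
    exact hload _
  · refine ⟨eJ.symm (ρ y), (hSv _ _).2 (by simp), fun i hi => ?_⟩
    rw [(hSv i y).1 hi]
    simp
  · let Jc := univ.filter fun j : J => ((U j).filter (D.comp · = c)).Nonempty
    have h1 : {i | ∃ x ∈ (S i).visited, N.hatLoc E x ∈ N.hatVerts c}.ncard ≤ Jc.card := by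
      rw [← Set.ncard_coe_finset]
      refine Set.ncard_le_ncard_of_injOn eJ (fun i hi => ?_) (eJ.injective.injOn)
      exact mem_filter.2 ⟨mem_univ _, hreal c i hi⟩
    have h2 : ((Jc.erase (p₀ c)).card : ℝ) * (α ε * k) ≤ 2 * Γ ε * k := by
      refine le_trans ?_ (hnum c c.2)
      rw [hD.numTerminals_eq h hroot]
      calc ((Jc.erase (p₀ c)).card : ℝ) * (α ε * k)
          ≤ ∑ j ∈ Jc.erase (p₀ c), (((U j).filter (D.comp · = c)).card : ℝ) := by
            rw [← nsmul_eq_mul]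
            refine card_nsmul_le_sum _ _ _ fun j hj => ?_
            rw [mem_erase] at hj
            exact hpart' j c (mem_filter.1 hj.2).2 hj.1
        _ ≤ ∑ j, (((U j).filter (D.comp · = c)).card : ℝ) :=
            sum_le_sum_of_subset_of_nonneg (subset_univ _) fun _ _ _ => Nat.cast_nonneg _
        _ = _ := by
            rw [← Nat.cast_sum, Nat.cast_inj,
              card_eq_sum_card_fiberwise (f := q) (t := univ) (fun _ _ => mem_coe.2 (mem_univ _))]
            refine sum_congr rfl fun j _ => ?_
            congr 1
            ext x
            simp only [mem_filter, mem_univ, true_and, hU]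
            tauto
    have h3 : (Jc.card : ℝ) ≤ (Jc.erase (p₀ c)).card + 1 := by
      have := Jc.pred_card_le_card_erase (a := p₀ c)
      have h4 : Jc.card ≤ (Jc.erase (p₀ c)).card + 1 := by omega
      exact_mod_cast h4
    have h4 : ((Jc.erase (p₀ c)).card : ℝ) ≤ 2 * Γ ε / α ε := by
      rw [le_div_iff₀ hα]
      nlinarith
    have h5 : ({i | ∃ x ∈ (S i).visited, N.hatLoc E x ∈ N.hatVerts c}.ncard : ℝ) ≤ Jc.card := by
      exact_mod_cast h1
    linarith
  · have e1 : {x | x ∈ (S i).visited ∧ N.hatLoc E x ∈ N.hatVerts c}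
        = (univ.filter fun y : N.terminals ⊕ Fin (Fintype.card Δ) =>
          Sum.elim (fun x : N.terminals => q x.1 = eJ i ∧ D.comp x.1 = c)
            (fun t => p₀ (e t).1 = eJ i ∧ (e t).1 = c) y : Finset _) := by
      ext y
      rw [Set.mem_ofPred_eq, hSv, hcomp, mem_coe, mem_filter]
      rcases y with x | t <;> simp [ρ]
    rw [e1, Set.ncard_coe_finset, hcount (fun x => q x = eJ i ∧ D.comp x = c)
      (fun d => p₀ d = eJ i ∧ d = c) ((U (eJ i)).filter (D.comp · = c))
      (if p₀ c = eJ i then {c} else ∅) (fun x => by simp [hU, and_assoc]) (fun d => ?_)]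
    · refine (hpart _ c (hreal c i hi)).trans (le_of_eq ?_)
      push_cast
      congr 1
      split_ifs <;> simp
    · split_ifs with hp
      · rw [mem_singleton]
        exact ⟨fun hd => ⟨hd ▸ hp, hd⟩, fun hd => hd.2⟩
      · simp only [notMem_empty, false_iff]
        rintro ⟨h1, rfl⟩
        exact hp h1
  · have hcost : ∀ j, (N.hat ε 𝒞).cost (walk j)
        ≤ (1 + ε) * (2 * ∑ a ∈ R.span (U j), N.parWt R a) := by
      intro j
      rw [hwalk2, hhw]
      have h1 : ∑ x ∈ K.hatTree.span ((U j).image Sum.inl), K.hatWt x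
          ≤ ∑ a ∈ R.span (U j), N.parWt R a + ((U j).image D.comp).card * N.classWidth ε := by
        convert K.hat_span_le Represents.parWt_root hwt hWpos (U j) (hUroot j)
      -- the tour meets at most `1 / α` components
      have h2 : (((U j).image D.comp).card : ℝ) * (α ε * k) ≤ k := by
        have h3 : (((U j).image D.comp).card : ℝ) * (α ε * k)
            ≤ ∑ c ∈ (U j).image D.comp, ((((U j).filter (D.comp · = c)).card : ℝ)
              + if p₀ c = j then (pad c : ℝ) else 0) := by
          rw [← nsmul_eq_mul]
          refine card_nsmul_le_sum _ _ _ fun c hc => hpart j c ?_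
          obtain ⟨x, hx, rfl⟩ := mem_image.1 hc
          exact ⟨x, mem_filter.2 ⟨hx, rfl⟩⟩
        have h4 : ∑ c ∈ (U j).image D.comp, (if p₀ c = j then (pad c : ℝ) else 0)
            ≤ ∑ c ∈ univ.filter (fun c => p₀ c = j), (pad c : ℝ) := by
          rw [sum_filter]
          refine sum_le_sum_of_subset_of_nonneg (subset_univ _) fun c _ _ => ?_
          split_ifs
          exacts [Nat.cast_nonneg _, le_rfl]
        have h5 : ∑ c ∈ (U j).image D.comp, (((U j).filter (D.comp · = c)).card : ℝ)
            = (U j).card := by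
          rw [← Nat.cast_sum, ← card_eq_sum_card_image]
        have h6 : ((U j).card : ℝ) + ∑ c ∈ univ.filter (fun c => p₀ c = j), (pad c : ℝ) ≤ k := by
          exact_mod_cast hload j
        rw [sum_add_distrib] at h3
        linarith
      have h3 : (((U j).image D.comp).card : ℝ) * N.classWidth ε
          ≤ ε * ∑ a ∈ R.span (U j), N.parWt R a := by
        rcases (U j).eq_empty_or_nonempty with hem | ⟨x, hx⟩
        · rw [hem]; simp [RTree.span]
        · have h4 : (((U j).image D.comp).card : ℝ) * α ε ≤ 1 := by
            rw [← mul_assoc] at h2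
            exact le_of_mul_le_mul_right (by linarith) hk0
          have h5 := (h.Dmin_le hw ((hU j x).1 hx).1).trans (RTree.dist_le_span hwt hx)
          have h6 := mul_le_mul_of_nonneg_left h5 hε.le
          have h7 : 0 ≤ ε * N.Dmin := by positivity
          calc (((U j).image D.comp).card : ℝ) * N.classWidth ε
              = (((U j).image D.comp).card : ℝ) * α ε * (ε * N.Dmin) := by
                rw [classWidth]; ring
            _ ≤ 1 * (ε * N.Dmin) := mul_le_mul_of_nonneg_right h4 h7
            _ ≤ _ := by rw [one_mul]; exact h6
      refine (mul_le_mul_of_nonneg_left h1 zero_le_two).trans ?_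
      linarith
    rw [mul_sum]
    calc totalCost S = ∑ j, (N.hat ε 𝒞).cost (walk j) :=
          eJ.sum_comp fun j => (N.hat ε 𝒞).cost (walk j)
      _ ≤ _ := sum_le_sum fun j _ => hcost j

end Network

/-! ### The cost of the redistributed tours -/

theorem α_pos {ε : ℝ} (hε : 0 < ε) : 0 < α ε := Real.rpow_pos_of_pos hε _

theorem α_le {ε : ℝ} (hε : 0 < ε) (h1 : ε ≤ 1) : α ε ≤ ε := by
  have h2 : (1 : ℝ) ≤ 1 / ε + 1 := by
    have : 0 < 1 / ε := by positivity
    linarith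
  calc α ε = ε ^ (1 / ε + 1) := rfl
    _ ≤ ε ^ (1 : ℝ) := Real.rpow_le_rpow_of_exponent_ge hε h1 h2
    _ = ε := Real.rpow_one ε

theorem α_mul_rpow {ε : ℝ} (hε : 0 < ε) : α ε * (1 / ε) ^ (1 / ε - 1) = ε ^ 2 := by
  rw [α, one_div ε, Real.inv_rpow hε.le, ← Real.rpow_neg hε.le, ← Real.rpow_add hε,
    ← Real.rpow_natCast]
  congr 1
  push_cast
  ring

namespace Network

variable {V : Type*} [Fintype V] {N : Network V} {R : RTree V} {ε : ℝ}
  {𝒞 : Set (Set (Sym2 V))} {D : R.Partition 𝒞}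

/-- The roots of the components are paid for by the terminals: each component is charged to a big
component below it. -/
theorem IsDecomposition.sum_dist_top_le (h : N.Represents R)
    (hw : ∀ e ∈ N.graph.edgeSet, 0 ≤ N.weight e) (hD0 : 0 < N.Dmin) {k : ℕ}
    (hd : N.IsDecomposition ε k 𝒞) (hD : N.IsPartitionOf 𝒞 D) :
    Γ ε * k * ∑ c, R.dist (N.parWt R) (D.top c)
      ≤ 3 * ∑ x ∈ univ.filter (· ∈ N.terminals), R.dist (N.parWt R) x := by
  have hwt := h.parWt_nonneg hw
  have hdist : ∀ v, 0 ≤ R.dist (N.parWt R) v := fun v => RTree.dist_nonneg hwt v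
  have hroot : ∀ x ∈ N.terminals, x ≠ R.root := fun x hx => h.terminal_ne_root hw hD0 hx
  by_cases hcard : 1 < 𝒞.ncard
  · obtain ⟨f, hbig, hdesc, hfib⟩ := hd.big_map hcard
    let g : 𝒞 → ℝ := fun b => ∑ x ∈ (univ.filter (· ∈ N.terminals)).filter (D.comp · = b),
      R.dist (N.parWt R) x
    have hg0 : ∀ b, 0 ≤ g b := fun b => sum_nonneg fun x _ => hdist x
    have h1 : ∀ c, Γ ε * k * R.dist (N.parWt R) (D.top c) ≤ g (f c) := by
      intro c
      have h2 : R.Anc (D.top c) (D.top (f c)) := by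
        rcases hdesc c with h3 | ⟨v, hv, -, h3⟩
        · rw [Subtype.ext h3]; exact RTree.Anc.refl _
        · rw [← hD.top_eq, h.isAncestor_iff] at h3
          refine RTree.Anc.trans ?_ h3
          rcases hD.mem_verts_iff.1 hv with rfl | ⟨h4, rfl⟩
          exacts [RTree.Anc.refl _, D.top_anc h4]
      calc Γ ε * k * R.dist (N.parWt R) (D.top c)
          ≤ N.numTerminals (f c) * R.dist (N.parWt R) (D.top (f c)) :=
            mul_le_mul (hbig c) (RTree.dist_mono hwt h2) (hdist _) (Nat.cast_nonneg _)
        _ ≤ g (f c) := by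
          rw [hD.numTerminals_eq h hroot, ← nsmul_eq_mul, ← filter_filter]
          refine card_nsmul_le_sum _ _ _ fun x hx => ?_
          simp only [mem_filter, mem_univ, true_and] at hx
          rw [← hx.2]
          exact RTree.dist_mono hwt (D.top_anc (hroot x hx.1))
    calc Γ ε * k * ∑ c, R.dist (N.parWt R) (D.top c)
        = ∑ c, Γ ε * k * R.dist (N.parWt R) (D.top c) := mul_sum _ _ _
      _ ≤ ∑ c, g (f c) := sum_le_sum fun c _ => h1 c
      _ = ∑ b, ∑ c ∈ univ.filter (fun c => f c = b), g (f c) :=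
        (sum_fiberwise _ _ _).symm
      _ ≤ ∑ b, 3 * g b := by
        refine sum_le_sum fun b _ => ?_
        rw [sum_congr rfl fun c hc => by rw [(mem_filter.1 hc).2], sum_const, nsmul_eq_mul]
        refine mul_le_mul_of_nonneg_right ?_ (hg0 b)
        have h2 := hfib b
        rw [← Set.ncard_coe_finset, coe_filter_univ]
        exact_mod_cast h2
      _ = _ := by rw [← mul_sum, sum_fiberwise]
  · -- a single component has the depot as its root
    have h1 : ∀ c, D.top c = R.root := by
      intro c
      by_contra hc
      have h2 : D.comp (D.top c) ≠ c := fun h3 => D.top_ne hc (by rw [h3])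
      refine hcard ((Set.one_lt_ncard (Set.toFinite _)).2
        ⟨_, (D.comp (D.top c)).2, _, c.2, fun h3 => h2 (Subtype.ext h3)⟩)
    simp only [h1, RTree.dist_root Represents.parWt_root, sum_const_zero, mul_zero]
    exact mul_nonneg (by norm_num) (sum_nonneg fun x _ => hdist x)

/-- The paths from the depot to the exit vertices that are needed for the bins are cheap. -/
theorem IsDecomposition.sum_bins_mul_dist_exit_le (h : N.Represents R)
    (hw : ∀ e ∈ N.graph.edgeSet, 0 ≤ N.weight e) (hε : 0 < ε) (hbd : N.HasBoundedDistances ε)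
    {k : ℕ} (hk : 1 ≤ k) (hd : N.IsDecomposition ε k 𝒞) (hD : N.IsPartitionOf 𝒞 D) {Q : ℝ} {m : ℕ}
    (hdQ : ∑ x ∈ univ.filter (· ∈ N.terminals), R.dist (N.parWt R) x ≤ k * Q)
    (hIQ : m * N.Dmin ≤ Q) (u : 𝒞 → ℕ) (hu : ∑ c, u c ≤ m) {j : ℕ} (hj : 1 ≤ j)
    (hjα : 1 ≤ 4 * α ε * j) :
    ∑ c, ((u c / j + 1 : ℕ) : ℝ) * R.dist (N.parWt R) (D.exit c) ≤ (ε / 2 + 4 * ε ^ 2) * Q := by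
  have hD0 : 0 < N.Dmin := h.Dmin_pos hw hε hbd
  have hα := α_pos hε
  have hk0 : (0 : ℝ) < k := by exact_mod_cast hk
  have hwt := h.parWt_nonneg hw
  have hdist : ∀ v, 0 ≤ R.dist (N.parWt R) v := fun v => RTree.dist_nonneg hwt v
  have h1 : ∑ c, R.dist (N.parWt R) (D.exit c) ≤ ε / 2 * Q := by
    have h2 := D.sum_dist_exit_le hwt
    have h3 := (hd.sum_dist_top_le h hw hD0 hD).trans
      (mul_le_mul_of_nonneg_left hdQ (by norm_num))
    have h4 : Γ ε * k * ∑ c, R.dist (N.parWt R) (D.top c)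
        = k / ε * (12 * ∑ c, R.dist (N.parWt R) (D.top c)) := by rw [Γ]; ring
    have h5 : 3 * (k * Q) = k / ε * (3 * ε * Q) := by field_simp
    rw [h4, h5] at h3
    have h6 := le_of_mul_le_mul_left h3 (by positivity)
    linarith
  have h2 : ∑ c, ((u c / j : ℕ) : ℝ) * R.dist (N.parWt R) (D.exit c)
      ≤ 4 * ε ^ 2 * Q := by
    have hDmax : 0 ≤ N.Dmax := (hdist R.root).trans (h.dist_le_Dmax hw _)
    have hαD : α ε * N.Dmax ≤ ε ^ 2 * N.Dmin := by
      rw [← α_mul_rpow hε, mul_assoc]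
      exact mul_le_mul_of_nonneg_left hbd.le hα.le
    have hj0 : (0 : ℝ) < j := by exact_mod_cast hj
    calc ∑ c, ((u c / j : ℕ) : ℝ) * R.dist (N.parWt R) (D.exit c)
        ≤ ∑ c, (u c : ℝ) * (4 * α ε * N.Dmax) := by
          refine sum_le_sum fun c _ => ?_
          have h3 : ((u c / j : ℕ) : ℝ) ≤ u c * (4 * α ε) := by
            refine Nat.cast_div_le.trans ?_
            rw [div_le_iff₀ hj0, mul_assoc]
            exact le_mul_of_one_le_right (Nat.cast_nonneg _) hjα
          calc _ ≤ u c * (4 * α ε) * N.Dmax :=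
                mul_le_mul h3 (h.dist_le_Dmax hw _) (hdist _) (by positivity)
            _ = _ := by ring
      _ = (∑ c, u c : ℕ) * (4 * α ε * N.Dmax) := by rw [← sum_mul, Nat.cast_sum]
      _ ≤ m * (4 * α ε * N.Dmax) :=
          mul_le_mul_of_nonneg_right (by exact_mod_cast hu) (by positivity)
      _ ≤ m * (4 * (ε ^ 2 * N.Dmin)) := by
          refine mul_le_mul_of_nonneg_left ?_ (Nat.cast_nonneg _)
          linarith
      _ = 4 * ε ^ 2 * (m * N.Dmin) := by ring
      _ ≤ _ := mul_le_mul_of_nonneg_left hIQ (by positivity)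
  have h3 : ∑ c, ((u c / j + 1 : ℕ) : ℝ) * R.dist (N.parWt R) (D.exit c)
      = ∑ c, ((u c / j : ℕ) : ℝ) * R.dist (N.parWt R) (D.exit c)
        + ∑ c, R.dist (N.parWt R) (D.exit c) := by
    rw [← sum_add_distrib]
    refine sum_congr rfl fun c _ => ?_
    push_cast
    ring
  rw [h3]
  linarith

/-- A distribution of the terminals to tours of at most `k` terminals can be turned into a solution
in the height-reduced tree with the required properties at the expense of a factor `1 + 2ε`. -/
theorem IsDecomposition.exists_hat_solution (h : N.Represents R)
    (hw : ∀ e ∈ N.graph.edgeSet, 0 ≤ N.weight e) (hε : 0 < ε) (hε' : ε ≤ 1 / 32)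
    (hbd : N.HasBoundedDistances ε) {k : ℕ} (hk : 1 ≤ k)
    (hd : N.IsDecomposition ε k 𝒞) (hD : N.IsPartitionOf 𝒞 D)
    (K : D.Critical (N.parWt R) (N.classWidth ε))
    (hK : ∀ (c : 𝒞) u, N.IsCriticalFor ε 𝒞 c u ↔ u = K.crit c)
    {I : Type*} [Fintype I] (τ : V → I) (X : I → Finset V)
    (hX : ∀ i x, x ∈ X i ↔ x ∈ N.terminals ∧ τ x = i) (hXk : ∀ i, (X i).card ≤ k)
    (hXne : ∀ i, (X i).Nonempty) :
    ∃ (m : ℕ) (E : Fin m → V ⊕ 𝒞) (n : ℕ) (S' : Fin n → (N.hat ε 𝒞).Tour (N.hatLoc E)),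
      (∀ j, ¬ (N.hat ε 𝒞).IsLeaf (E j)) ∧
      IsFeasible k S' ∧
      (∀ c : 𝒞, ({i | ∃ x ∈ (S' i).visited, N.hatLoc E x ∈ N.hatVerts c}.ncard : ℝ) ≤
        2 * Γ ε / α ε + 1) ∧
      (∀ (c : 𝒞) (i : Fin n), (∃ x ∈ (S' i).visited, N.hatLoc E x ∈ N.hatVerts c) →
        α ε * k ≤ ({x | x ∈ (S' i).visited ∧ N.hatLoc E x ∈ N.hatVerts c}.ncard : ℝ)) ∧
      totalCost S' ≤ (1 + 2 * ε) * ∑ i, 2 * ∑ a ∈ R.span (X i), N.parWt R a := by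
  have hD0 : 0 < N.Dmin := h.Dmin_pos hw hε hbd
  have hα := α_pos hε
  have hαε := α_le hε (by linarith)
  have hk0 : (0 : ℝ) < k := by exact_mod_cast hk
  have ha : 0 < α ε * k := mul_pos hα hk0
  have hwt := h.parWt_nonneg hw
  have hdist : ∀ v, 0 ≤ R.dist (N.parWt R) v := fun v => RTree.dist_nonneg hwt v
  let L : Finset V := univ.filter (· ∈ N.terminals)
  have hLmem : ∀ x, x ∈ L ↔ x ∈ N.terminals := fun x => by simp [L]
  have hL : ∀ x ∈ L, x ≠ R.root := fun x hx => h.terminal_ne_root hw hD0 ((hLmem x).1 hx)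
  obtain rfl : X = fun i => L.filter fun x => τ x = i := by
    ext i x
    rw [hX, mem_filter, hLmem]
  let X : I → Finset V := fun i => L.filter fun x => τ x = i
  let w : I → ℝ := fun i => ∑ a ∈ R.span (X i), N.parWt R a
  have hIQ : Fintype.card I * N.Dmin ≤ ∑ i, w i := by
    rw [← nsmul_eq_mul, ← card_univ]
    refine card_nsmul_le_sum _ _ _ fun i _ => ?_
    obtain ⟨x, hx⟩ := hXne i
    exact (h.Dmin_le hw ((hLmem x).1 (mem_filter.1 hx).1)).trans (RTree.dist_le_span hwt hx)
  have hdQ : ∑ x ∈ L, R.dist (N.parWt R) x ≤ k * ∑ i, w i := by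
    rw [← sum_fiberwise L τ, mul_sum]
    refine sum_le_sum fun i _ => (sum_le_card_nsmul (X i) _ (w i) fun x hx =>
      RTree.dist_le_span hwt hx).trans ?_
    rw [nsmul_eq_mul]
    exact mul_le_mul_of_nonneg_right (by exact_mod_cast hXk i) (sum_nonneg fun a _ => hwt a)
  -- a bin has room for `j = ⌊1 / (2α)⌋` groups of size at most `2αk`
  obtain ⟨j, hj, haj, hjα⟩ : ∃ j : ℕ, 1 ≤ j ∧ 2 * (α ε * k) * j ≤ k ∧ 1 ≤ 4 * α ε * j := by
    have h1 : 1 ≤ 1 / (4 * α ε) := by rw [le_div_iff₀ (by positivity)]; linarith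
    have h2 : 1 / (2 * α ε) = 2 * (1 / (4 * α ε)) := by field_simp; norm_num
    have h3 := Nat.floor_le (a := 1 / (2 * α ε)) (by positivity)
    have h4 := Nat.lt_floor_add_one (1 / (2 * α ε))
    have h5 : 1 / (4 * α ε) ≤ (⌊1 / (2 * α ε)⌋₊ : ℝ) := by linarith
    refine ⟨⌊1 / (2 * α ε)⌋₊, by exact_mod_cast h1.trans h5, ?_, ?_⟩
    · rw [le_div_iff₀ (by positivity)] at h3
      nlinarith
    · rw [div_le_iff₀ (by positivity)] at h5
      linarith
  let s : I → 𝒞 → ℝ := fun i c => ((D.piece L τ i c).card : ℝ)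
  obtain ⟨u, σ, hu, hσ1, hσ2, hσ3, hσ4, hσ5, hσ6, hσ7⟩ := exists_redistribution s
    (fun i c => Nat.cast_nonneg _) (fun i c => decide (D.Passes L τ i c)) ha hj haj
  have hcount : ∀ (c : 𝒞) (y : I ⊕ ℕ),
      ((L.filter fun x => D.comp x = c ∧ σ (τ x) c = y).card : ℝ)
        = ∑ i ∈ univ.filter (fun i => σ i c = y), s i c := by
    intro c y
    rw [card_eq_sum_card_fiberwise (f := τ) (t := univ.filter fun i => σ i c = y)
      (fun x hx => by simpa using (mem_filter.1 hx).2.2), Nat.cast_sum]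
    refine sum_congr rfl fun i hi => ?_
    congr 2
    ext x
    simp only [mem_filter, mem_univ, true_and] at hi
    simp only [mem_filter, D.mem_piece]
    constructor
    · rintro ⟨⟨h1, h2, -⟩, h3⟩; exact ⟨h1, h3, h2⟩
    · rintro ⟨h1, rfl, h2⟩; exact ⟨⟨h1, h2, hi⟩, rfl⟩
  let nb : 𝒞 → ℕ := fun c => u c / j + 1
  -- the new tours: the given ones and the bins of the components
  let J := I ⊕ Σ c : 𝒞, Fin (nb c)
  obtain ⟨q, hq1, hq2⟩ : ∃ q : V → J,
      (∀ x i, q x = Sum.inl i ↔ σ (τ x) (D.comp x) = Sum.inl i) ∧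
      (∀ x c b, q x = Sum.inr ⟨c, b⟩ ↔ D.comp x = c ∧ σ (τ x) c = Sum.inr b.1) := by
    have : ∀ x, ∃ y : J, (∀ i, y = Sum.inl i ↔ σ (τ x) (D.comp x) = Sum.inl i) ∧
        ∀ c b, y = Sum.inr ⟨c, b⟩ ↔ D.comp x = c ∧ σ (τ x) c = Sum.inr b.1 := by
      intro x
      rcases hσx : σ (τ x) (D.comp x) with i | b
      · refine ⟨Sum.inl i,
          fun i' => ⟨fun h1 => by rw [Sum.inl.inj h1], fun h1 => by rw [Sum.inl.inj h1]⟩,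
          fun c b => ⟨by simp, ?_⟩⟩
        rintro ⟨rfl, h2⟩
        rw [hσx] at h2
        simp at h2
      · refine ⟨Sum.inr ⟨D.comp x, b, Nat.lt_succ_of_le (hσ3 _ _ _ hσx)⟩, fun i' => by simp,
          fun c b' => ⟨fun h1 => ?_, ?_⟩⟩
        · obtain ⟨rfl, h2⟩ := Sigma.mk.inj (Sum.inr.inj h1)
          rw [← eq_of_heq h2]
          exact ⟨rfl, hσx⟩
        · rintro ⟨rfl, h2⟩
          rw [hσx] at h2
          have h3 := Sum.inr.inj h2
          subst h3
          rfl
    choose q hq using this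
    exact ⟨q, fun x => (hq x).1, fun x => (hq x).2⟩
  -- the bin 0 of `c` is filled up with dummy terminals
  let p₀ : 𝒞 → J := fun c => Sum.inr ⟨c, 0, Nat.succ_pos _⟩
  let U : J → Finset V := fun y => L.filter fun x => q x = y
  have hU1 : ∀ i, U (Sum.inl i) = L.filter fun x => σ (τ x) (D.comp x) = Sum.inl i :=
    fun i => filter_congr fun x _ => hq1 x i
  have hU2 : ∀ c b, U (Sum.inr ⟨c, b⟩) = L.filter fun x => D.comp x = c ∧ σ (τ x) c = Sum.inr b.1 :=
    fun c b => filter_congr fun x _ => hq2 x c b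
  have hU1c : ∀ i c, ((U (Sum.inl i)).filter (D.comp · = c))
      = L.filter fun x => D.comp x = c ∧ σ (τ x) c = Sum.inl i := by
    intro i c
    rw [hU1, filter_filter]
    refine filter_congr fun x _ => ⟨?_, ?_⟩
    · rintro ⟨h1, rfl⟩; exact ⟨rfl, h1⟩
    · rintro ⟨rfl, h1⟩; exact ⟨h1, rfl⟩
  let F : 𝒞 → Finset V := fun c => U (p₀ c)
  let pad : 𝒞 → ℕ := fun c =>
    if (F c).Nonempty ∧ ((F c).card : ℝ) < α ε * k then ⌈α ε * k⌉₊ - (F c).card else 0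
  have hpiece : ∀ y c, ((U y).filter (D.comp · = c)).Nonempty → y ≠ p₀ c →
      α ε * k ≤ (((U y).filter (D.comp · = c)).card : ℝ) := by
    intro y c hne hy
    have hpos : (0 : ℝ) < ((U y).filter (D.comp · = c)).card := by
      exact_mod_cast card_pos.2 hne
    rcases y with i | ⟨c', b⟩
    · rw [hU1c, hcount] at hpos ⊢
      exact (hσ5 i c).resolve_left hpos.ne'
    · obtain ⟨x, hx⟩ := hne
      rw [hU2, mem_filter, mem_filter] at hx
      obtain ⟨⟨-, hx1, -⟩, hx2⟩ := hx
      obtain rfl : c' = c := hx1.symm.trans hx2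
      have hself : (U (Sum.inr ⟨c', b⟩)).filter (D.comp · = c') = U (Sum.inr ⟨c', b⟩) :=
        filter_true_of_mem fun x hx => by
          rw [hU2] at hx
          exact (mem_filter.1 hx).2.1
      rw [hself, hU2, hcount] at hpos ⊢
      refine (hσ7 c' b fun hb => hy ?_).resolve_left hpos.ne'
      simp only [p₀]
      congr
      exact Fin.ext hb
  have hFself : ∀ c, (F c).filter (D.comp · = c) = F c := fun c =>
    filter_true_of_mem fun x hx => by
      simp only [F, p₀, hU2] at hx
      exact (mem_filter.1 hx).2.1
  have hpad : ∀ c, (F c).card + pad c ≤ k := by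
    intro c
    simp only [pad]
    split_ifs with hc
    · have h1 : (F c).card ≤ ⌈α ε * k⌉₊ := by
        exact_mod_cast hc.2.le.trans (Nat.le_ceil _)
      rw [Nat.add_sub_cancel' h1]
      refine Nat.ceil_le.2 ?_
      nlinarith
    · have h1 := hσ6 c 0
      rw [← hcount] at h1
      rw [add_zero]
      simp only [F, p₀, hU2]
      exact_mod_cast h1
  have hUk : ∀ y, (U y).card + ∑ c ∈ univ.filter (fun c => p₀ c = y), pad c ≤ k := by
    rintro (i | ⟨c, b⟩)
    · have h1 : univ.filter (fun c => p₀ c = Sum.inl i) = ∅ :=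
        filter_false_of_mem fun c _ => by simp [p₀]
      rw [h1, sum_empty, add_zero]
      have h2 : ((U (Sum.inl i)).card : ℝ) ≤ (X i).card := by
        calc ((U (Sum.inl i)).card : ℝ)
            = ∑ c, ∑ i' ∈ univ.filter (fun i' => σ i' c = Sum.inl i), s i' c := by
              rw [card_eq_sum_card_fiberwise (f := D.comp) (t := univ) (fun x _ => by simp),
                Nat.cast_sum]
              exact sum_congr rfl fun c _ => by rw [hU1c, hcount]
          _ ≤ ∑ c, s i c := hσ4 i
          _ = (X i).card := by
              rw [card_eq_sum_card_fiberwise (f := D.comp) (t := univ) (fun x _ => by simp),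
                Nat.cast_sum]
              refine sum_congr rfl fun c _ => ?_
              simp only [s]
              congr 2
              ext x
              simp only [X, D.mem_piece, mem_filter, and_assoc]
      exact (Nat.cast_le.1 h2).trans (hXk i)
    · by_cases hb : b.1 = 0
      · have h1 : (Sum.inr ⟨c, b⟩ : J) = p₀ c := by
          simp only [p₀]
          congr
          exact Fin.ext hb
        have h2 : univ.filter (fun d => p₀ d = p₀ c) = {c} := by
          ext d
          simp only [mem_filter, mem_univ, true_and, mem_singleton]
          exact ⟨fun h3 => (Sigma.mk.inj (Sum.inr.inj h3)).1, fun h3 => by rw [h3]⟩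
        rw [h1, h2, sum_singleton]
        exact hpad c
      · have h1 : univ.filter (fun d => p₀ d = Sum.inr ⟨c, b⟩) = ∅ := by
          refine filter_false_of_mem fun d _ h3 => hb ?_
          obtain ⟨rfl, h4⟩ := Sigma.mk.inj (Sum.inr.inj h3)
          rw [← eq_of_heq h4]
        rw [h1, sum_empty, add_zero, hU2]
        have h2 := hσ6 c b
        rw [← hcount] at h2
        exact_mod_cast h2
  obtain ⟨m, E, n', S', g1, g2, g3, g4, g5⟩ := Network.exists_hat_solution h hw hε hD0 hk hD
    hd.numTerminals_le K hK q pad p₀ U (fun y x => by simp [U, hLmem])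
    (fun c hc => by
      have h1 : (F c).Nonempty := by
        by_contra h2
        simp [pad, h2] at hc
      obtain ⟨x, hx⟩ := h1
      refine ⟨x, hx, ?_⟩
      rw [← hFself, mem_filter] at hx
      exact hx.2)
    (fun y => by convert hUk y)
    (fun y c hne => by
      by_cases hy : y = p₀ c
      · subst hy
        rw [if_pos rfl]
        change α ε * k ≤ (((F c).filter (D.comp · = c)).card : ℝ) + _
        change ((F c).filter (D.comp · = c)).Nonempty at hne
        rw [hFself] at hne ⊢
        simp only [pad]
        split_ifs with h1
        · refine (Nat.le_ceil _).trans ?_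
          exact_mod_cast le_add_tsub
        · push_cast
          rw [add_zero]
          exact not_lt.1 fun h2 => h1 ⟨hne, h2⟩
      · rw [if_neg fun h1 => hy h1.symm, add_zero]
        exact hpiece y c hne hy)
    hpiece
  refine ⟨m, E, n', S', g1, g2, g3, g4, g5.trans ?_⟩
  have hQ0 : 0 ≤ ∑ i, w i := sum_nonneg fun i _ => sum_nonneg fun a _ => hwt a
  have hcost := D.sum_redistributed_le (L := L) (σ := σ) (τ := τ) Represents.parWt_root hwt hL
    (small := fun i c => 0 < s i c ∧ s i c < α ε * k)
    (fun i c hsm => card_pos.1 (Nat.cast_pos.1 hsm.1)) hσ1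
    (fun i c i' hsm hi => by
      obtain ⟨h1, h2⟩ := hσ2 i c i' hsm hi
      exact ⟨h1, fun h3 => by simpa [h3] using h2.symm⟩) nb
  have hsum : ∑ y, ∑ a ∈ R.span (U y), N.parWt R a
      = ∑ i', ∑ a ∈ R.span (L.filter fun x => σ (τ x) (D.comp x) = Sum.inl i'), N.parWt R a
        + ∑ c, ∑ b ∈ range (nb c), ∑ a ∈ R.span (L.filter fun x => D.comp x = c ∧
            σ (τ x) c = Sum.inr b), N.parWt R a := by
    rw [Fintype.sum_sum_type, Fintype.sum_sigma]
    congr 1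
    · exact sum_congr rfl fun i _ => by rw [hU1]
    · refine sum_congr rfl fun c _ => ?_
      rw [← Fin.sum_univ_eq_sum_range (fun b => ∑ a ∈ R.span (L.filter fun x => D.comp x = c ∧
            σ (τ x) c = Sum.inr b), N.parWt R a)]
      exact sum_congr rfl fun b _ => by rw [hU2]
  have hexit : ∑ c, (nb c : ℝ) * R.dist (N.parWt R) (D.exit c)
      ≤ (ε / 2 + 4 * ε ^ 2) * ∑ i, w i :=
    hd.sum_bins_mul_dist_exit_le h hw hε hbd hk hD hdQ hIQ u hu hj hjα
  rw [← mul_sum, ← mul_sum, hsum]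
  calc (1 + ε) * (2 * _) ≤ (1 + ε) * (2 * (∑ i, w i + (ε / 2 + 4 * ε ^ 2) * ∑ i, w i)) := by
        refine mul_le_mul_of_nonneg_left (mul_le_mul_of_nonneg_left ?_ zero_le_two) (by positivity)
        convert hcost.trans (add_le_add_right hexit _)
    _ = (1 + ε) * (1 + ε / 2 + 4 * ε ^ 2) * (2 * ∑ i, w i) := by ring
    _ ≤ (1 + 2 * ε) * (2 * ∑ i, w i) := by
        refine mul_le_mul_of_nonneg_right ?_ (by positivity)
        have h1 : ε * ε ≤ 1 / 32 * ε := mul_le_mul_of_nonneg_right hε' hε.le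
        have h2 : ε * (ε * ε) ≤ ε * (1 / 32 * ε) := mul_le_mul_of_nonneg_left h1 hε.le
        nlinarith

/-- A feasible solution can be turned into a solution in the height-reduced tree with the
required properties at the expense of a factor `1 + 2ε`. -/
theorem IsDecomposition.exists_hat_solution_of_isFeasible (h : N.Represents R)
    (hw : ∀ e ∈ N.graph.edgeSet, 0 ≤ N.weight e) (hε : 0 < ε) (hε' : ε ≤ 1 / 32)
    (hbd : N.HasBoundedDistances ε) {k : ℕ} (hk : 1 ≤ k)
    (hd : N.IsDecomposition ε k 𝒞) (hD : N.IsPartitionOf 𝒞 D)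
    (K : D.Critical (N.parWt R) (N.classWidth ε))
    (hK : ∀ (c : 𝒞) u, N.IsCriticalFor ε 𝒞 c u ↔ u = K.crit c)
    {n : ℕ} (S : Fin n → N.Tour (Subtype.val : N.terminals → V)) (hS : IsFeasible k S) :
    ∃ (m : ℕ) (E : Fin m → V ⊕ 𝒞) (n : ℕ) (S' : Fin n → (N.hat ε 𝒞).Tour (N.hatLoc E)),
      (∀ j, ¬ (N.hat ε 𝒞).IsLeaf (E j)) ∧
      IsFeasible k S' ∧
      (∀ c : 𝒞, ({i | ∃ x ∈ (S' i).visited, N.hatLoc E x ∈ N.hatVerts c}.ncard : ℝ) ≤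
        2 * Γ ε / α ε + 1) ∧
      (∀ (c : 𝒞) (i : Fin n), (∃ x ∈ (S' i).visited, N.hatLoc E x ∈ N.hatVerts c) →
        α ε * k ≤ ({x | x ∈ (S' i).visited ∧ N.hatLoc E x ∈ N.hatVerts c}.ncard : ℝ)) ∧
      totalCost S' ≤ (1 + 2 * ε) * totalCost S := by
  -- tours without terminals are dropped, as they need not have any length
  let I := {i : Fin n // (S i).visited.Nonempty}
  have hvis : ∀ x (hx : x ∈ N.terminals), ∃ i : I, (⟨x, hx⟩ : N.terminals) ∈ (S i.1).visited := by
    intro x hx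
    obtain ⟨i, hi, -⟩ := hS.2 ⟨x, hx⟩
    exact ⟨⟨i, _, hi⟩, hi⟩
  obtain ⟨τ, hτ⟩ : ∃ τ : V → I, ∀ x (hx : x ∈ N.terminals), ⟨x, hx⟩ ∈ (S (τ x).1).visited := by
    obtain ⟨x₀, hx₀, -⟩ := h.exists_terminal R.root
    obtain ⟨i₀, -⟩ := hvis x₀ hx₀
    refine ⟨fun x => if hx : x ∈ N.terminals then (hvis x hx).choose else i₀, fun x hx => ?_⟩
    simp only [hx, dite_true]
    exact (hvis x hx).choose_spec
  have hτ' : ∀ i x (hx : x ∈ N.terminals), ⟨x, hx⟩ ∈ (S i).visited → (τ x).1 = i :=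
    fun i x hx hi => (hS.2 ⟨x, hx⟩).unique (hτ x hx) hi
  let X : I → Finset V := fun i => univ.filter fun x => x ∈ N.terminals ∧ τ x = i
  have hmem : ∀ i x, x ∈ X i ↔ x ∈ N.terminals ∧ τ x = i := fun i x => by simp [X]
  obtain ⟨m, E, n', S', g1, g2, g3, g4, g5⟩ :=
    hd.exists_hat_solution h hw hε hε' hbd hk hD K hK τ X hmem
    (fun i => by
      have h1 : X i ⊆ (S i.1).visited.image Subtype.val := by
        intro x hx
        obtain ⟨h2, rfl⟩ := (hmem i x).1 hx
        exact mem_image.2 ⟨_, hτ x h2, rfl⟩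
      exact (card_le_card h1).trans (card_image_le.trans (hS.1 i.1)))
    (fun i => by
      obtain ⟨x, hx⟩ := i.2
      exact ⟨x.1, (hmem i _).2 ⟨x.2, Subtype.ext (hτ' i x.1 x.2 hx)⟩⟩)
  refine ⟨m, E, n', S', g1, g2, g3, g4, g5.trans ?_⟩
  refine mul_le_mul_of_nonneg_left ?_ (by positivity)
  calc ∑ i : I, 2 * ∑ a ∈ R.span (X i), N.parWt R a
      ≤ ∑ i : I, N.cost (S i.1).walk := by
        refine sum_le_sum fun i _ => h.two_mul_span_le_cost hw _ _ fun x hx => ?_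
        obtain ⟨h2, rfl⟩ := (hmem i x).1 hx
        exact (S (τ x).1).visited_on_walk _ (hτ x h2)
    _ = ∑ i ∈ univ.map (Function.Embedding.subtype fun i => (S i).visited.Nonempty),
          N.cost (S i).walk := by rw [sum_map]; rfl
    _ ≤ totalCost S :=
        sum_le_sum_of_subset_of_nonneg (subset_univ _) fun i _ _ => Represents.cost_nonneg hw _

end Network

/-! ### The height of the height-reduced tree and the optimal cost -/

theorem H_mul_eq {ε : ℝ} (hε : 0 < ε) : H ε * (α ε * ε) = (1 / ε) ^ (1 / ε - 1) := by
  have h1 : α ε * ε = ε ^ (1 / ε + 1 + 1) := by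
    rw [Real.rpow_add_one hε.ne' (1 / ε + 1), α]
  rw [h1, H, one_div ε, Real.inv_rpow hε.le, Real.inv_rpow hε.le, ← Real.rpow_neg hε.le,
    ← Real.rpow_neg hε.le, ← Real.rpow_add hε]
  congr 1
  ring

namespace Network

variable {V : Type*} [Fintype V] {N : Network V} {R : RTree V} {ε : ℝ}
  {𝒞 : Set (Set (Sym2 V))} {D : R.Partition 𝒞}

theorem HasBoundedDistances.classWidth_pos (h : N.Represents R)
    (hw : ∀ e ∈ N.graph.edgeSet, 0 ≤ N.weight e) (hε : 0 < ε) (hbd : N.HasBoundedDistances ε) :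
    0 < N.classWidth ε :=
  mul_pos (mul_pos (α_pos hε) hε) (h.Dmin_pos hw hε hbd)

theorem IsPartitionOf.hat_isWeightedTree (h : N.Represents R)
    (hw : ∀ e ∈ N.graph.edgeSet, 0 ≤ N.weight e) (hD : N.IsPartitionOf 𝒞 D)
    (K : D.Critical (N.parWt R) (N.classWidth ε))
    (hK : ∀ (c : 𝒞) u, N.IsCriticalFor ε 𝒞 c u ↔ u = K.crit c) :
    (N.hat ε 𝒞).IsWeightedTree := by
  have hrep := hD.hat_represents h K hK
  refine ⟨hrep.isTree, fun e he => ?_⟩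
  obtain ⟨x, hx, rfl⟩ := hrep.mem_edgeSet_iff.1 he
  rw [← Represents.parWt_of_ne hx, hD.hat_parWt h hw K]
  exact K.hatWt_nonneg (h.parWt_nonneg hw) x

/-- On a path from the root the class of the components increases, and the classes are bounded in
terms of the maximum distance. -/
theorem IsPartitionOf.ncard_comp_path_le (h : N.Represents R)
    (hw : ∀ e ∈ N.graph.edgeSet, 0 ≤ N.weight e) (hε : 0 < ε) (hbd : N.HasBoundedDistances ε)
    (hD : N.IsPartitionOf 𝒞 D) (K : D.Critical (N.parWt R) (N.classWidth ε))
    (hK : ∀ (c : 𝒞) u, N.IsCriticalFor ε 𝒞 c u ↔ u = K.crit c) (x : V ⊕ 𝒞)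
    (p : (N.hat ε 𝒞).graph.Walk (N.hat ε 𝒞).root x) (hp : p.IsPath) :
    {c : 𝒞 | ∃ y ∈ p.support, y ∈ N.hatVerts c}.ncard ≤ ⌈H ε⌉₊ := by
  have hrep := hD.hat_represents h K hK
  have hsup : ∀ y, y ∈ p.support ↔ K.hatTree.Anc y x := by
    have h1 : ∀ r (p : (N.hat ε 𝒞).graph.Walk r x), r = K.hatTree.root → p.IsPath →
        ∀ y, y ∈ p.support ↔ K.hatTree.Anc y x := by
      rintro r p rfl hp
      exact hrep.path_support p hp
    exact h1 _ p hrep.root_eq hp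
  by_cases hx : x = K.hatTree.root
  · have h1 : {c : 𝒞 | ∃ y ∈ p.support, y ∈ N.hatVerts c} = ∅ := by
      refine Set.eq_empty_of_forall_notMem fun c hc => ?_
      obtain ⟨y, hy, hyc⟩ := hc
      rw [hsup, hx] at hy
      exact ((hD.mem_hatVerts_iff K).1 hyc).1 (RTree.anc_root hy)
    rw [h1, Set.ncard_empty]
    exact Nat.zero_le _
  · have h1 : {c : 𝒞 | ∃ y ∈ p.support, y ∈ N.hatVerts c}
        = (((K.hatTree.anc x).filter (· ≠ K.hatTree.root)).image
          (RTree.Partition.Critical.hatComp D) : Finset 𝒞) := by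
      ext c
      simp only [Set.mem_ofPred_eq, coe_image, Set.mem_image, mem_coe, mem_filter, RTree.mem_anc,
        hsup, hD.mem_hatVerts_iff K, and_assoc]
    rw [h1, Set.ncard_coe_finset]
    set c := RTree.Partition.Critical.hatComp D x
    suffices h5 : K.cls c ≤ ⌈H ε⌉₊ by
      refine le_trans (le_of_eq ?_) ((K.card_comp_anc_le hx).trans h5)
      congr!
    have hW := hbd.classWidth_pos h hw hε
    have h2 : ((K.cls c : ℝ) - 1) * N.classWidth ε < H ε * N.classWidth ε := by
      calc _ ≤ N.Dmax := (K.cls_le c).trans (h.dist_le_Dmax hw _)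
        _ < (1 / ε) ^ (1 / ε - 1) * N.Dmin := hbd
        _ = _ := by rw [← H_mul_eq hε, classWidth]; ring
    have h3 := lt_of_mul_lt_mul_right h2 hW.le
    have h4 : (K.cls c : ℝ) < ⌈H ε⌉₊ + 1 := by
      have := Nat.le_ceil (H ε)
      linarith
    exact Nat.lt_succ_iff.1 (by exact_mod_cast h4)

theorem Represents.two_mul_Dmin_le (h : N.Represents R)
    (hw : ∀ e ∈ N.graph.edgeSet, 0 ≤ N.weight e) {k n : ℕ}
    (S : Fin n → N.Tour (Subtype.val : N.terminals → V)) (hS : IsFeasible k S) :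
    2 * N.Dmin ≤ totalCost S := by
  obtain ⟨x, hx, -⟩ := h.exists_terminal R.root
  obtain ⟨i, hi, -⟩ := hS.2 ⟨x, hx⟩
  have h1 := h.two_mul_span_le_cost hw (S i).walk {x} fun u hu => by
    rw [mem_singleton.1 hu]
    exact (S i).visited_on_walk _ hi
  have h2 := (h.Dmin_le hw hx).trans
    (RTree.dist_le_span (R := R) (h.parWt_nonneg hw) (mem_singleton_self x))
  have h3 : N.cost (S i).walk ≤ totalCost S :=
    single_le_sum (f := fun i => N.cost (S i).walk) (fun i _ => Represents.cost_nonneg hw _)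
      (mem_univ i)
  linarith

theorem Represents.exists_isFeasible (h : N.Represents R) {k : ℕ} (hk : 1 ≤ k) :
    ∃ (n : ℕ) (S : Fin n → N.Tour (Subtype.val : N.terminals → V)), IsFeasible k S := by
  let e := (Fintype.equivFin N.terminals).symm
  choose walk hwalk using fun x : N.terminals =>
    h.exists_closed_walk (R.anc x.1) fun a ha b hb => by
      rw [RTree.mem_anc] at ha ⊢
      exact hb.trans ha
  refine ⟨_, fun i => ⟨walk (e i), {e i}, fun x hx => ?_⟩, fun i => ?_, fun x => ?_⟩
  · rw [mem_singleton.1 hx]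
    exact (hwalk _).1 _ (RTree.mem_anc.2 (RTree.Anc.refl _))
  · simpa using hk
  · exact ⟨e.symm x, by simp, fun i hi => by rw [mem_singleton.1 hi, e.symm_apply_apply]⟩

/-- There is a feasible solution of cost arbitrarily close to the optimal cost. -/
theorem Represents.exists_totalCost_lt (h : N.Represents R)
    (hw : ∀ e ∈ N.graph.edgeSet, 0 ≤ N.weight e) (hD0 : 0 < N.Dmin) {k : ℕ} (hk : 1 ≤ k) {x y : ℝ}
    (hy : 0 < y) (hxy : y < x) :
    ∃ (n : ℕ) (S : Fin n → N.Tour (Subtype.val : N.terminals → V)),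
      IsFeasible k S ∧ y * totalCost S < x * N.opt k := by
  have hne : {x | ∃ (n : ℕ) (S : Fin n → N.Tour (Subtype.val : N.terminals → V)),
      IsFeasible k S ∧ totalCost S = x}.Nonempty := by
    obtain ⟨n, S, hS⟩ := h.exists_isFeasible hk
    exact ⟨_, n, S, hS, rfl⟩
  have h1 : 0 < N.opt k := by
    refine lt_of_lt_of_le (by linarith : 0 < 2 * N.Dmin) (le_csInf hne ?_)
    rintro _ ⟨n, S, hS, rfl⟩
    exact h.two_mul_Dmin_le hw S hS
  have h2 : N.opt k < x / y * N.opt k := lt_mul_of_one_lt_left h1 ((one_lt_div hy).2 hxy)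
  obtain ⟨_, ⟨n, S, hS, rfl⟩, h3⟩ := exists_lt_of_csInf_lt hne h2
  refine ⟨n, S, hS, ?_⟩
  rw [div_mul_eq_mul_div, lt_div_iff₀ hy] at h3
  linarith

end Network

/-! ### Construction of components -/

namespace RTree

variable {V : Type*} [Fintype V] (R : RTree V)

/-- The vertices of the subtree rooted at `v`. -/
def below (v : V) : Finset V := univ.filter fun u => R.Anc v u

/-- The vertices of the subtree rooted at `v` other than `v`. -/
def strictBelow (v : V) : Finset V := univ.filter fun u => R.Anc v u ∧ u ≠ v

variable {R}

@[simp] theorem mem_below {u v : V} : u ∈ R.below v ↔ R.Anc v u := by simp [below]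

@[simp] theorem mem_strictBelow {u v : V} : u ∈ R.strictBelow v ↔ R.Anc v u ∧ u ≠ v := by
  simp [strictBelow]

theorem anc_par_of_mem_strictBelow {u v : V} (h : u ∈ R.strictBelow v) :
    u ≠ R.root ∧ R.Anc v (R.par u) := by
  obtain ⟨h1, h2⟩ := mem_strictBelow.1 h
  exact anc_of_ne h1 h2.symm

theorem par_anc_of_mem_strictBelow {u v : V} (hu : u ≠ R.root) (h : R.Anc v (R.par u)) :
    u ∈ R.strictBelow v := by
  refine mem_strictBelow.2 ⟨h.trans (anc_par u), ?_⟩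
  rintro rfl
  exact not_anc_par hu h

theorem exists_child_anc {v w : V} (h : w ∈ R.strictBelow v) :
    ∃ u, u ≠ R.root ∧ R.par u = v ∧ R.Anc u w := by
  induction w using RTree.induction_on (R := R) with | _ w ih
  obtain ⟨h1, h2⟩ := anc_par_of_mem_strictBelow h
  by_cases h3 : R.par w = v
  · exact ⟨w, h1, h3, Anc.refl _⟩
  · obtain ⟨u, hu1, hu2, hu3⟩ := ih _ (R.rank_par w h1) (mem_strictBelow.2 ⟨h2, h3⟩)
    exact ⟨u, hu1, hu2, hu3.trans (anc_par w)⟩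

variable (R)

/-- The non-root vertices in `K` stand for the edges of a component: the component has a root vertex
`ρ`, and it contains everything below `ρ`, or all edges that leave it downwards do so at one exit
vertex `e`. Furthermore, the component contains at most `2Θ` elements of `L`, and in the former case
at least `Θ` of them unless `β` fails. -/
structure IsComponent (L : Finset V) (Θ : ℝ) (β : Prop) (K : Finset V) : Prop where
  nonempty : K.Nonempty
  exists_top : ∃ ρ, ρ ∉ K ∧ (∀ u ∈ K, u ≠ R.root ∧ (R.par u = ρ ∨ R.par u ∈ K)) ∧
    ((∀ u ∈ R.strictBelow ρ, u ∈ K) ∧ (β → Θ ≤ (K ∩ L).card) ∨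
      ∃ e ∈ K, (∃ u, u ≠ R.root ∧ R.par u = e ∧ u ∉ K) ∧
        ∀ u, u ≠ R.root → R.par u ∈ K → u ∉ K → R.par u = e)
  card_le : ((K ∩ L).card : ℝ) ≤ 2 * Θ

/-- A partition of `S` into components which are charged to components with at least `Θ` elements
of `L`. The multiset `M` consists of the pairs of a component and the component that it is charged
to. The components in `Λ` are those that can be charged once more for each occurrence in `Λ`. -/
structure IsCharging (L : Finset V) (Θ : ℝ) (S : Finset V) (M : Multiset (Finset V × Finset V))
    (Λ : Multiset (Finset V)) : Prop where
  isComponent : ∀ x ∈ M, R.IsComponent L Θ True x.1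
  desc : ∀ x ∈ M, x.2 = x.1 ∨ ∃ v ∈ x.1, ∀ u ∈ x.2, R.Anc v (R.par u)
  big : ∀ b ∈ M.map Prod.snd + Λ, b ∈ M.map Prod.fst ∧ Θ ≤ (b ∩ L).card
  countP_eq : ∀ u, (M.map Prod.fst).countP (u ∈ ·) = if u ∈ S then 1 else 0
  count_le : ∀ b, (M.map Prod.snd + Λ).count b ≤ 3

variable {R} {L : Finset V} {Θ : ℝ}

theorem isComponent_strictBelow {ρ : V} (hne : (R.strictBelow ρ).Nonempty) {β : Prop}
    (h1 : β → Θ ≤ (R.strictBelow ρ ∩ L).card) (h2 : ((R.strictBelow ρ ∩ L).card : ℝ) ≤ 2 * Θ) :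
    R.IsComponent L Θ β (R.strictBelow ρ) := by
  refine ⟨hne, ⟨ρ, by simp, fun u hu => ?_, Or.inl ⟨fun u hu => hu, h1⟩⟩, h2⟩
  obtain ⟨h3, h4⟩ := anc_par_of_mem_strictBelow hu
  refine ⟨h3, or_iff_not_imp_left.2 fun h5 => mem_strictBelow.2 ⟨h4, h5⟩⟩

/-- A union `B` of subtrees hanging below `ρ`, cut off at `e`, is a component. -/
theorem isComponent_sdiff {ρ e : V} {B : Finset V} (hρ : ρ ∉ B)
    (hup : ∀ u ∈ B, u ≠ R.root ∧ (R.par u = ρ ∨ R.par u ∈ B))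
    (hdown : ∀ u ∈ B, ∀ w, R.Anc u w → w ∈ B) (he : e ∈ B) (hne : (R.strictBelow e).Nonempty)
    (h2 : (((B \ R.strictBelow e) ∩ L).card : ℝ) ≤ 2 * Θ) {β : Prop} :
    R.IsComponent L Θ β (B \ R.strictBelow e) := by
  have heK : e ∈ B \ R.strictBelow e := mem_sdiff.2 ⟨he, by simp⟩
  refine ⟨⟨e, heK⟩, ⟨ρ, fun h => hρ (mem_sdiff.1 h).1, fun u hu => ?_,
    Or.inr ⟨e, heK, ?_, fun u hu hp hnu => ?_⟩⟩, h2⟩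
  · obtain ⟨h3, h4⟩ := mem_sdiff.1 hu
    refine ⟨(hup u h3).1, (hup u h3).2.imp_right fun h5 => mem_sdiff.2 ⟨h5, fun h6 => h4 ?_⟩⟩
    exact par_anc_of_mem_strictBelow (hup u h3).1 (mem_strictBelow.1 h6).1
  · obtain ⟨w, hw⟩ := hne
    obtain ⟨u, hu, hp, -⟩ := exists_child_anc hw
    exact ⟨u, hu, hp, fun h3 => (mem_sdiff.1 h3).2
      (par_anc_of_mem_strictBelow hu (hp ▸ Anc.refl _))⟩
  · obtain ⟨h3, h4⟩ := mem_sdiff.1 hp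
    have h5 : u ∈ R.strictBelow e := by
      by_contra h6
      exact hnu (mem_sdiff.2 ⟨hdown _ h3 _ (anc_par u), h6⟩)
    by_contra h6
    exact h4 (mem_strictBelow.2 ⟨(anc_par_of_mem_strictBelow h5).2, h6⟩)

namespace IsCharging

variable {S S' : Finset V} {M M' : Multiset (Finset V × Finset V)} {Λ Λ' : Multiset (Finset V)}

theorem subset (h : R.IsCharging L Θ S M Λ) {K : Finset V} (hK : K ∈ M.map Prod.fst) : K ⊆ S := by
  intro u hu
  by_contra hS
  have := h.countP_eq u
  rw [if_neg hS, Multiset.countP_eq_zero] at this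
  exact this K hK hu

theorem nonempty (h : R.IsCharging L Θ S M Λ) {K : Finset V} (hK : K ∈ M.map Prod.fst) :
    K.Nonempty := by
  obtain ⟨x, hx, rfl⟩ := Multiset.mem_map.1 hK
  exact (h.isComponent x hx).nonempty

theorem mono (h : R.IsCharging L Θ S M Λ) (hΛ : Λ' ≤ Λ) : R.IsCharging L Θ S M Λ' :=
  ⟨h.isComponent, h.desc, fun b hb => h.big b (Multiset.mem_of_le (by gcongr) hb), h.countP_eq,
    fun b => (Multiset.count_le_of_le b (by gcongr)).trans (h.count_le b)⟩

/-- A single component is charged to itself, and can be charged twice more. -/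
theorem single {K : Finset V} (hK : R.IsComponent L Θ True K) (hb : Θ ≤ (K ∩ L).card) :
    R.IsCharging L Θ K {(K, K)} {K, K} := by
  refine ⟨fun x hx => ?_, fun x hx => ?_, fun b hb' => ?_, fun u => ?_, fun b => ?_⟩
  · rw [Multiset.mem_singleton.1 hx]; exact hK
  · rw [Multiset.mem_singleton.1 hx]; exact Or.inl rfl
  · obtain rfl : b = K := by simpa using hb'
    simpa using hb
  · rw [Multiset.map_singleton, Multiset.countP_eq_card_filter, Multiset.filter_singleton]
    split_ifs <;> rfl
  · exact Multiset.count_le_card _ _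

theorem union (h : R.IsCharging L Θ S M Λ) (h' : R.IsCharging L Θ S' M' Λ') (hd : Disjoint S S') :
    R.IsCharging L Θ (S ∪ S') (M + M') (Λ + Λ') := by
  have e1 : (M + M').map Prod.snd + (Λ + Λ') = (M.map Prod.snd + Λ) + (M'.map Prod.snd + Λ') := by
    rw [Multiset.map_add]; abel
  refine ⟨fun x hx => ?_, fun x hx => ?_, fun b hb => ?_, fun u => ?_, fun b => ?_⟩
  · exact (Multiset.mem_add.1 hx).elim (h.isComponent x) (h'.isComponent x)
  · exact (Multiset.mem_add.1 hx).elim (h.desc x) (h'.desc x)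
  · rw [e1] at hb
    rw [Multiset.map_add, Multiset.mem_add]
    rcases Multiset.mem_add.1 hb with hb | hb
    · exact ⟨Or.inl (h.big b hb).1, (h.big b hb).2⟩
    · exact ⟨Or.inr (h'.big b hb).1, (h'.big b hb).2⟩
  · rw [Multiset.map_add, Multiset.countP_add, h.countP_eq, h'.countP_eq]
    have : u ∈ S → u ∉ S' := fun h1 => disjoint_left.1 hd h1
    by_cases h1 : u ∈ S <;> by_cases h2 : u ∈ S' <;> simp_all
  · rw [e1, Multiset.count_add]
    by_cases hb : b ∈ M.map Prod.snd + Λ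
    · by_cases hb' : b ∈ M'.map Prod.snd + Λ'
      · obtain ⟨u, hu⟩ := h.nonempty (h.big b hb).1
        exact absurd (h'.subset (h'.big b hb').1 hu)
          (disjoint_left.1 hd (h.subset (h.big b hb).1 hu))
      · rw [Multiset.count_eq_zero_of_notMem hb', add_zero]
        exact h.count_le b
    · rw [Multiset.count_eq_zero_of_notMem hb, zero_add]
      exact h'.count_le b

/-- A further component `K` is charged to a component `b` below it. -/
theorem insert {K b : Finset V} (h : R.IsCharging L Θ S M (b ::ₘ Λ))
    (hK : R.IsComponent L Θ True K) (hd : Disjoint K S)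
    (hb : ∃ v ∈ K, ∀ u ∈ b, R.Anc v (R.par u)) :
    R.IsCharging L Θ (K ∪ S) ((K, b) ::ₘ M) Λ := by
  have e1 : ((K, b) ::ₘ M).map Prod.snd + Λ = M.map Prod.snd + (b ::ₘ Λ) := by
    rw [Multiset.map_cons, Multiset.cons_add, Multiset.add_cons]
  refine ⟨fun x hx => ?_, fun x hx => ?_, fun b' hb' => ?_, fun u => ?_, fun b' => ?_⟩
  · rcases Multiset.mem_cons.1 hx with rfl | hx
    exacts [hK, h.isComponent x hx]
  · rcases Multiset.mem_cons.1 hx with rfl | hx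
    exacts [Or.inr hb, h.desc x hx]
  · rw [e1] at hb'
    rw [Multiset.map_cons, Multiset.mem_cons]
    exact ⟨Or.inr (h.big b' hb').1, (h.big b' hb').2⟩
  · rw [Multiset.map_cons, Multiset.countP_cons, h.countP_eq]
    have : u ∈ K → u ∉ S := fun h1 => disjoint_left.1 hd h1
    by_cases h1 : u ∈ K <;> by_cases h2 : u ∈ S <;> simp_all
  · rw [e1]
    exact h.count_le b'

end IsCharging

theorem below_eq_insert (v : V) : R.below v = insert v (R.strictBelow v) := by
  ext u
  simp only [mem_below, mem_insert, mem_strictBelow]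
  by_cases h : u = v
  · simp [h, Anc.refl]
  · simp [h]

theorem disjoint_below {q q' : V} (hq : q ≠ R.root) (hq' : q' ≠ R.root) (hne : q ≠ q')
    (hp : R.par q = R.par q') : Disjoint (R.below q) (R.below q') := by
  refine disjoint_left.2 fun u hu hu' => ?_
  rw [mem_below] at hu hu'
  rcases hu.total hu' with h | h
  · exact not_anc_par hq (hp ▸ (anc_of_ne h hne).2)
  · exact not_anc_par hq' (hp ▸ (anc_of_ne h hne.symm).2)

/-- In every subtree with at least `Θ` elements of `L`, the part below a suitable vertex `e` can be
partitioned into components, such that less than `Θ` elements of `L` remain above `e`. Two further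
components can be charged to these components. -/
theorem exists_isCharging (hbin : ∀ v ∉ L, ∃ q q', q ≠ q' ∧ ∀ u, (u ≠ R.root ∧ R.par u = v) ↔
    u = q ∨ u = q') (hL : ∀ v ∈ L, R.strictBelow v = ∅) (hΘ : 1 < Θ) (v : V)
    (hv : Θ ≤ (R.below v ∩ L).card) :
    ∃ e M b b', R.Anc v e ∧ (((R.below v \ R.strictBelow e) ∩ L).card : ℝ) < Θ ∧
      R.IsCharging L Θ (R.strictBelow e) M {b, b'} := by
  induction hn : (R.below v).card using Nat.strong_induction_on generalizing v with | _ n ih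
  have hvL : v ∉ L := by
    intro h
    rw [below_eq_insert, hL v h, insert_empty_eq] at hv
    have h1 : (({v} ∩ L).card : ℝ) ≤ 1 := by
      exact_mod_cast card_le_one.2 fun a ha b hb => by
        rw [mem_singleton.1 (mem_inter.1 ha).1, mem_singleton.1 (mem_inter.1 hb).1]
    linarith
  have hbL : ∀ A : Finset V, insert v A ∩ L = A ∩ L := fun A => insert_inter_of_notMem hvL
  obtain ⟨q, q', hqq, hch⟩ := hbin v hvL
  obtain ⟨hq, hqp⟩ := (hch q).2 (Or.inl rfl)
  obtain ⟨hq', hqp'⟩ := (hch q').2 (Or.inr rfl)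
  have hdisj : Disjoint (R.below q) (R.below q') := disjoint_below hq hq' hqq (hqp.trans hqp'.symm)
  have hunion : R.strictBelow v = R.below q ∪ R.below q' := by
    ext u
    rw [mem_union, mem_below, mem_below]
    constructor
    · intro hu
      obtain ⟨w, hw, hwp, hwu⟩ := exists_child_anc hu
      rcases (hch w).1 ⟨hw, hwp⟩ with rfl | rfl
      exacts [Or.inl hwu, Or.inr hwu]
    · have key : ∀ w, w ≠ R.root → R.par w = v → R.Anc w u → u ∈ R.strictBelow v := by
        rintro w hw rfl hwu
        refine mem_strictBelow.2 ⟨(anc_par w).trans hwu, ?_⟩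
        rintro rfl
        exact not_anc_par hw hwu
      rintro (hu | hu)
      exacts [key q hq hqp hu, key q' hq' hqp' hu]
  have hlt : ∀ w, w ≠ R.root → R.par w = v → (R.below w).card < n := by
    rintro w hw rfl
    rw [← hn]
    refine card_lt_card ⟨fun u hu => ?_, fun h => ?_⟩
    · rw [mem_below] at hu ⊢
      exact (anc_par w).trans hu
    · exact not_anc_par hw (mem_below.1 (h (mem_below.2 (Anc.refl (R.par w)))))
  have hself : ∀ {M b b'}, R.IsCharging L Θ (R.strictBelow v) M {b, b'} →
      ∃ e M b b', R.Anc v e ∧ (((R.below v \ R.strictBelow e) ∩ L).card : ℝ) < Θ ∧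
        R.IsCharging L Θ (R.strictBelow e) M {b, b'} := by
    intro M b b' h
    refine ⟨v, M, b, b', Anc.refl v, ?_, h⟩
    have h1 : (R.below v \ R.strictBelow v) ∩ L = ∅ := by
      rw [below_eq_insert, insert_sdiff_of_notMem _ (by simp), sdiff_self, hbL]
      exact empty_inter _
    rw [h1, card_empty, Nat.cast_zero]
    linarith
  have hne : ∀ {e M b b'}, R.IsCharging L Θ (R.strictBelow e) M {b, b'} →
      (R.strictBelow e).Nonempty := fun {e M b b'} h => by
    have h1 := (h.big b (by simp)).1
    exact (h.nonempty h1).mono (h.subset h1)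
  -- Only the child `q` has at least `Θ` elements of `L` below it. Either the part above the cut below
  -- `q` stays light, or it becomes a component of its own, with at least `Θ` elements of `L`.
  have hone : ∀ q q', q ≠ R.root → R.par q = v → Disjoint (R.below q) (R.below q') →
      R.strictBelow v = R.below q ∪ R.below q' → Θ ≤ (R.below q ∩ L).card →
      ¬ Θ ≤ (R.below q' ∩ L).card →
      ∃ e M b b', R.Anc v e ∧ (((R.below v \ R.strictBelow e) ∩ L).card : ℝ) < Θ ∧
        R.IsCharging L Θ (R.strictBelow e) M {b, b'} := by
    intro q q' hq hqp hdisj hunion h1 h2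
    obtain ⟨e, M, b, b', hqe, hlight, hM⟩ := ih _ (hlt q hq hqp) q h1 rfl
    have hve : e ∈ R.strictBelow v := by
      rw [hunion]
      exact mem_union_left _ (mem_below.2 hqe)
    by_cases h3 : (((R.strictBelow v \ R.strictBelow e) ∩ L).card : ℝ) < Θ
    · refine ⟨e, M, b, b', (mem_strictBelow.1 hve).1, ?_, hM⟩
      have h4 : v ∉ R.strictBelow e := fun h => (mem_strictBelow.1 hve).2
        ((mem_strictBelow.1 h).1.antisymm (mem_strictBelow.1 hve).1)
      rwa [below_eq_insert, insert_sdiff_of_notMem _ h4, hbL]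
    · have h4 : (((R.strictBelow v \ R.strictBelow e) ∩ L).card : ℝ) ≤ 2 * Θ := by
        have h5 : (R.strictBelow v \ R.strictBelow e) ∩ L
            ⊆ ((R.below q \ R.strictBelow e) ∩ L) ∪ (R.below q' ∩ L) := by
          rw [hunion]
          intro u
          simp only [mem_inter, mem_sdiff, mem_union]
          tauto
        have h6 : ((_ : ℕ) : ℝ) ≤ (_ : ℕ) :=
          Nat.cast_le.2 ((card_le_card h5).trans (card_union_le _ _))
        push_cast at h6
        linarith
      have h5 := isComponent_sdiff (R := R) (L := L) (Θ := Θ) (β := True) (ρ := v) (by simp)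
        (fun u hu => by
          obtain ⟨h6, h7⟩ := anc_par_of_mem_strictBelow hu
          exact ⟨h6, or_iff_not_imp_left.2 fun h8 => mem_strictBelow.2 ⟨h7, h8⟩⟩)
        (fun u hu w hw => by
          rw [mem_strictBelow] at hu ⊢
          refine ⟨hu.1.trans hw, ?_⟩
          rintro rfl
          exact hu.2 (hw.antisymm hu.1)) hve (hne hM) h4
      have h6 := (hM.union (IsCharging.single h5 (not_lt.1 h3)) disjoint_sdiff).mono
        (Multiset.le_add_right _ _)
      rw [union_sdiff_of_subset] at h6
      · exact hself h6
      · intro u hu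
        rw [mem_strictBelow] at hu hve ⊢
        refine ⟨hve.1.trans hu.1, ?_⟩
        rintro rfl
        exact hve.2 (hu.1.antisymm hve.1)
  by_cases h1 : Θ ≤ (R.below q ∩ L).card
  · by_cases h2 : Θ ≤ (R.below q' ∩ L).card
    · -- Both subtrees are closed by a component that takes one of the two spare charges.
      have htwo : ∀ q, q ≠ R.root → R.par q = v → Θ ≤ (R.below q ∩ L).card →
          ∃ M b, R.IsCharging L Θ (R.below q) M {b} := by
        intro q hq hqp h1
        obtain ⟨e, M, b, b', hqe, hlight, hM⟩ := ih _ (hlt q hq hqp) q h1 rfl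
        have h3 := isComponent_sdiff (R := R) (L := L) (Θ := Θ) (β := True) (ρ := R.par q)
          (B := R.below q) (fun h => not_anc_par hq (mem_below.1 h))
          (fun u hu => by
            rw [mem_below] at hu
            refine ⟨hu.ne_root hq, ?_⟩
            by_cases h4 : q = u
            · exact Or.inl (by rw [h4])
            · exact Or.inr (mem_below.2 (anc_of_ne hu h4).2))
          (fun u hu w hw => by
            rw [mem_below] at hu ⊢
            exact hu.trans hw) (mem_below.2 hqe) (hne hM) (by linarith)
        have h4 := hM.insert h3 sdiff_disjoint ⟨e, mem_sdiff.2 ⟨mem_below.2 hqe, by simp⟩,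
          fun u hu => (anc_par_of_mem_strictBelow (hM.subset (hM.big b (by simp)).1 hu)).2⟩
        rw [sdiff_union_of_subset] at h4
        · exact ⟨_, b', h4⟩
        · intro u hu
          exact mem_below.2 (hqe.trans (mem_strictBelow.1 hu).1)
      obtain ⟨M, b, hM⟩ := htwo q hq hqp h1
      obtain ⟨M', b', hM'⟩ := htwo q' hq' hqp' h2
      have h3 := hM.union hM' hdisj
      rw [← hunion] at h3
      exact hself h3
    · exact hone q q' hq hqp hdisj hunion h1 h2
  · by_cases h2 : Θ ≤ (R.below q' ∩ L).card
    · exact hone q' q hq' hqp' hdisj.symm (by rw [hunion, union_comm]) h2 h1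
    · -- Both children are light, so everything below `v` is one component.
      have h3 : R.below v ∩ L = R.strictBelow v ∩ L := by rw [below_eq_insert, hbL]
      rw [h3] at hv
      refine hself (IsCharging.single (isComponent_strictBelow ⟨q, ?_⟩ (fun _ => hv) ?_) hv)
      · rw [hunion]
        exact mem_union_left _ (mem_below.2 (Anc.refl q))
      · rw [hunion, union_inter_distrib_right]
        have h4 : ((_ : ℕ) : ℝ) ≤ (_ : ℕ) :=
          Nat.cast_le.2 (card_union_le (R.below q ∩ L) (R.below q' ∩ L))
        push_cast at h4
        linarith

end RTree

/-! ### Existence of a component decomposition -/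

/-- The edges represented by the vertices of `K`. -/
def RTree.edgesOf {V : Type*} (R : RTree V) (K : Finset V) : Set (Sym2 V) :=
  {e | ∃ v ∈ K, e = s(v, R.par v)}

namespace Network

variable {V : Type*} {N : Network V} {R : RTree V} {K : Finset V} {ρ : V}

theorem Represents.mk_par_mem_edgesOf (hK : ∀ u ∈ K, u ≠ R.root) {u : V} (hu : u ≠ R.root) :
    s(u, R.par u) ∈ R.edgesOf K ↔ u ∈ K := by
  constructor
  · rintro ⟨v, hv, he⟩
    rwa [Represents.edge_inj hu (hK v hv) he]
  · exact fun h => ⟨u, h, rfl⟩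

theorem anc_of_mem_component (hup : ∀ u ∈ K, u ≠ R.root ∧ (R.par u = ρ ∨ R.par u ∈ K)) {u : V}
    (hu : u ∈ K) : R.Anc ρ (R.par u) := by
  induction u using RTree.induction_on (R := R) with | _ u ih
  obtain ⟨h1, h2 | h2⟩ := hup u hu
  · rw [h2]; exact RTree.Anc.refl _
  · exact (ih _ (R.rank_par u h1) h2).trans (RTree.anc_par _)

theorem exists_par_eq_top (hne : K.Nonempty)
    (hup : ∀ u ∈ K, u ≠ R.root ∧ (R.par u = ρ ∨ R.par u ∈ K)) : ∃ u ∈ K, R.par u = ρ := by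
  obtain ⟨u, hu, hmin⟩ := K.exists_min_image R.rank hne
  exact ⟨u, hu, (hup u hu).2.resolve_right fun h =>
    absurd (R.rank_par u (hup u hu).1) (not_lt.2 (hmin _ h))⟩

theorem mem_verts_edgesOf (hne : K.Nonempty)
    (hup : ∀ u ∈ K, u ≠ R.root ∧ (R.par u = ρ ∨ R.par u ∈ K)) {w : V} :
    w ∈ verts (R.edgesOf K) ↔ w = ρ ∨ w ∈ K := by
  constructor
  · rintro ⟨_, ⟨u, hu, rfl⟩, hw⟩
    rcases Sym2.mem_iff.1 hw with rfl | rfl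
    exacts [Or.inr hu, (hup u hu).2]
  · rintro (rfl | hw)
    · obtain ⟨u, hu, rfl⟩ := exists_par_eq_top hne hup
      exact ⟨_, ⟨u, hu, rfl⟩, Sym2.mem_mk_right _ _⟩
    · exact ⟨_, ⟨w, hw, rfl⟩, Sym2.mem_mk_left _ _⟩

theorem Represents.compRoot_edgesOf (h : N.Represents R) (hne : K.Nonempty)
    (hup : ∀ u ∈ K, u ≠ R.root ∧ (R.par u = ρ ∨ R.par u ∈ K)) :
    N.compRoot (R.edgesOf K) = ρ := by
  have h1 : N.IsCompRoot (R.edgesOf K) ρ := by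
    refine ⟨(mem_verts_edgesOf hne hup).2 (Or.inl rfl), fun u hu => h.isAncestor_iff.2 ?_⟩
    rcases (mem_verts_edgesOf hne hup).1 hu with rfl | hu
    exacts [RTree.Anc.refl _, (anc_of_mem_component hup hu).trans (RTree.anc_par _)]
  have h2 : N.IsCompRoot (R.edgesOf K) (N.compRoot (R.edgesOf K)) :=
    Classical.epsilon_spec_aux _ _ ⟨ρ, h1⟩
  exact (h.isAncestor_iff.1 (h2.2 _ h1.1)).antisymm (h.isAncestor_iff.1 (h1.2 _ h2.1))

theorem reachable_edgesOf (hup : ∀ u ∈ K, u ≠ R.root ∧ (R.par u = ρ ∨ R.par u ∈ K)) {u : V}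
    (hu : u ∈ K) : (SimpleGraph.fromEdgeSet (R.edgesOf K)).Reachable u ρ := by
  induction u using RTree.induction_on (R := R) with | _ u ih
  obtain ⟨h1, h2⟩ := hup u hu
  have h3 : (SimpleGraph.fromEdgeSet (R.edgesOf K)).Adj u (R.par u) :=
    (SimpleGraph.fromEdgeSet_adj _).2 ⟨⟨u, hu, rfl⟩, (RTree.par_ne h1).symm⟩
  rcases h2 with h2 | h2
  · exact h2 ▸ h3.reachable
  · exact h3.reachable.trans (ih _ (R.rank_par u h1) h2)

variable [Fintype V]

theorem Represents.numTerminals_edgesOf (h : N.Represents R) (hne : K.Nonempty)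
    (hup : ∀ u ∈ K, u ≠ R.root ∧ (R.par u = ρ ∨ R.par u ∈ K)) :
    N.numTerminals (R.edgesOf K) = (K ∩ univ.filter (· ∈ N.terminals)).card := by
  rw [numTerminals, ← Set.ncard_coe_finset]
  congr 1
  ext x
  simp only [Set.mem_inter_iff, mem_verts_edgesOf hne hup, coe_inter, coe_filter, mem_univ,
    true_and, mem_coe, Set.mem_ofPred_eq]
  constructor
  · rintro ⟨rfl | h1, h2⟩
    · obtain ⟨u, hu, hp⟩ := exists_par_eq_top hne hup
      exact absurd hp (h.isLeaf_iff.1 h2 u (hup u hu).1)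
    · exact ⟨h1, h2⟩
  · exact fun h1 => ⟨Or.inr h1.1, h1.2⟩

/-- A partition of the non-root vertices into components in the sense of `RTree.IsComponent`,
charged to each other, gives a component decomposition. -/
theorem Represents.isDecomposition_edgesOf (h : N.Represents R) {ε : ℝ} {k : ℕ} {β : Prop}
    (M : Multiset (Finset V × Finset V))
    (hβ : 1 < {c | ∃ x ∈ M, c = R.edgesOf x.1}.ncard → β)
    (hcomp : ∀ x ∈ M, R.IsComponent (univ.filter (· ∈ N.terminals)) (Γ ε * k) β x.1)
    (hdesc : ∀ x ∈ M, x.2 = x.1 ∨ ∃ v ∈ x.1, ∀ u ∈ x.2, R.Anc v (R.par u))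
    (hbig : β → ∀ x ∈ M, x.2 ∈ M.map Prod.fst ∧
      Γ ε * k ≤ (x.2 ∩ univ.filter (· ∈ N.terminals)).card)
    (hcount : ∀ u, (M.map Prod.fst).countP (u ∈ ·) = if u ∈ R.strictBelow R.root then 1 else 0)
    (hle : β → ∀ b, (M.map Prod.snd).count b ≤ 3) :
    N.IsDecomposition ε k {c | ∃ x ∈ M, c = R.edgesOf x.1} := by
  have hex : ∀ u, u ≠ R.root → ∃ x ∈ M, u ∈ x.1 := by
    intro u hu
    have h1 := hcount u
    rw [if_pos (RTree.mem_strictBelow.2 ⟨RTree.root_anc u, hu⟩)] at h1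
    have h2 : 0 < (M.map Prod.fst).countP (u ∈ ·) := by omega
    obtain ⟨K, hK, hu⟩ := Multiset.countP_pos.1 h2
    obtain ⟨x, hx, rfl⟩ := Multiset.mem_map.1 hK
    exact ⟨x, hx, hu⟩
  have huniq : ∀ x ∈ M, ∀ y ∈ M, ∀ u ∈ x.1, u ∈ y.1 → x = y := by
    intro x hx y hy u hux huy
    by_contra hne
    have h1 := hcount u
    have h2 : 0 < ((M.erase x).map Prod.fst).countP (u ∈ ·) := by
      refine Multiset.countP_pos.2 ⟨y.1, Multiset.mem_map.2 ⟨y, ?_, rfl⟩, huy⟩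
      exact (Multiset.mem_erase_of_ne fun h3 => hne h3.symm).2 hy
    rw [← Multiset.cons_erase hx, Multiset.map_cons, Multiset.countP_cons, if_pos hux] at h1
    split_ifs at h1
    omega
  choose ρ hρ hup hexit using fun x hx => (hcomp x hx).exists_top
  have hne : ∀ x ∈ M, x.1.Nonempty := fun x hx => (hcomp x hx).nonempty
  have hroot : ∀ x ∈ M, ∀ u ∈ x.1, u ≠ R.root := fun x hx u hu => (hup x hx u hu).1
  have hverts : ∀ x (hx : x ∈ M) w, w ∈ verts (R.edgesOf x.1) ↔ w = ρ x hx ∨ w ∈ x.1 :=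
    fun x hx w => mem_verts_edgesOf (hne x hx) (hup x hx)
  have htop : ∀ x (hx : x ∈ M), N.compRoot (R.edgesOf x.1) = ρ x hx := fun x hx =>
    h.compRoot_edgesOf (hne x hx) (hup x hx)
  have hnum : ∀ x ∈ M, N.numTerminals (R.edgesOf x.1)
      = (x.1 ∩ univ.filter (· ∈ N.terminals)).card := fun x hx =>
    h.numTerminals_edgesOf (hne x hx) (hup x hx)
  have hinj : ∀ x ∈ M, ∀ y ∈ M, R.edgesOf x.1 = R.edgesOf y.1 → x = y := by
    intro x hx y hy hxy
    obtain ⟨u, hu⟩ := hne x hx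
    refine huniq x hx y hy u hu ((Represents.mk_par_mem_edgesOf (hroot y hy) (hroot x hx u hu)).1 ?_)
    rw [← hxy]
    exact ⟨u, hu, rfl⟩
  -- a vertex shared with another component is the parent of a vertex outside
  have hshare : ∀ x (hx : x ∈ M), ∀ y ∈ M, R.edgesOf y.1 ≠ R.edgesOf x.1 →
      ∀ w ∈ verts (R.edgesOf x.1) ∩ verts (R.edgesOf y.1), w ≠ ρ x hx →
        w ∈ x.1 ∧ ∃ u, u ≠ R.root ∧ R.par u = w ∧ u ∉ x.1 := by
    intro x hx y hy hxy w hw hwρ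
    have hwx := ((hverts x hx w).1 hw.1).resolve_left hwρ
    have hdis : ∀ u ∈ y.1, u ∉ x.1 := fun u huy hux => hxy (by rw [huniq x hx y hy u hux huy])
    obtain rfl := ((hverts y hy w).1 hw.2).resolve_right fun h1 => hdis w h1 hwx
    obtain ⟨u, hu, hp⟩ := exists_par_eq_top (hne y hy) (hup y hy)
    exact ⟨hwx, u, hroot y hy u hu, hp, hdis u hu⟩
  have hleaf : ∀ x (hx : x ∈ M), N.IsLeafComp (R.edgesOf x.1) ↔
      ∀ u ∈ R.strictBelow (ρ x hx), u ∈ x.1 := by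
    intro x hx
    simp only [IsLeafComp, htop x hx, h.isAncestor_iff, hverts x hx, RTree.mem_strictBelow]
    exact ⟨fun h1 u hu => (h1 u hu.1).resolve_left hu.2,
      fun h1 u hu => or_iff_not_imp_left.2 fun h2 => h1 u ⟨hu, h2⟩⟩
  have hclosed : ∀ x (hx : x ∈ M), (∀ u ∈ R.strictBelow (ρ x hx), u ∈ x.1) →
      ∀ u, u ≠ R.root → R.par u ∈ x.1 → u ∈ x.1 := by
    intro x hx h1 u hu hp
    refine h1 u (RTree.par_anc_of_mem_strictBelow hu ?_)
    exact (anc_of_mem_component (hup x hx) hp).trans (RTree.anc_par _)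
  refine ⟨?_, ?_, ?_, ?_, ?_, ?_, ?_, ?_, ?_⟩
  · rintro _ ⟨x, hx, rfl⟩
    obtain ⟨u, hu⟩ := hne x hx
    exact ⟨_, u, hu, rfl⟩
  · rintro _ ⟨x, hx, rfl⟩ _ ⟨y, hy, rfl⟩ hxy
    refine Set.disjoint_left.2 ?_
    rintro _ ⟨u, hu, rfl⟩ he
    have h1 := (Represents.mk_par_mem_edgesOf (hroot y hy) (hroot x hx u hu)).1 he
    exact hxy (by rw [huniq x hx y hy u hu h1])
  · ext e
    rw [h.mem_edgeSet_iff]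
    constructor
    · rintro ⟨_, ⟨x, hx, rfl⟩, u, hu, rfl⟩
      exact ⟨u, hroot x hx u hu, rfl⟩
    · rintro ⟨u, hu, rfl⟩
      obtain ⟨x, hx, hux⟩ := hex u hu
      exact ⟨_, ⟨x, hx, rfl⟩, u, hux, rfl⟩
  · rintro _ ⟨x, hx, rfl⟩ u hu v hv
    have key : ∀ w ∈ verts (R.edgesOf x.1),
        (SimpleGraph.fromEdgeSet (R.edgesOf x.1)).Reachable w (ρ x hx) := by
      intro w hw
      rcases (hverts x hx w).1 hw with rfl | hw
      exacts [SimpleGraph.Reachable.refl _, reachable_edgesOf (hup x hx) hw]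
    exact (key u hu).trans (key v hv).symm
  · rintro _ ⟨x, hx, rfl⟩ hl _ ⟨y, hy, rfl⟩ hxy w hw
    rw [Set.mem_singleton_iff, htop x hx]
    by_contra hwρ
    obtain ⟨h1, u, hu, rfl, h2⟩ := hshare x hx y hy hxy w hw hwρ
    exact h2 (hclosed x hx ((hleaf x hx).1 hl) u hu h1)
  · rintro _ ⟨x, hx, rfl⟩ hl
    rw [hleaf x hx] at hl
    rcases hexit x hx with ⟨h1, -⟩ | ⟨e, he, ⟨u, hu, hue, hux⟩, h2⟩
    · exact absurd h1 hl
    · refine ⟨e, (hverts x hx e).2 (Or.inr he), ?_, ?_, ?_⟩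
      · rw [htop x hx]
        rintro rfl
        exact hρ x hx he
      · obtain ⟨y, hy, huy⟩ := hex u hu
        refine ⟨_, ⟨y, hy, rfl⟩, fun h3 => hux (hinj y hy x hx h3 ▸ huy), ?_⟩
        exact (hverts y hy e).2 (hue ▸ (hup y hy u huy).2)
      · rintro _ ⟨y, hy, rfl⟩ hxy w hw
        rw [htop x hx]
        by_cases hwρ : w = ρ x hx
        · exact Or.inl hwρ
        · obtain ⟨h3, u, hu, rfl, h4⟩ := hshare x hx y hy hxy w hw hwρ
          exact Or.inr (h2 u hu h3 h4)
  · rintro _ ⟨x, hx, rfl⟩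
    rw [hnum x hx, mul_assoc]
    exact (hcomp x hx).card_le
  · rintro h1 _ ⟨x, hx, rfl⟩ hl
    rw [IsBig, hnum x hx]
    rcases hexit x hx with ⟨-, h2⟩ | ⟨e, he, ⟨u, hu, hue, hux⟩, -⟩
    · exact h2 (hβ h1)
    · exact absurd (hclosed x hx ((hleaf x hx).1 hl) u hu (hue ▸ he)) hux
  · intro hcard
    have hb := hbig (hβ hcard)
    choose g hg1 hg2 using fun c : {c | ∃ x ∈ M, c = R.edgesOf x.1} => c.2
    have hg3 : ∀ c, ∃ y ∈ M, y.1 = (g c).2 := fun c => by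
      simpa using (hb _ (hg1 c)).1
    choose y hy1 hy2 using hg3
    refine ⟨fun c => ⟨R.edgesOf (y c).1, y c, hy1 c, rfl⟩, fun c => ?_, fun c => ?_, fun b => ?_⟩
    · rw [IsBig, hnum _ (hy1 c), hy2]
      exact (hb _ (hg1 c)).2
    · change N.IsDescComp c.1 (R.edgesOf (y c).1)
      rw [hg2 c]
      rcases hdesc _ (hg1 c) with h1 | ⟨v, hv, h1⟩
      · exact Or.inl (by rw [hy2, h1])
      · refine Or.inr ⟨v, (hverts _ (hg1 c) v).2 (Or.inr hv), ?_, ?_⟩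
        · rw [htop _ (hg1 c)]
          rintro rfl
          exact hρ _ _ hv
        · obtain ⟨u, hu, hp⟩ := exists_par_eq_top (hne _ (hy1 c)) (hup _ (hy1 c))
          rw [htop _ (hy1 c), h.isAncestor_iff, ← hp]
          exact h1 u (hy2 c ▸ hu)
    · obtain ⟨z, hz, hbz⟩ := b.2
      have h1 : g '' {c | (⟨R.edgesOf (y c).1, y c, hy1 c, rfl⟩ :
          {c | ∃ x ∈ M, c = R.edgesOf x.1}) = b}
          ⊆ ((M.filter fun x => z.1 = x.2).toFinset : Set (Finset V × Finset V)) := by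
        rintro _ ⟨c, hc, rfl⟩
        rw [mem_coe, Multiset.mem_toFinset, Multiset.mem_filter]
        refine ⟨hg1 c, ?_⟩
        have h2 : R.edgesOf (y c).1 = R.edgesOf z.1 := (congrArg Subtype.val hc).trans hbz
        rw [← hinj _ (hy1 c) z hz h2]
        exact hy2 c
      have h2 : Function.Injective g := fun c d hcd => Subtype.ext (by rw [hg2 c, hg2 d, hcd])
      rw [← Set.ncard_image_of_injective _ h2]
      refine (Set.ncard_le_ncard h1 (finite_toSet _)).trans ?_
      rw [Set.ncard_coe_finset]
      refine (Multiset.toFinset_card_le _).trans ?_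
      rw [← Multiset.count_map]
      exact hle (hβ hcard) z.1

/-- The part of the tree above the last cut, with fewer than `Γ k` terminals, is charged to a
component below it. -/
theorem Represents.exists_isDecomposition (h : N.Represents R) (hbin : N.IsBinary) {ε : ℝ}
    (hε : 0 < ε) (hε' : ε ≤ 1 / 32) {k : ℕ} (hk : 1 ≤ k) (hV : ∃ v, v ≠ R.root) :
    ∃ 𝒞 : Set (Set (Sym2 V)), N.IsDecomposition ε k 𝒞 := by
  let L : Finset V := univ.filter (· ∈ N.terminals)
  have hΘ : 1 < Γ ε * k := by
    have h1 : 1 < Γ ε := by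
      rw [Γ, one_lt_div hε]
      linarith
    have h2 : (1 : ℝ) ≤ k := by exact_mod_cast hk
    nlinarith
  have hLmem : ∀ v, v ∈ L ↔ ∀ u, u ≠ R.root → R.par u ≠ v := fun v => by
    rw [← h.isLeaf_iff]
    exact ⟨fun h1 => (mem_filter.1 h1).2, fun h1 => mem_filter.2 ⟨mem_univ _, h1⟩⟩
  have hL : ∀ v ∈ L, R.strictBelow v = ∅ := by
    intro v hv
    by_contra hne
    obtain ⟨w, hw⟩ := nonempty_iff_ne_empty.2 hne
    obtain ⟨u, hu, hp, -⟩ := RTree.exists_child_anc hw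
    exact (hLmem v).1 hv u hu hp
  have hbin' : ∀ v ∉ L, ∃ q q', q ≠ q' ∧ ∀ u, (u ≠ R.root ∧ R.par u = v) ↔ u = q ∨ u = q' := by
    intro v hv
    obtain ⟨q, q', hne, hqq⟩ := Set.ncard_eq_two.1 (hbin v fun hl =>
      hv (mem_filter.2 ⟨mem_univ _, hl⟩))
    refine ⟨q, q', hne, fun u => ?_⟩
    rw [← h.isChild_iff]
    exact Set.ext_iff.1 hqq u
  have hne : (R.strictBelow R.root).Nonempty := by
    obtain ⟨v, hv⟩ := hV
    exact ⟨v, RTree.mem_strictBelow.2 ⟨RTree.root_anc v, hv⟩⟩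
  have hrootL : R.root ∉ L := fun h1 => by
    rw [hL _ h1] at hne
    exact not_nonempty_empty hne
  by_cases hv : Γ ε * k ≤ (R.below R.root ∩ L).card
  · obtain ⟨e, M, b, b', -, hlight, hM⟩ := RTree.exists_isCharging hbin' hL hΘ R.root hv
    obtain ⟨M', Λ, hM'⟩ : ∃ M' Λ, R.IsCharging L (Γ ε * k) (R.strictBelow R.root) M' Λ := by
      by_cases he : e = R.root
      · exact ⟨M, _, he ▸ hM⟩
      · have he' : e ∈ R.strictBelow R.root :=
          RTree.mem_strictBelow.2 ⟨RTree.root_anc e, he⟩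
        have hb := hM.big b (by simp)
        have h1 := RTree.isComponent_sdiff (R := R) (L := L) (Θ := Γ ε * k) (β := True)
          (ρ := R.root) (B := R.strictBelow R.root) (by simp)
          (fun u hu => by
            obtain ⟨h6, h7⟩ := RTree.anc_par_of_mem_strictBelow hu
            exact ⟨h6, or_iff_not_imp_left.2 fun h8 => RTree.mem_strictBelow.2 ⟨h7, h8⟩⟩)
          (fun u hu w hw => RTree.mem_strictBelow.2
            ⟨RTree.root_anc w, hw.ne_root (RTree.mem_strictBelow.1 hu).2⟩) he'
          ((hM.nonempty hb.1).mono (hM.subset hb.1)) (by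
            have h2 : ((R.strictBelow R.root \ R.strictBelow e) ∩ L).card
                ≤ ((R.below R.root \ R.strictBelow e) ∩ L).card :=
              card_le_card (inter_subset_inter_right (sdiff_subset_sdiff
                (by rw [RTree.below_eq_insert]; exact subset_insert _ _) subset_rfl))
            have h3 : (((R.strictBelow R.root \ R.strictBelow e) ∩ L).card : ℝ)
                ≤ ((R.below R.root \ R.strictBelow e) ∩ L).card := by exact_mod_cast h2
            linarith)
        have h2 := hM.insert h1 sdiff_disjoint ⟨e, mem_sdiff.2 ⟨he', by simp⟩,
          fun u hu => (RTree.anc_par_of_mem_strictBelow (hM.subset hb.1 hu)).2⟩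
        rw [sdiff_union_of_subset] at h2
        · exact ⟨_, _, h2⟩
        · intro u hu
          exact RTree.mem_strictBelow.2 ⟨RTree.root_anc u,
            (RTree.anc_par_of_mem_strictBelow hu).1⟩
    refine ⟨_, h.isDecomposition_edgesOf (β := True) M' (fun _ => trivial) hM'.isComponent
      hM'.desc (fun _ x hx => hM'.big _ (Multiset.mem_add.2 (Or.inl (Multiset.mem_map_of_mem _ hx))))
      hM'.countP_eq fun _ b => (Nat.le_add_right _ _).trans
        ((Multiset.count_add _ _ _).symm.trans_le (hM'.count_le b))⟩
  · -- all edges form one component, which need not be big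
    have h1 : R.below R.root ∩ L = R.strictBelow R.root ∩ L := by
      rw [RTree.below_eq_insert, insert_inter_of_notMem hrootL]
    rw [h1] at hv
    refine ⟨_, h.isDecomposition_edgesOf (β := False) {(R.strictBelow R.root, R.strictBelow R.root)}
      (fun h2 => ?_) (fun x hx => ?_) (fun x hx => ?_) False.elim (fun u => ?_) False.elim⟩
    · have h3 : {c | ∃ x ∈ ({(R.strictBelow R.root, R.strictBelow R.root)} :
          Multiset (Finset V × Finset V)), c = R.edgesOf x.1}
          = {R.edgesOf (R.strictBelow R.root)} := by
        ext c
        simp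
      rw [h3, Set.ncard_singleton] at h2
      exact lt_irrefl _ h2
    · rw [Multiset.mem_singleton.1 hx]
      exact RTree.isComponent_strictBelow hne False.elim (by linarith)
    · rw [Multiset.mem_singleton.1 hx]
      exact Or.inl rfl
    · rw [Multiset.map_singleton, Multiset.countP_eq_card_filter, Multiset.filter_singleton]
      split_ifs <;> rfl

end Network

end

end CVRP

theorem mainTheorem7 {V : Type*} [Fintype V] (T : CVRP.Network V) (ε : ℝ) (k : ℕ)
    (hε : 0 < ε) (hε' : ε ≤ 1 / 32) (hk : 1 ≤ k)
    (hT : T.IsWeightedTree) (hbin : T.IsBinary) (hdist : T.HasBoundedDistances ε) :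
    (∃ 𝒞 : Set (Set (Sym2 V)), T.IsDecomposition ε k 𝒞) ∧
    ∀ 𝒞 : Set (Set (Sym2 V)), T.IsDecomposition ε k 𝒞 →
      (T.hat ε 𝒞).IsWeightedTree ∧
      (∀ (x : V ⊕ 𝒞) (p : (T.hat ε 𝒞).graph.Walk (T.hat ε 𝒞).root x), p.IsPath →
        {c : 𝒞 | ∃ y ∈ p.support, y ∈ T.hatVerts c}.ncard ≤ ⌈CVRP.H ε⌉₊) ∧
      ∃ (m : ℕ) (D : Fin m → V ⊕ 𝒞) (n : ℕ) (S : Fin n → (T.hat ε 𝒞).Tour (T.hatLoc D)),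
        (∀ j, ¬ (T.hat ε 𝒞).IsLeaf (D j)) ∧
        CVRP.Network.IsFeasible k S ∧
        (∀ c : 𝒞, ({i | ∃ x ∈ (S i).visited, T.hatLoc D x ∈ T.hatVerts c}.ncard : ℝ) ≤
          2 * CVRP.Γ ε / CVRP.α ε + 1) ∧
        (∀ (c : 𝒞) (i : Fin n), (∃ x ∈ (S i).visited, T.hatLoc D x ∈ T.hatVerts c) →
          CVRP.α ε * k ≤ ({x | x ∈ (S i).visited ∧ T.hatLoc D x ∈ T.hatVerts c}.ncard : ℝ)) ∧
        CVRP.Network.totalCost S < (1 + 3 * ε) * T.opt k := by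
  obtain ⟨R, h⟩ := T.exists_represents hT.1
  have hw := hT.2
  have hD0 : 0 < T.Dmin := h.Dmin_pos hw hε hdist
  have hV : ∃ v, v ≠ R.root := by
    obtain ⟨x, hx, -⟩ := h.exists_terminal R.root
    exact ⟨x, h.terminal_ne_root hw hD0 hx⟩
  refine ⟨h.exists_isDecomposition hbin hε hε' hk hV, fun 𝒞 hd => ?_⟩
  obtain ⟨D, hD⟩ := hd.exists_partition h hV
  obtain ⟨K, hK⟩ := hD.exists_critical h hw (hdist.classWidth_pos h hw hε)
  refine ⟨hD.hat_isWeightedTree h hw K hK, hD.ncard_comp_path_le h hw hε hdist K hK, ?_⟩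
  obtain ⟨n, S, hS, hlt⟩ := h.exists_totalCost_lt hw hD0 hk
    (by linarith : 0 < 1 + 2 * ε) (by linarith : 1 + 2 * ε < 1 + 3 * ε)
  obtain ⟨m, E, n', S', h1, h2, h3, h4, h5⟩ :=
    hd.exists_hat_solution_of_isFeasible h hw hε hε' hdist hk hD K hK S hS
  exact ⟨m, E, n', S', h1, h2, h3, h4, h5.trans_lt hlt⟩
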